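/- Let $d\ge 1$ and let $\mathcal P$ be the set of probability vectors on $\mathbb Z^d$, with the $\sigma$-field generated by the coordinates. An environment is $\omega=(\omega_x)_{x\in\mathbb Z^d}\in\Omega=\mathcal P^{\mathbb Z^d}$, and $\pi_{x,x+z}(\omega)=\omega_x(z)$. The shifts are given by $(T_z\omega)_x=\omega_{x+z}$. For fixed $\omega$, $P_z^\omega$ is the law of the Markov chain $(X_n)_{n\ge0}$ on $\mathbb Z^d$ with $X_0=z$ and transition probabilities $\pi_{xy}(\omega)$. Given a probability measure $\mathbb P$ on $\Omega$, $P_z(d\omega,dX)=P_z^\omega(dX)\,\mathbb P(d\omega)$ is the joint annealed law, and $E_z$ is expectation under $P_z$. Write $|\cdot|$ for the $\ell^1$-norm. Let $\mathbb P$ be an i.i.d. product measure on $\Omega$, let $\hat u\in\mathbb R^d\setminus\{0\}$, and assume: (forbidden direction $-\hat u$) $\mathbb P\big(\sum_{z:\,z\cdot\hat u\ge0}\pi_{0z}=1\big)=1$; (N) there is a constant $\delta>0$ with $\mathbb P\big(\sum_z z\cdot\hat u\,\pi_{0z}\ge\delta\big)=1$; (M) there are constants $p>1$ and $M>0$ with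 $\mathbb P\big(\sum_z|z|^p\pi_{0z}\le M^p\big)=1$. For integers $k$ let $\mathfrak S_k=\sigma(\omega_x: x\cdot\hat u\ge k)$, and let $\hat\pi(\omega,A)=P_0^\omega(T_{X_1}\omega\in A)$ be the kernel of the environment chain. Let $D(\omega)=E_0^\omega(X_1)=\sum_z z\,\pi_{0z}(\omega)$ be the drift and $\sigma_1=\inf\{n: X_n\cdot\hat u\ge X_0\cdot\hat u+1\}$. Then there is exactly one probability measure $\mathbb P_\infty$ on $\Omega$ that is invariant under $\hat\pi$, is absolutely continuous with respect to $\mathbb P$ on $\mathfrak S_k$ for every integer $k\le 0$, and under which the environment chain is ergodic (every measurable $A$ with $\hat\pi(\omega,A)=\mathbf 1_A(\omega)$ for $\mathbb P_\infty$-a.e. $\omega$ has $\mathbb P_\infty(A)\in\{0,1\}$). For $\mathbb P_\infty$-a.e. $\omega$ the sum defining $D(\omega)$ converges absolutely, and $D$ is $\mathbb P_\infty$-integrable. With $v=\mathbb E_\infty(D)=\int D\,d\mathbb P_\infty$ the law of large numbers holds: $$P_0\Big(\lim_{n\to\infty}n^{-1}X_n=v\Big)=1.$$ Moreover $E_0(\sigma_1)<\infty$,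 $X_{\sigma_1}$ and every $X_n$ are $P_0$-integrable, $$v=\frac{E_0(X_{\sigma_1})}{E_0(\sigma_1)},\qquad\text{and}\qquad \sup_{n}|E_0(X_n)-nv|<\infty.$$ -/

import Mathlib

open MeasureTheory ProbabilityTheory Filter Topology
open scoped ENNReal

noncomputable section

namespace RWRE

/-- The lattice `ℤ^d`. -/
abbrev Site (d : ℕ) : Type := Fin d → ℤ

/-- The space `𝒫` of probability vectors carries the σ-field generated by the coordinates. -/
instance instMeasurableSpacePMF {α : Type*} : MeasurableSpace (PMF α) :=
  MeasurableSpace.comap (fun (p : PMF α) (a : α) => p a) MeasurableSpace.pi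

/-- Environments: `ω x z` is the probability `π_{x,x+z}(ω)` of the jump `z` from the site `x`.
The space carries the product σ-field. -/
abbrev Env (d : ℕ) : Type := Site d → PMF (Site d)

/-- Walk paths `(X_n)_{n ≥ 0}`, with the product σ-field. -/
abbrev Path (d : ℕ) : Type := ℕ → Site d

variable {d : ℕ}

/-- The inclusion of `ℤ^d` into `ℝ^d`. -/
def toReal (z : Site d) : Fin d → ℝ := fun i => (z i : ℝ)

/-- The `l¹`-norm. -/
def l1 (x : Fin d → ℝ) : ℝ := ∑ i, |x i|

/-- The level `x · u` of the site `x`. -/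
def level (u : Fin d → ℝ) (x : Site d) : ℝ := ∑ i, (x i : ℝ) * u i

/-- The shift: `π_{x,y}(T_z ω) = π_{x+z,y+z}(ω)`. -/
def shift (z : Site d) (ω : Env d) : Env d := fun x => ω (x + z)

lemma measurable_pmf_apply {α : Type*} (a : α) : Measurable fun p : PMF α => p a :=
  (measurable_pi_apply a).comp (comap_measurable (fun (p : PMF α) (a : α) => p a))

lemma measurable_shift (z : Site d) : Measurable (shift z : Env d → Env d) :=
  measurable_pi_lambda _ fun x => measurable_pi_apply (x + z)

/-- The law of an i.i.d. environment whose site marginal is `μ`. -/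
def iidEnvLaw (μ : Measure (PMF (Site d))) [IsProbabilityMeasure μ] : Measure (Env d) :=
  Measure.infinitePi fun _ : Site d => μ

/-! ### The walk -/

/-- The one-step transition of the walk in the environment `ω` at time `n`, as a function of the
history: from `x = X_n` jump to `x + z` with probability `ω x z`. -/
def stepKernel (ω : Env d) (n : ℕ) : Kernel (Finset.Iic n → Site d) (Site d) where
  toFun h := ((ω (h ⟨n, by simp⟩)).map fun z => h ⟨n, by simp⟩ + z).toMeasure
  measurable' := measurable_of_countable _

instance (ω : Env d) (n : ℕ) : IsMarkovKernel (stepKernel ω n) :=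
  ⟨fun _ => PMF.toMeasure.isProbabilityMeasure _⟩

/-- The quenched law `P_z^ω` on paths: the law of the Markov chain started at `z`. -/
def quenchedLaw (ω : Env d) (z : Site d) : Measure (Path d) :=
  Kernel.traj (X := fun _ => Site d) (stepKernel ω) 0 fun _ => z

instance (ω : Env d) (z : Site d) : IsProbabilityMeasure (quenchedLaw ω z) := by
  unfold quenchedLaw; infer_instance

lemma stepKernel_singleton (ω : Env d) (n : ℕ) (h : Finset.Iic n → Site d) (y : Site d) :
    stepKernel ω n h {y} = ω (h ⟨n, by simp⟩) (y - h ⟨n, by simp⟩) := by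
  have h1 : ∀ a : Site d, y = h ⟨n, by simp⟩ + a ↔ a = y - h ⟨n, by simp⟩ := fun a =>
    ⟨fun e => by rw [e]; simp, fun e => by rw [e]; simp⟩
  change ((ω (h ⟨n, by simp⟩)).map fun z => h ⟨n, by simp⟩ + z).toMeasure {y} = _
  rw [PMF.toMeasure_apply_singleton _ _ (measurableSet_singleton y), PMF.map_apply]
  simp only [h1]
  rw [tsum_eq_single (y - h ⟨n, by simp⟩)]
  · simp
  · intro b hb
    simp [hb]

/-- The cylinder probabilities of the quenched law. -/
lemma quenchedLaw_cylinder (ω : Env d) (z : Site d) (w : Path d) (n : ℕ) :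
    quenchedLaw ω z {X | ∀ i ≤ n, X i = w i} =
      if w 0 = z then ∏ i ∈ Finset.range n, ω (w i) (w (i + 1) - w i) else 0 := by
  induction n with
  | zero =>
    have h0 : (quenchedLaw ω z).map (Preorder.frestrictLe 0) =
        Measure.dirac (fun _ : Finset.Iic 0 => z) := by
      unfold quenchedLaw
      rw [Kernel.traj_map_frestrictLe_apply, Kernel.partialTraj_self, Kernel.id_apply]
    have hm : MeasurableSet {h : Finset.Iic 0 → Site d | h ⟨0, by simp⟩ = w 0} :=
      MeasurableSet.of_discrete
    have := congrArg (fun ν => ν {h : Finset.Iic 0 → Site d | h ⟨0, by simp⟩ = w 0}) h0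
    beta_reduce at this
    rw [Measure.map_apply (Preorder.measurable_frestrictLe 0) hm, Measure.dirac_apply' _ hm] at this
    have e : {X : Path d | ∀ i ≤ 0, X i = w i} =
        Preorder.frestrictLe 0 ⁻¹' {h : Finset.Iic 0 → Site d | h ⟨0, by simp⟩ = w 0} := by
      ext X; simp
    rw [e, this]
    by_cases hz : w 0 = z
    · simp [hz]
    · simp [hz, Ne.symm hz]
  | succ n ih =>
    have key := Kernel.partialTraj_compProd_eq_map_traj (X := fun _ => Site d)
      (κ := stepKernel ω) (Nat.zero_le n) (x₀ := fun _ => z)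
    set S : Set (Finset.Iic n → Site d) := {h | ∀ i, h i = w i}
    have hS : MeasurableSet S := MeasurableSet.of_discrete
    have hT : MeasurableSet (S ×ˢ ({w (n + 1)} : Set (Site d))) := hS.prod (measurableSet_singleton _)
    have h1 := congrArg (fun ν => ν (S ×ˢ ({w (n + 1)} : Set (Site d)))) key
    beta_reduce at h1
    rw [Measure.map_apply (by fun_prop) hT, Measure.compProd_apply_prod hS (measurableSet_singleton _)]
      at h1
    have e1 : (fun X : Path d => ((Preorder.frestrictLe n X : Finset.Iic n → Site d), X (n + 1))) ⁻¹'
        (S ×ˢ {w (n + 1)}) = {X | ∀ i ≤ n + 1, X i = w i} := by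
      ext X
      simp only [S, Set.mem_preimage, Set.mem_prod, Set.mem_ofPred_eq, Set.mem_singleton_iff]
      constructor
      · rintro ⟨a, b⟩ i hi
        rcases Nat.le_succ_iff.1 hi with h | h
        · exact a ⟨i, by simpa using h⟩
        · rw [h]; exact b
      · intro a
        refine ⟨fun i => a i ?_, a _ le_rfl⟩
        have := Finset.mem_Iic.1 i.2
        omega
    have e2 : {X : Path d | ∀ i ≤ n, X i = w i} = Preorder.frestrictLe n ⁻¹' S := by
      ext X
      simp only [S, Set.mem_preimage, Set.mem_ofPred_eq]
      exact ⟨fun a i => a i (Finset.mem_Iic.1 i.2), fun a i hi => a ⟨i, by simpa using hi⟩⟩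
    have e3 : Kernel.partialTraj (X := fun _ => Site d) (stepKernel ω) 0 n (fun _ => z) S =
        quenchedLaw ω z {X | ∀ i ≤ n, X i = w i} := by
      rw [e2, ← Measure.map_apply (Preorder.measurable_frestrictLe n) hS]
      unfold quenchedLaw
      rw [Kernel.traj_map_frestrictLe_apply]
    have e4 : ∫⁻ h in S, stepKernel ω n h {w (n + 1)}
          ∂(Kernel.partialTraj (X := fun _ => Site d) (stepKernel ω) 0 n fun _ => z) =
        ω (w n) (w (n + 1) - w n) * quenchedLaw ω z {X | ∀ i ≤ n, X i = w i} := by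
      rw [← e3, ← setLIntegral_const]
      refine setLIntegral_congr_fun hS fun h hh => ?_
      have hn : h ⟨n, by simp⟩ = w n := hh ⟨n, by simp⟩
      simp only [stepKernel_singleton, hn]
    rw [e1, e4, ih] at h1
    refine h1.symm.trans ?_
    by_cases hz : w 0 = z
    · simp only [hz, if_true, Finset.prod_range_succ, mul_comm]
    · simp [hz]

lemma measurable_quenchedLaw (z : Site d) : Measurable fun ω : Env d => quenchedLaw ω z := by
  refine Measure.measurable_of_measurable_coe _ fun t ht => ?_
  induction t, ht using MeasurableSpace.induction_on_inter
    generateFrom_measurableCylinders.symm isPiSystem_measurableCylinders with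
  | empty => simp
  | basic t ht =>
    rw [measurableCylinders_nat] at ht
    simp only [Set.mem_iUnion, Set.mem_singleton_iff] at ht
    obtain ⟨N, S, -, rfl⟩ := ht
    have hcyl : ∀ ω : Env d, quenchedLaw ω z (cylinder (Finset.Iic N) S) =
        ∑' h : S, quenchedLaw ω z {X | ∀ i ≤ N, X i = if hi : i ≤ N then
          (h : Finset.Iic N → Site d) ⟨i, by simpa using hi⟩ else 0} := by
      intro ω
      rw [← measure_iUnion]
      · congr 1
        ext X
        simp only [mem_cylinder, Set.mem_iUnion, Set.mem_ofPred_eq]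
        constructor
        · intro hX
          exact ⟨⟨_, hX⟩, fun i hi => by simp [hi]⟩
        · rintro ⟨⟨h, hS⟩, hX⟩
          convert! hS using 1
          ext1 i
          have hi := Finset.mem_Iic.1 i.2
          simpa [hi] using hX i hi
      · rintro ⟨h, hS⟩ ⟨h', hS'⟩ hne
        refine Set.disjoint_left.2 fun X hX hX' => hne ?_
        ext1
        funext i
        have hi := Finset.mem_Iic.1 i.2
        have a := hX i hi
        have b := hX' i hi
        simp only [hi, dif_pos] at a b
        exact a.symm.trans b
      · intro h
        rw [Set.ofPred_forall]
        refine MeasurableSet.iInter fun i => ?_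
        rw [Set.ofPred_forall]
        exact MeasurableSet.iInter fun _ => measurable_pi_apply i (measurableSet_singleton _)
    simp only [hcyl, quenchedLaw_cylinder]
    refine Measurable.tsum fun h => ?_
    exact Measurable.ite (MeasurableSet.const _) (Finset.measurable_prod _ fun i _ =>
      (measurable_pmf_apply _).comp (measurable_pi_apply _)) measurable_const
  | compl t ht ih =>
    simp only [prob_compl_eq_one_sub ht]
    exact measurable_const.sub ih
  | iUnion f hd hf ih =>
    simp only [measure_iUnion hd hf]
    exact Measurable.tsum ih

/-- The quenched laws as a kernel from environments to paths. -/
def quenchedKernel (z : Site d) : Kernel (Env d) (Path d) where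
  toFun ω := quenchedLaw ω z
  measurable' := measurable_quenchedLaw z

instance (z : Site d) : IsMarkovKernel (quenchedKernel (d := d) z) :=
  ⟨fun ω => inferInstanceAs (IsProbabilityMeasure (quenchedLaw ω z))⟩

/-- The joint annealed law `P_z(dω, dX) = P_z^ω(dX) P(dω)`. -/
def annealedLaw (P : Measure (Env d)) (z : Site d) : Measure (Env d × Path d) :=
  P ⊗ₘ quenchedKernel z

/-! ### The assumptions -/

/-- Forbidden direction `-u`: almost surely `∑_{z · u ≥ 0} π_{0z} = 1`. -/
def ForbiddenDirection (P : Measure (Env d)) (u : Fin d → ℝ) : Prop :=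
  ∀ᵐ ω ∂P, ∑' z : {z : Site d // 0 ≤ level u z}, ω 0 z = 1

/-- Non-nestling in direction `u`: for a deterministic `δ > 0`,
almost surely `∑_z (z · u) π_{0z} ≥ δ`. -/
def NonNestling (P : Measure (Env d)) (u : Fin d → ℝ) : Prop :=
  ∃ δ : ℝ, 0 < δ ∧ ∀ᵐ ω ∂P, δ ≤ ∑' z : Site d, level u z * (ω 0 z).toReal

/-- The moment hypothesis with exponent `p`: for a deterministic `M > 0`,
almost surely `∑_z |z|^p π_{0z} ≤ M^p`. -/
def MomentHypothesis (P : Measure (Env d)) (p : ℝ) : Prop :=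
  ∃ M : ℝ, 0 < M ∧
    ∀ᵐ ω ∂P, ∑' z : Site d, ENNReal.ofReal (l1 (toReal z) ^ p) * ω 0 z ≤ ENNReal.ofReal (M ^ p)

/-! ### The environment chain and its equilibrium measure -/

lemma measurable_shift_path :
    Measurable fun s : Env d × Path d => shift (s.2 1) s.1 := by
  have h : Measurable fun q : Env d × Site d => shift q.2 q.1 :=
    measurable_from_prod_countable_left fun x => measurable_shift x
  exact h.comp (measurable_fst.prodMk ((measurable_pi_apply 1).comp measurable_snd))

/-- The kernel `π̂(ω, A) = P_0^ω(T_{X_1} ω ∈ A)` of the environment chain. -/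
def envKernel : Kernel (Env d) (Env d) :=
  (Kernel.id ×ₖ quenchedKernel 0).map fun s : Env d × Path d => shift (s.2 1) s.1

lemma envKernel_apply (ω : Env d) {A : Set (Env d)} (hA : MeasurableSet A) :
    envKernel ω A = quenchedLaw ω 0 {X | shift (X 1) ω ∈ A} := by
  have hm := measurable_shift_path (d := d) hA
  rw [envKernel, Kernel.map_apply' _ measurable_shift_path _ hA, Kernel.prod_apply,
    Kernel.id_apply, Measure.prod_apply hm, lintegral_dirac' _ (measurable_measure_prodMk_left hm)]
  rfl

/-- The σ-field `𝔖_k` generated by `ω_x` with `x · u ≥ k`. -/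
abbrev halfSpace (u : Fin d → ℝ) (k : ℤ) : MeasurableSpace (Env d) :=
  ⨆ x : {x : Site d // (k : ℝ) ≤ level u x},
    MeasurableSpace.comap (fun ω : Env d => ω x) inferInstance

/-- Ergodicity of the stationary Markov process with kernel `κ` and initial law `Q`:
every almost surely invariant set is trivial. -/
def IsErgodicChain {α : Type*} [MeasurableSpace α] (κ : Kernel α α) (Q : Measure α) : Prop :=
  ∀ A : Set α, MeasurableSet A → (∀ᵐ ω ∂Q, κ ω A = A.indicator 1 ω) → Q A = 0 ∨ Q A = 1

/-- `Q` is an invariant probability measure of the environment chain, absolutely continuous with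
respect to `P` on `𝔖_k` for every `k ≤ 0`, under which the environment chain is ergodic. -/
structure IsEquilibrium (P : Measure (Env d)) (u : Fin d → ℝ) (Q : Measure (Env d)) : Prop where
  isProbabilityMeasure : IsProbabilityMeasure Q
  invariant : envKernel.Invariant Q
  absolutelyContinuous : ∀ k : ℤ, k ≤ 0 → ∀ A : Set (Env d),
    MeasurableSet[halfSpace u k] A → P A = 0 → Q A = 0
  ergodic : IsErgodicChain envKernel Q

/-- The drift `D(ω) = E_0^ω(X_1) = ∑_z z π_{0z}(ω)`. -/
def drift (ω : Env d) : Fin d → ℝ := ∑' z : Site d, (ω 0 z).toReal • toReal z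

/-- `σ_1 = inf {n : X_n · u ≥ X_0 · u + 1}`, with value `⊤` if there is no such `n`. -/
def sigma1 (u : Fin d → ℝ) (X : Path d) : ℕ∞ :=
  ⨅ (n : ℕ) (_ : level u (X 0) + 1 ≤ level u (X n)), (n : ℕ∞)

/-- The position `X_{σ_1}`, which is used where `σ_1 < ∞`. -/
def posSigma1 (u : Fin d → ℝ) (X : Path d) : Site d := X (sigma1 u X).toNat

end RWRE

end

noncomputable section

namespace RWRE

variable {d : ℕ}

/-! ### Measures on paths -/

/-! The walk never decreases its level. When it stands strictly above everything visited before, the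
environment from its level on is unexplored, and whatever lies strictly below is never read again by
the walk. The times `reg`, at each of which at least one level has been gained since the preceding
one, are therefore regeneration times without any conditioning on the future: after such a time
there is an independent copy of the environment and the walk, glued to the explored past
(`lintegral_regeneration`).

The moment bound with `p > 1` allows the level increments to be truncated at a deterministic `K`
while a mean gain `ε` per step survives. Before one level is gained the truncated increments add up
to at most `1 + K`, so the mean of `σ_1` is at most `(1 + K) / ε`, uniformly over good environments
and starting points (`lintegral_sigma1_le`). If a functional looks `k` levels back and `L` levels
ahead, then its sums over the blocks between regenerations are identically distributed from the
`k`-th block on, and independent when their indices differ by at least `k + 1 + L`. The strong law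
along residue classes, followed by interpolation, gives `ae_tendsto_average`.

The equilibrium measure is the occupation measure of the environment seen from the walk during one
block, divided by the mean of `σ_1`, with infinitely many independent blocks glued behind. For a
function that looks `k` levels back only `k` of them matter, and the glued block can be replaced by
the actual `k`-th block (`lintegral_equilibrium_of_envLocal`). This gives absolute continuity on
half-spaces, and invariance by telescoping.

Now let `Q` be any invariant probability measure with the half-space absolute continuity. The
averages of a cylinder `A` converge to its equilibrium mass almost surely under `Q` too. Multiplying
them by the indicator of an invariant set `B` and integrating gives `Q (B ∩ A) = Q B * equilibrium
A` (`HalfSpaceAC.measureReal_inter`). The choice `B = univ` is uniqueness; the choice `Q =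
equilibrium` makes `B` independent of itself, which is ergodicity.

The mean displacement over a block equals the mean of the summed drifts, hence mean `σ_1` times the
mean drift in equilibrium. For the bounded error, Wald's identity is applied to the blocks that
begin before time `n`; the last of them exceeds `n` by a time of bounded mean
(`lintegral_sum_jump_bounds`). -/

lemma measurable_path_comp {α : Type*} [MeasurableSpace α] (g : Site d → α) (n : ℕ) :
    Measurable fun X : Path d => g (X n) :=
  (measurable_of_countable g).comp (measurable_pi_apply n)

lemma measurable_path_comp_sub {α : Type*} [MeasurableSpace α] (g : Site d → α) (m n : ℕ) :
    Measurable fun X : Path d => g (X m - X n) := by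
  have h : Measurable fun X : Path d => (X m, X n) :=
    (measurable_pi_apply m).prodMk (measurable_pi_apply n)
  exact (measurable_of_countable fun q : Site d × Site d => g (q.1 - q.2)).comp h

/-- The paths which agree with `w` up to time `n`. -/
def pathCyl (n : ℕ) (w : Path d) : Set (Path d) := {X | ∀ i ≤ n, X i = w i}

lemma mem_pathCyl {n : ℕ} {w X : Path d} : X ∈ pathCyl n w ↔ ∀ i ≤ n, X i = w i := Iff.rfl

lemma measurableSet_pathCyl (n : ℕ) (w : Path d) : MeasurableSet (pathCyl n w) := by
  have : pathCyl n w = ⋂ i : ℕ, ⋂ _ : i ≤ n, (fun X : Path d => X i) ⁻¹' {w i} := by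
    ext X; simp [pathCyl]
  rw [this]
  exact MeasurableSet.iInter fun i => MeasurableSet.iInter fun _ =>
    measurable_pi_apply i (measurableSet_singleton _)

/-- The extension of a finite path by a constant. -/
def extendPath (n : ℕ) (h : Finset.Iic n → Site d) : Path d := fun i => h ⟨min i n, by simp⟩

lemma pathCyl_extendPath (n : ℕ) (h : Finset.Iic n → Site d) :
    pathCyl n (extendPath n h) = (Preorder.frestrictLe n : Path d → _) ⁻¹' {h} := by
  ext X
  simp only [pathCyl, extendPath, Set.mem_ofPred_eq, Set.mem_preimage, Set.mem_singleton_iff]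
  constructor
  · intro hX
    funext i
    have hi := Finset.mem_Iic.1 i.2
    have := hX i hi
    simpa [hi] using this
  · rintro rfl i hi
    simp [hi]

lemma iUnion_pathCyl (n : ℕ) : ⋃ h, pathCyl (d := d) n (extendPath n h) = Set.univ := by
  ext X; simp [pathCyl_extendPath]

lemma pairwise_disjoint_pathCyl (n : ℕ) :
    Pairwise (Function.onFun Disjoint fun h => pathCyl (d := d) n (extendPath n h)) := by
  intro h h' hne
  simp only [Function.onFun, pathCyl_extendPath]
  exact Disjoint.preimage _ (Set.disjoint_singleton.2 hne)

lemma lintegral_eq_tsum_pathCyl (n : ℕ) (ν : Measure (Path d)) (f : Path d → ℝ≥0∞) :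
    ∫⁻ X, f X ∂ν = ∑' h, ∫⁻ X in pathCyl n (extendPath n h), f X ∂ν := by
  rw [← lintegral_iUnion (fun h => measurableSet_pathCyl n _) (pairwise_disjoint_pathCyl n),
    iUnion_pathCyl, setLIntegral_univ]

/-- There are only countably many paths up to time `n`, so the masses of single initial segments
determine the finite-dimensional laws. -/
lemma path_measure_ext {ν ν' : Measure (Path d)} [IsFiniteMeasure ν]
    (h : ∀ n w, ν (pathCyl n w) = ν' (pathCyl n w)) : ν = ν' := by
  have hmap : ∀ n, ν.map (Preorder.frestrictLe n) = ν'.map (Preorder.frestrictLe n) := by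
    intro n
    refine Measure.ext_of_singleton fun a => ?_
    rw [Measure.map_apply (Preorder.measurable_frestrictLe n) (measurableSet_singleton a),
      Measure.map_apply (Preorder.measurable_frestrictLe n) (measurableSet_singleton a),
      ← pathCyl_extendPath, h]
  have hcyl : ∀ n (S : Set (Finset.Iic n → Site d)),
      ν (Preorder.frestrictLe n ⁻¹' S) = ν' (Preorder.frestrictLe n ⁻¹' S) := by
    intro n S
    rw [← Measure.map_apply (Preorder.measurable_frestrictLe n) MeasurableSet.of_discrete,
      hmap, Measure.map_apply (Preorder.measurable_frestrictLe n) MeasurableSet.of_discrete]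
  refine ext_of_generate_finite _ generateFrom_measurableCylinders.symm
    isPiSystem_measurableCylinders (fun s hs => ?_) ?_
  · rw [measurableCylinders_nat] at hs
    simp only [Set.mem_iUnion, Set.mem_singleton_iff] at hs
    obtain ⟨N, S, -, rfl⟩ := hs
    exact hcyl N S
  · simpa using hcyl 0 Set.univ

/-- The path seen from time `n` on, relative to the position at that time. -/
def pathShift (n : ℕ) (X : Path d) : Path d := fun k => X (n + k) - X n

lemma measurable_pathShift (n : ℕ) : Measurable (pathShift n : Path d → Path d) :=
  measurable_pi_lambda _ fun k => (measurable_pi_apply (n + k)).sub (measurable_pi_apply n)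

lemma quenchedLaw_pathCyl (ω : Env d) (z : Site d) (n : ℕ) (w : Path d) :
    quenchedLaw ω z (pathCyl n w) =
      if w 0 = z then ∏ i ∈ Finset.range n, ω (w i) (w (i + 1) - w i) else 0 :=
  quenchedLaw_cylinder ω z w n

lemma quenchedLaw_ae_zero (ω : Env d) (z : Site d) : ∀ᵐ X ∂quenchedLaw ω z, X 0 = z := by
  have h := quenchedLaw_pathCyl ω z 0 fun _ => z
  simp only [if_true, Finset.range_zero, Finset.prod_empty] at h
  rw [← prob_compl_eq_zero_iff (measurableSet_pathCyl _ _)] at h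
  filter_upwards [compl_mem_ae_iff.2 h] with X hX
  exact not_not.1 (fun hh => hX (fun h' => hh (h' 0 le_rfl)))

/-- The Markov property on a cylinder. -/
lemma restrict_pathCyl_map_pathShift (ω : Env d) (z : Site d) (n : ℕ) (w : Path d) :
    ((quenchedLaw ω z).restrict (pathCyl n w)).map (pathShift n) =
      quenchedLaw ω z (pathCyl n w) • quenchedLaw (shift (w n) ω) 0 := by
  have : IsFiniteMeasure (((quenchedLaw ω z).restrict (pathCyl n w)).map (pathShift n)) :=
    Measure.isFiniteMeasure_map _ _
  refine path_measure_ext fun m v => ?_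
  rw [Measure.map_apply (measurable_pathShift n) (measurableSet_pathCyl m v),
    Measure.restrict_apply (measurable_pathShift n (measurableSet_pathCyl m v)),
    Measure.smul_apply, smul_eq_mul, quenchedLaw_pathCyl _ 0]
  by_cases hv : v 0 = 0
  -- The concatenation of `w` with `v` translated to start at `w n`; the cylinder probability of `c`
  -- factors at time `n`.
  · set c : Path d := fun i => if i ≤ n then w i else v (i - n) + w n with hc
    have hcn : ∀ k, c (n + k) = v k + w n := by
      intro k
      rcases Nat.eq_zero_or_pos k with rfl | hk
      · simp [hc, hv]
      · simp [hc, hk.ne']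
    have hset : pathShift n ⁻¹' pathCyl m v ∩ pathCyl n w = pathCyl (n + m) c := by
      ext X
      simp only [Set.mem_inter_iff, Set.mem_preimage, mem_pathCyl, pathShift]
      constructor
      · rintro ⟨h1, h2⟩ i hi
        by_cases hin : i ≤ n
        · simp [hc, hin, h2]
        · obtain ⟨k, rfl⟩ := Nat.exists_eq_add_of_le (not_le.1 hin).le
          rw [hcn, ← h1 k (by omega), h2 n le_rfl]
          simp
      · intro h
        have h2 : ∀ i ≤ n, X i = w i := fun i hi => by
          rw [h i (by omega)]; simp [hc, hi]
        refine ⟨fun i hi => ?_, h2⟩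
        rw [h (n + i) (by omega), hcn, h2 n le_rfl]
        simp
    rw [hset, quenchedLaw_pathCyl, quenchedLaw_pathCyl]
    have h0 : c 0 = w 0 := by simp [hc]
    rw [h0, if_pos hv, Finset.prod_range_add]
    have h1 : ∏ i ∈ Finset.range n, ω (c i) (c (i + 1) - c i) =
        ∏ i ∈ Finset.range n, ω (w i) (w (i + 1) - w i) := by
      refine Finset.prod_congr rfl fun i hi => ?_
      have := Finset.mem_range.1 hi
      simp [hc, this.le, Nat.succ_le_of_lt this]
    have h2 : ∏ x ∈ Finset.range m, ω (c (n + x)) (c (n + x + 1) - c (n + x)) =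
        ∏ i ∈ Finset.range m, shift (w n) ω (v i) (v (i + 1) - v i) := by
      refine Finset.prod_congr rfl fun i _ => ?_
      rw [add_assoc, hcn, hcn]
      simp [shift]
    rw [h1, h2]
    split_ifs <;> simp
  · rw [if_neg hv, mul_zero]
    have : pathShift n ⁻¹' pathCyl m v ∩ pathCyl n w = ∅ := by
      rw [Set.eq_empty_iff_forall_notMem]
      rintro X ⟨h1, -⟩
      have := h1 0 (Nat.zero_le _)
      simp only [pathShift, add_zero, sub_self] at this
      exact hv this.symm
    rw [this, measure_empty]

/-- The Markov property. The function of the past has to depend on the past only for paths with a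
property which holds almost surely. -/
lemma lintegral_pathShift_of_ae (ω : Env d) (z : Site d) (n : ℕ) {R : Path d → Prop}
    (hR : ∀ᵐ X ∂quenchedLaw ω z, R X) (Φ : Path d → Path d → ℝ≥0∞)
    (hΦ : ∀ X, Measurable (Φ X))
    (hdep : ∀ X X', R X → R X' → (∀ i ≤ n, X i = X' i) → Φ X = Φ X') :
    ∫⁻ X, Φ X (pathShift n X) ∂quenchedLaw ω z =
      ∫⁻ X, ∫⁻ Y, Φ X Y ∂quenchedLaw (shift (X n) ω) 0 ∂quenchedLaw ω z := by
  rw [lintegral_eq_tsum_pathCyl n, lintegral_eq_tsum_pathCyl n]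
  refine tsum_congr fun h => ?_
  -- A cylinder that meets `R` can be represented by a path `w` in `R`, which freezes the first
  -- argument of `Φ`. A cylinder that misses `R` is a null set.
  by_cases hex : ∃ w, R w ∧ w ∈ pathCyl n (extendPath n h)
  · obtain ⟨w, hw, hwc⟩ := hex
    have hcyl : pathCyl n (extendPath n h) = pathCyl n w := by
      ext X
      exact ⟨fun hX i hi => (hX i hi).trans (hwc i hi).symm,
        fun hX i hi => (hX i hi).trans (hwc i hi)⟩
    rw [hcyl]
    have h1 : ∫⁻ X in pathCyl n w, Φ X (pathShift n X) ∂quenchedLaw ω z =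
        ∫⁻ X in pathCyl n w, Φ w (pathShift n X) ∂quenchedLaw ω z := by
      refine setLIntegral_congr_fun_ae (measurableSet_pathCyl n w) ?_
      filter_upwards [hR] with X hRX hX
      rw [hdep X w hRX hw hX]
    have h2 : ∫⁻ X in pathCyl n w, ∫⁻ Y, Φ X Y ∂quenchedLaw (shift (X n) ω) 0
        ∂quenchedLaw ω z =
        ∫⁻ X in pathCyl n w, ∫⁻ Y, Φ w Y ∂quenchedLaw (shift (w n) ω) 0 ∂quenchedLaw ω z := by
      refine setLIntegral_congr_fun_ae (measurableSet_pathCyl n w) ?_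
      filter_upwards [hR] with X hRX hX
      simp only [hdep X w hRX hw hX, hX n le_rfl]
    rw [h1, h2, setLIntegral_const, ← lintegral_map (hΦ w) (measurable_pathShift n),
      restrict_pathCyl_map_pathShift, lintegral_smul_measure, smul_eq_mul, mul_comm]
  · have h0 : quenchedLaw ω z (pathCyl n (extendPath n h)) = 0 :=
      measure_mono_null (fun X hX hr => hex ⟨X, hr, hX⟩) (ae_iff.1 hR)
    rw [setLIntegral_measure_zero _ _ h0, setLIntegral_measure_zero _ _ h0]

/-- The Markov property. -/
lemma lintegral_pathShift (ω : Env d) (z : Site d) (n : ℕ) (Φ : Path d → Path d → ℝ≥0∞)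
    (hΦ : ∀ X, Measurable (Φ X)) (hdep : ∀ X X', (∀ i ≤ n, X i = X' i) → Φ X = Φ X') :
    ∫⁻ X, Φ X (pathShift n X) ∂quenchedLaw ω z =
      ∫⁻ X, ∫⁻ Y, Φ X Y ∂quenchedLaw (shift (X n) ω) 0 ∂quenchedLaw ω z :=
  lintegral_pathShift_of_ae ω z n (R := fun _ => True) (ae_of_all _ fun _ => trivial) Φ hΦ
    fun X X' _ _ h => hdep X X' h

/-! ### Single steps of the walk and of the environment chain -/

lemma quenchedLaw_map_one (ω : Env d) (z : Site d) :
    (quenchedLaw ω z).map (fun X => X 1 - z) = (ω z).toMeasure := by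
  refine Measure.ext_of_singleton fun a => ?_
  rw [Measure.map_apply (measurable_path_comp (fun y : Site d => y - z) 1) (measurableSet_singleton a),
    PMF.toMeasure_apply_singleton _ _ (measurableSet_singleton a)]
  have h := quenchedLaw_pathCyl ω z 1 fun i => if i = 0 then z else z + a
  simp only [if_true, Finset.range_one, Finset.prod_singleton, zero_add, one_ne_zero, if_false,
    add_sub_cancel_left] at h
  rw [← h]
  refine measure_congr ?_
  filter_upwards [quenchedLaw_ae_zero ω z] with X hX
  refine propext ⟨fun h i hi => ?_, fun h => ?_⟩
  · have h : X 1 - z = a := h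
    interval_cases i
    · simpa using hX
    · simp [← h]
  · have := h 1 le_rfl
    change X 1 - z = a
    rw [this]; simp

lemma lintegral_toMeasure_eq_tsum (q : PMF (Site d)) (g : Site d → ℝ≥0∞) :
    ∫⁻ z, g z ∂q.toMeasure = ∑' z, g z * q z := by
  rw [lintegral_countable']
  refine tsum_congr fun z => ?_
  rw [PMF.toMeasure_apply_singleton _ _ (measurableSet_singleton z)]

lemma lintegral_quenchedLaw_one (ω : Env d) (g : Site d → ℝ≥0∞) :
    ∫⁻ X, g (X 1) ∂quenchedLaw ω 0 = ∑' z, g z * ω 0 z := by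
  rw [← lintegral_toMeasure_eq_tsum, ← quenchedLaw_map_one,
    lintegral_map (measurable_of_countable g) (by fun_prop)]
  simp

/-- The mean of a function of the jump of the walk from the origin. -/
def jumpMean (g : Site d → ℝ≥0∞) (ω : Env d) : ℝ≥0∞ := ∑' z, g z * ω 0 z

lemma measurable_jumpMean (g : Site d → ℝ≥0∞) : Measurable (jumpMean g) :=
  Measurable.tsum fun z =>
    ((measurable_pmf_apply z).comp (measurable_pi_apply (0 : Site d))).const_mul (g z)

/-- One step of the walk after time `n`. -/
lemma lintegral_mul_jump (ω : Env d) (z : Site d) (n : ℕ) (F : Path d → ℝ≥0∞)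
    (hdep : ∀ X X', (∀ i ≤ n, X i = X' i) → F X = F X') (g : Site d → ℝ≥0∞) :
    ∫⁻ X, F X * g (X (n + 1) - X n) ∂quenchedLaw ω z =
      ∫⁻ X, F X * jumpMean g (shift (X n) ω) ∂quenchedLaw ω z := by
  have h := lintegral_pathShift ω z n (fun X Y => F X * g (Y 1))
    (fun X => ((measurable_of_countable g).comp (measurable_pi_apply 1)).const_mul _)
    (fun X X' h => by simp only [hdep X X' h])
  refine h.trans (lintegral_congr fun X => ?_)
  rw [lintegral_const_mul _ (measurable_path_comp g 1),
    lintegral_quenchedLaw_one]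
  rfl

lemma envKernel_eq_map (ω : Env d) :
    envKernel ω = (quenchedLaw ω 0).map fun X => shift (X 1) ω := by
  ext A hA
  rw [envKernel_apply ω hA, Measure.map_apply _ hA]
  · rfl
  · exact (measurable_of_countable fun z : Site d => shift z ω).comp (measurable_pi_apply 1)

lemma lintegral_envKernel (ω : Env d) {f : Env d → ℝ≥0∞} (hf : Measurable f) :
    ∫⁻ η, f η ∂envKernel ω = jumpMean (fun z => f (shift z ω)) ω := by
  rw [envKernel_eq_map, lintegral_map hf]
  · exact lintegral_quenchedLaw_one ω fun z => f (shift z ω)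
  · exact (measurable_of_countable fun z : Site d => shift z ω).comp (measurable_pi_apply 1)

/-! ### Levels -/

lemma level_add (u : Fin d → ℝ) (x y : Site d) : level u (x + y) = level u x + level u y := by
  simp [level, add_mul, Finset.sum_add_distrib]

lemma level_sub (u : Fin d → ℝ) (x y : Site d) : level u (x - y) = level u x - level u y := by
  simp [level, sub_mul, Finset.sum_sub_distrib]

@[simp] lemma level_zero (u : Fin d → ℝ) : level u (0 : Site d) = 0 := by simp [level]

/-- No jump with a negative level. -/
def Forward (u : Fin d → ℝ) (q : PMF (Site d)) : Prop := ∀ z, level u z < 0 → q z = 0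

/-- Two environments without backward jumps which agree on the levels `≥ 0` have the same walk
from the origin. -/
lemma quenchedLaw_congr (u : Fin d → ℝ) {ω ω' : Env d}
    (hω : ∀ x, 0 ≤ level u x → Forward u (ω x)) (h : ∀ x, 0 ≤ level u x → ω x = ω' x) :
    quenchedLaw ω 0 = quenchedLaw ω' 0 := by
  refine path_measure_ext fun n w => ?_
  rw [quenchedLaw_pathCyl, quenchedLaw_pathCyl]
  by_cases hw : w 0 = 0
  · rw [if_pos hw, if_pos hw]
    by_cases hall : ∀ i < n, 0 ≤ level u (w i)
    · exact Finset.prod_congr rfl fun i hi => by rw [h _ (hall i (Finset.mem_range.1 hi))]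
    -- At the first visit below level zero the path makes a backward jump from a site where the two
    -- environments agree, so both products contain a zero factor.
    · have hex : ∃ i, i < n ∧ level u (w i) < 0 := by
        push Not at hall
        exact hall
      classical
      have hi := Nat.find_spec hex
      have hmin := fun j => Nat.find_min hex (m := j)
      set i := Nat.find hex
      obtain ⟨k, hk⟩ : ∃ k, i = k + 1 := by
        refine Nat.exists_eq_succ_of_ne_zero fun h0 => ?_
        have := hi.2
        rw [h0, hw, level_zero] at this
        exact lt_irrefl _ this
      have hk0 : 0 ≤ level u (w k) := by
        have := hmin k (by omega)
        push Not at this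
        exact this (by omega)
      have hz : level u (w (k + 1) - w k) < 0 := by
        rw [level_sub]
        have := hi.2
        rw [hk] at this
        linarith
      have e1 := hω _ hk0 _ hz
      have e2 : ω' (w k) (w (k + 1) - w k) = 0 := by rw [← h _ hk0]; exact e1
      have hkn : k ∈ Finset.range n := Finset.mem_range.2 (by omega)
      rw [Finset.prod_eq_zero hkn e1, Finset.prod_eq_zero hkn e2]
  · rw [if_neg hw, if_neg hw]

/-- At every site the mean of the indicator of a backward jump vanishes; there are only countably
many times. -/
lemma quenchedLaw_ae_monotone (u : Fin d → ℝ) {ω : Env d} (hω : ∀ x, Forward u (ω x))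
    (z : Site d) : ∀ᵐ X ∂quenchedLaw ω z, Monotone fun n => level u (X n) := by
  have h : ∀ n, ∀ᵐ X ∂quenchedLaw ω z, level u (X n) ≤ level u (X (n + 1)) := by
    intro n
    have := lintegral_mul_jump ω z n (fun _ => 1) (fun _ _ _ => rfl)
      ({a | level u a < 0}.indicator 1)
    have h0 : ∀ X : Path d, jumpMean ({a | level u a < 0}.indicator 1) (shift (X n) ω) = 0 := by
      intro X
      refine ENNReal.tsum_eq_zero.2 fun a => ?_
      by_cases ha : level u a < 0
      · have : shift (X n) ω 0 a = 0 := hω _ a ha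
        rw [this, mul_zero]
      · simp [ha]
    simp only [h0, mul_zero, lintegral_zero, one_mul] at this
    rw [lintegral_eq_zero_iff (measurable_path_comp_sub _ _ _)] at this
    filter_upwards [this] with X hX
    by_contra hlt
    have : level u (X (n + 1) - X n) < 0 := by rw [level_sub]; linarith
    simp [this] at hX
  filter_upwards [ae_all_iff.2 h] with X hX
  exact monotone_nat_of_le_succ hX

/-! ### The law of the environment -/

instance (μ : Measure (PMF (Site d))) [IsProbabilityMeasure μ] :
    IsProbabilityMeasure (iidEnvLaw μ) := by
  unfold iidEnvLaw; infer_instance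

lemma shift_shift (a b : Site d) (ω : Env d) : shift a (shift b ω) = shift (a + b) ω := by
  funext x; simp [shift, add_assoc]

@[simp] lemma shift_zero (ω : Env d) : shift 0 ω = ω := by
  funext x; simp [shift]

/-- The environment which is `ω` on `S` and `ω'` off `S`. -/
def patch (S : Set (Site d)) (ω ω' : Env d) : Env d :=
  open scoped Classical in fun y => if y ∈ S then ω y else ω' y

lemma patch_of_mem {S : Set (Site d)} (ω ω' : Env d) {y : Site d} (h : y ∈ S) :
    patch S ω ω' y = ω y := by simp [patch, h]

lemma patch_of_notMem {S : Set (Site d)} (ω ω' : Env d) {y : Site d} (h : y ∉ S) :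
    patch S ω ω' y = ω' y := by simp [patch, h]

lemma measurable_patch (S : Set (Site d)) :
    Measurable fun q : Env d × Env d => patch S q.1 q.2 := by
  refine measurable_pi_lambda _ fun y => ?_
  by_cases hy : y ∈ S
  · simp only [patch_of_mem _ _ hy]
    exact (measurable_pi_apply y).comp measurable_fst
  · simp only [patch_of_notMem _ _ hy]
    exact (measurable_pi_apply y).comp measurable_snd

section
variable (μ : Measure (PMF (Site d))) [IsProbabilityMeasure μ]

lemma measurePreserving_shift (z : Site d) :
    MeasurePreserving (shift z) (iidEnvLaw μ) (iidEnvLaw μ) := by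
  refine ⟨measurable_shift z, ?_⟩
  refine Measure.eq_infinitePi _ fun s t ht => ?_
  classical
  rw [Measure.map_apply (measurable_shift z)
    (MeasurableSet.pi s.countable_toSet fun i _ => ht i)]
  have : shift z ⁻¹' Set.pi s t =
      Set.pi (s.map (addRightEmbedding z) : Finset (Site d)) fun i => t (i - z) := by
    ext ω
    simp only [shift, Set.mem_preimage, Set.mem_pi, Finset.mem_coe, Finset.mem_map,
      addRightEmbedding_apply, forall_exists_index, and_imp, forall_apply_eq_imp_iff₂,
      add_sub_cancel_right]
  rw [this, iidEnvLaw, Measure.infinitePi_pi _ fun i _ => ht _, Finset.prod_map]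
  simp

/-- Resampling the sites off `S` independently leaves a product measure unchanged. This is what
produces the fresh environment ahead of the walk. -/
lemma measurePreserving_patch (S : Set (Site d)) :
    MeasurePreserving (fun q : Env d × Env d => patch S q.1 q.2)
      ((iidEnvLaw μ).prod (iidEnvLaw μ)) (iidEnvLaw μ) := by
  refine ⟨measurable_patch S, ?_⟩
  refine Measure.eq_infinitePi _ fun s t ht => ?_
  classical
  rw [Measure.map_apply (measurable_patch S) (MeasurableSet.pi s.countable_toSet fun i _ => ht i)]
  have : (fun q : Env d × Env d => patch S q.1 q.2) ⁻¹' Set.pi s t =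
      Set.pi (s.filter (· ∈ S) : Finset (Site d)) t ×ˢ
        Set.pi (s.filter (· ∉ S) : Finset (Site d)) t := by
    ext q
    simp only [Set.mem_preimage, Set.mem_pi, Set.mem_prod, Finset.coe_filter, Set.mem_ofPred_eq,
      Finset.mem_coe]
    constructor
    · intro h
      refine ⟨fun i hi => ?_, fun i hi => ?_⟩
      · simpa [patch_of_mem _ _ hi.2] using h i hi.1
      · simpa [patch_of_notMem _ _ hi.2] using h i hi.1
    · rintro ⟨h1, h2⟩ i hi
      by_cases hiS : i ∈ S
      · simpa [patch_of_mem _ _ hiS] using h1 i ⟨hi, hiS⟩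
      · simpa [patch_of_notMem _ _ hiS] using h2 i ⟨hi, hiS⟩
  rw [this, Measure.prod_prod, iidEnvLaw, Measure.infinitePi_pi _ fun i _ => ht _,
    Measure.infinitePi_pi _ fun i _ => ht _]
  exact Finset.prod_filter_mul_prod_filter_not s (· ∈ S) _

lemma iidEnvLaw_ae_forall {r : PMF (Site d) → Prop} (h : ∀ᵐ ω ∂iidEnvLaw μ, r (ω 0)) :
    ∀ᵐ ω ∂iidEnvLaw μ, ∀ x, r (ω x) := by
  refine ae_all_iff.2 fun x => ?_
  have := (measurePreserving_shift μ x).quasiMeasurePreserving.ae h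
  filter_upwards [this] with ω hω
  simpa [shift] using hω

end

/-! ### Consequences of the hypotheses for a single site -/

lemma l1_nonneg (x : Fin d → ℝ) : 0 ≤ l1 x := Finset.sum_nonneg fun _ _ => abs_nonneg _

lemma abs_le_l1 (x : Fin d → ℝ) (i : Fin d) : |x i| ≤ l1 x :=
  Finset.single_le_sum (f := fun i => |x i|) (fun _ _ => abs_nonneg _) (Finset.mem_univ i)

lemma l1_eq_zero_or_one_le (z : Site d) : l1 (toReal z) = 0 ∨ 1 ≤ l1 (toReal z) := by
  have h : l1 (toReal z) = ((∑ i, |z i| : ℤ) : ℝ) := by simp [l1, toReal]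
  rw [h]
  rcases (Finset.sum_nonneg fun i _ => abs_nonneg (z i) : 0 ≤ ∑ i, |z i|).eq_or_lt with h0 | h0
  · left; rw [← h0]; simp
  · right; exact_mod_cast h0

lemma level_le_mul_l1 (u : Fin d → ℝ) (z : Site d) :
    level u z ≤ (1 + ∑ i, |u i|) * l1 (toReal z) := by
  have h : ∀ i, (z i : ℝ) * u i ≤ |u i| * l1 (toReal z) := fun i => by
    calc (z i : ℝ) * u i ≤ |(z i : ℝ) * u i| := le_abs_self _
      _ = |u i| * |toReal z i| := by rw [abs_mul, mul_comm]; rfl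
      _ ≤ _ := mul_le_mul_of_nonneg_left (abs_le_l1 _ i) (abs_nonneg _)
  calc level u z ≤ ∑ i, |u i| * l1 (toReal z) := Finset.sum_le_sum fun i _ => h i
    _ = (∑ i, |u i|) * l1 (toReal z) := by rw [Finset.sum_mul]
    _ ≤ _ := by nlinarith [l1_nonneg (toReal z)]

/-- The jump distribution `q` has no backward jumps, its truncated mean in direction `u` is at
least `ε`, and its first absolute moment is at most `M`. -/
structure GoodSite (u : Fin d → ℝ) (K ε M : ℝ) (q : PMF (Site d)) : Prop where
  forward : Forward u q
  trunc : ENNReal.ofReal ε ≤ ∑' z, ENNReal.ofReal (min (level u z) K) * q z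
  moment : ∑' z, ENNReal.ofReal (l1 (toReal z)) * q z ≤ ENNReal.ofReal M

lemma forward_of_tsum_eq_one {u : Fin d → ℝ} {q : PMF (Site d)}
    (h : ∑' z : {z : Site d // 0 ≤ level u z}, q z = 1) : Forward u q := by
  have h1 := ENNReal.summable.tsum_add_tsum_compl (s := {z : Site d | 0 ≤ level u z}) (f := q)
    ENNReal.summable
  rw [q.tsum_coe] at h1
  have h2 : ∑' z : {z : Site d | 0 ≤ level u z}, q z = 1 := h
  rw [h2] at h1
  have h3 : ∑' z : ({z : Site d | 0 ≤ level u z}ᶜ : Set (Site d)), q z = 0 := by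
    refine (ENNReal.add_right_inj ENNReal.one_ne_top).1 (h1.trans (add_zero 1).symm)
  intro z hz
  exact ENNReal.tsum_eq_zero.1 h3 ⟨z, not_le.2 hz⟩

lemma ofReal_le_tsum_level {u : Fin d → ℝ} {q : PMF (Site d)} (hq : Forward u q) {δ : ℝ}
    (h : δ ≤ ∑' z : Site d, level u z * (q z).toReal) :
    ENNReal.ofReal δ ≤ ∑' z, ENNReal.ofReal (level u z) * q z := by
  refine ENNReal.ofReal_le_of_le_toReal (h.trans (le_of_eq ?_))
  rw [ENNReal.tsum_toReal_eq fun z => ENNReal.mul_ne_top ENNReal.ofReal_ne_top (q.apply_ne_top z)]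
  refine tsum_congr fun z => ?_
  rw [ENNReal.toReal_mul]
  rcases lt_or_ge (level u z) 0 with hz | hz
  · rw [hq z hz]; simp
  · rw [ENNReal.toReal_ofReal hz]

/-- A level above `U * T` forces a length `l > T`, and then `l ≤ T ^ (-(p - 1)) * l ^ p`. Thus the
`p`-th moment controls uniformly what a truncation of the level loses. -/
lemma level_le_min_add {u : Fin d → ℝ} {T p : ℝ} (hT : 0 < T) (hp : 1 < p) (z : Site d) :
    level u z ≤ min (level u z) ((1 + ∑ i, |u i|) * T) +
      (1 + ∑ i, |u i|) * T ^ (-(p - 1)) * l1 (toReal z) ^ p := by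
  set U := 1 + ∑ i, |u i|
  have hU : 0 < U := by positivity
  rcases le_or_gt (level u z) (U * T) with h | h
  · rw [min_eq_left h]
    have : 0 ≤ U * T ^ (-(p - 1)) * l1 (toReal z) ^ p :=
      mul_nonneg (by positivity) (Real.rpow_nonneg (l1_nonneg _) _)
    linarith
  · have h1 := level_le_mul_l1 u z
    have hl : T < l1 (toReal z) := lt_of_mul_lt_mul_left (h.trans_le h1) hU.le
    have hl0 : 0 < l1 (toReal z) := hT.trans hl
    have h2 : l1 (toReal z) ≤ T ^ (-(p - 1)) * l1 (toReal z) ^ p := by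
      have e : l1 (toReal z) ^ p = l1 (toReal z) ^ (p - 1) * l1 (toReal z) := by
        rw [← Real.rpow_add_one hl0.ne']; ring_nf
      rw [e, ← mul_assoc, Real.rpow_neg hT.le]
      have : 1 ≤ (T ^ (p - 1))⁻¹ * l1 (toReal z) ^ (p - 1) := by
        rw [inv_mul_eq_div, one_le_div (Real.rpow_pos_of_pos hT _)]
        exact Real.rpow_le_rpow hT.le hl.le (by linarith)
      nlinarith
    have h3 : U * l1 (toReal z) ≤ U * (T ^ (-(p - 1)) * l1 (toReal z) ^ p) :=
      mul_le_mul_of_nonneg_left h2 hU.le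
    have h4 : 0 ≤ min (level u z) (U * T) := by
      rw [min_eq_right h.le]; positivity
    rw [mul_assoc]
    linarith

/-- The truncation level depends only on `u`, `p`, `δ` and `M`, not on the jump distribution: the
loss is at most `U * T ^ (-(p - 1)) * M ^ p`, which falls below `δ / 2` for large `T`. -/
lemma exists_goodSite (u : Fin d → ℝ) {p δ M : ℝ} (hp : 1 < p) (hδ : 0 < δ) (hM : 0 < M) :
    ∃ K, 0 ≤ K ∧ ∀ q : PMF (Site d), Forward u q →
      δ ≤ ∑' z : Site d, level u z * (q z).toReal →
      ∑' z : Site d, ENNReal.ofReal (l1 (toReal z) ^ p) * q z ≤ ENNReal.ofReal (M ^ p) →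
      GoodSite u K (δ / 2) (M ^ p) q := by
  set U := 1 + ∑ i, |u i| with hUdef
  have hU : 0 < U := by positivity
  have hlim : Tendsto (fun T : ℝ => U * T ^ (-(p - 1)) * M ^ p) atTop (𝓝 0) := by
    have := ((tendsto_rpow_neg_atTop (sub_pos.2 hp)).const_mul U).mul_const (M ^ p)
    simpa using this
  obtain ⟨T, hT1, hT2⟩ := ((hlim.eventually (gt_mem_nhds (half_pos hδ))).and
    (eventually_gt_atTop 0)).exists
  refine ⟨U * T, by positivity, fun q hq hd hm => ⟨hq, ?_, ?_⟩⟩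
  · have h1 : ∑' z, ENNReal.ofReal (level u z) * q z ≤
        ∑' z, ENNReal.ofReal (min (level u z) (U * T)) * q z + ENNReal.ofReal (δ / 2) := by
      calc ∑' z, ENNReal.ofReal (level u z) * q z
          ≤ ∑' z, (ENNReal.ofReal (min (level u z) (U * T)) * q z +
            ENNReal.ofReal (U * T ^ (-(p - 1))) *
              (ENNReal.ofReal (l1 (toReal z) ^ p) * q z)) := by
            refine ENNReal.tsum_le_tsum fun z => ?_
            rw [← mul_assoc, ← add_mul]
            gcongr
            rw [← ENNReal.ofReal_mul (by positivity)]
            exact (ENNReal.ofReal_le_ofReal (level_le_min_add hT2 hp z)).trans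
              ENNReal.ofReal_add_le
        _ = ∑' z, ENNReal.ofReal (min (level u z) (U * T)) * q z +
            ENNReal.ofReal (U * T ^ (-(p - 1))) *
              ∑' z, ENNReal.ofReal (l1 (toReal z) ^ p) * q z := by
            rw [ENNReal.tsum_add, ENNReal.tsum_mul_left]
        _ ≤ _ := by
            gcongr
            refine (mul_le_mul_right hm _).trans ?_
            rw [← ENNReal.ofReal_mul (by positivity)]
            exact ENNReal.ofReal_le_ofReal hT1.le
    have h2 := (ofReal_le_tsum_level hq hd).trans h1
    rw [← add_halves δ, ENNReal.ofReal_add (by positivity) (by positivity), add_halves] at h2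
    exact (ENNReal.add_le_add_iff_right ENNReal.ofReal_ne_top).1 h2
  · refine le_trans (ENNReal.tsum_le_tsum fun z => ?_) hm
    gcongr
    -- Lengths of lattice vectors are `0` or at least `1`, so the first power is dominated by the
    -- `p`-th.
    rcases l1_eq_zero_or_one_le z with h | h
    · rw [h, Real.zero_rpow (by linarith)]
    · exact Real.self_le_rpow_of_one_le h hp.le

/-- Almost every environment is good at every site. -/
structure Ballistic (μ : Measure (PMF (Site d))) [IsProbabilityMeasure μ] (u : Fin d → ℝ)
    (K ε M : ℝ) : Prop where
  K_nonneg : 0 ≤ K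
  ε_pos : 0 < ε
  M_nonneg : 0 ≤ M
  good : ∀ᵐ ω ∂iidEnvLaw μ, ∀ x, GoodSite u K ε M (ω x)

lemma exists_ballistic (μ : Measure (PMF (Site d))) [IsProbabilityMeasure μ] (u : Fin d → ℝ)
    (hforb : ForbiddenDirection (iidEnvLaw μ) u) (hN : NonNestling (iidEnvLaw μ) u)
    {p : ℝ} (hp : 1 < p) (hM : MomentHypothesis (iidEnvLaw μ) p) :
    ∃ K ε M, Ballistic μ u K ε M := by
  obtain ⟨δ, hδ, hN⟩ := hN
  obtain ⟨M, hM0, hM⟩ := hM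
  obtain ⟨K, hK, h⟩ := exists_goodSite u hp hδ hM0
  refine ⟨K, δ / 2, M ^ p, hK, half_pos hδ, by positivity, iidEnvLaw_ae_forall μ ?_⟩
  filter_upwards [hforb, hN, hM] with ω h1 h2 h3
  exact h _ (forward_of_tsum_eq_one h1) h2 h3

/-! ### The time needed to gain one level -/

/-- The path gains less than one level up to time `n`, that is, `σ_1 > n`. -/
def NotHit (u : Fin d → ℝ) (n : ℕ) (X : Path d) : Prop :=
  ∀ j ≤ n, level u (X j) < level u (X 0) + 1

lemma NotHit.congr {u : Fin d → ℝ} {n : ℕ} {X X' : Path d} (h : ∀ i ≤ n, X i = X' i) :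
    NotHit u n X ↔ NotHit u n X' :=
  forall₂_congr fun j hj => by rw [h j hj, h 0 (Nat.zero_le n)]

lemma measurableSet_notHit (u : Fin d → ℝ) (n : ℕ) : MeasurableSet {X : Path d | NotHit u n X} := by
  have : {X : Path d | NotHit u n X} =
      ⋂ j : ℕ, ⋂ _ : j ≤ n, {X : Path d | level u (X j) < level u (X 0) + 1} := by
    ext X; simp [NotHit]
  rw [this]
  exact MeasurableSet.iInter fun j => MeasurableSet.iInter fun _ =>
    measurableSet_lt (measurable_path_comp (level u) j)
      ((measurable_path_comp (level u) 0).add_const 1)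

/-- The value of `σ_1` where it is finite. -/
def sig (u : Fin d → ℝ) (X : Path d) : ℕ := (sigma1 u X).toNat

lemma sigma1_eq_coe {u : Fin d → ℝ} {X : Path d} {k : ℕ}
    (hk : level u (X 0) + 1 ≤ level u (X k)) (h : ∀ j < k, level u (X j) < level u (X 0) + 1) :
    sigma1 u X = k := by
  refine le_antisymm (iInf₂_le k hk) (le_iInf₂ fun n hn => ?_)
  by_contra hlt
  exact absurd (h n (by exact_mod_cast not_le.1 hlt)) (not_lt.2 hn)

lemma sig_eq {u : Fin d → ℝ} {X : Path d} {k : ℕ}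
    (hk : level u (X 0) + 1 ≤ level u (X k)) (h : ∀ j < k, level u (X j) < level u (X 0) + 1) :
    sig u X = k := by
  rw [sig, sigma1_eq_coe hk h, ENat.toNat_natCast]

lemma sig_spec {u : Fin d → ℝ} {X : Path d} (h : ∃ n, level u (X 0) + 1 ≤ level u (X n)) :
    level u (X 0) + 1 ≤ level u (X (sig u X)) ∧
      ∀ j < sig u X, level u (X j) < level u (X 0) + 1 := by
  classical
  have h1 := Nat.find_spec h
  have h2 : ∀ j < Nat.find h, level u (X j) < level u (X 0) + 1 := fun j hj =>
    not_le.1 (Nat.find_min h hj)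
  rw [sig_eq h1 h2]
  exact ⟨h1, h2⟩

lemma sigma1_eq_sig {u : Fin d → ℝ} {X : Path d} (h : ∃ n, level u (X 0) + 1 ≤ level u (X n)) :
    sigma1 u X = sig u X :=
  sigma1_eq_coe (sig_spec h).1 (sig_spec h).2

lemma sigma1_eq_top {u : Fin d → ℝ} {X : Path d} (h : ∀ n, level u (X n) < level u (X 0) + 1) :
    sigma1 u X = ⊤ := by
  rw [sigma1, iInf₂_eq_top]
  exact fun n hn => absurd (h n) (not_lt.2 hn)

lemma sig_pos {u : Fin d → ℝ} {X : Path d} (h : ∃ n, level u (X 0) + 1 ≤ level u (X n)) :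
    0 < sig u X := by
  refine Nat.pos_of_ne_zero fun h0 => ?_
  have := (sig_spec h).1
  rw [h0] at this
  linarith

lemma notHit_iff_lt_sig {u : Fin d → ℝ} {X : Path d}
    (h : ∃ n, level u (X 0) + 1 ≤ level u (X n)) (n : ℕ) : NotHit u n X ↔ n < sig u X := by
  refine ⟨fun hn => ?_, fun hn j hj => (sig_spec h).2 j (by omega)⟩
  by_contra hle
  exact absurd (hn _ (not_lt.1 hle)) (not_lt.2 (sig_spec h).1)

/-- The tail-sum form of `σ_1`, valid also where it is infinite. It yields measurability and turns
expectations into sums over times before the hit. -/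
lemma sigma1_eq_tsum (u : Fin d → ℝ) (X : Path d) :
    (sigma1 u X : ℝ≥0∞) = ∑' n, {X : Path d | NotHit u n X}.indicator 1 X := by
  by_cases h : ∃ n, level u (X 0) + 1 ≤ level u (X n)
  · rw [sigma1_eq_sig h, tsum_eq_sum (s := Finset.range (sig u X))]
    · rw [Finset.sum_congr rfl fun n hn => Set.indicator_of_mem
        (show X ∈ {X : Path d | NotHit u n X} from
          (notHit_iff_lt_sig h n).2 (Finset.mem_range.1 hn)) 1]
      simp
    · intro n hn
      refine Set.indicator_of_notMem (fun hX => hn ?_) _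
      exact Finset.mem_range.2 ((notHit_iff_lt_sig h n).1 hX)
  · push Not at h
    have : ∀ n, {X : Path d | NotHit u n X}.indicator (1 : Path d → ℝ≥0∞) X = 1 := fun n =>
      Set.indicator_of_mem (show X ∈ {X : Path d | NotHit u n X} from fun j _ => h j) 1
    simp only [this, sigma1_eq_top h]
    simp

lemma measurable_sigma1 (u : Fin d → ℝ) : Measurable fun X : Path d => (sigma1 u X : ℝ≥0∞) := by
  simp only [sigma1_eq_tsum]
  exact Measurable.tsum fun n => measurable_one.indicator (measurableSet_notHit u n)

lemma measurable_sig (u : Fin d → ℝ) : Measurable (sig u : Path d → ℕ) := by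
  have : (sig u : Path d → ℕ) = fun X => ⌊((sigma1 u X : ℝ≥0∞)).toReal⌋₊ := by
    funext X
    unfold sig
    cases sigma1 u X with
    | top => simp
    | coe n => simp
  rw [this]
  exact Nat.measurable_floor.comp (measurable_sigma1 u).ennreal_toReal

/-- The truncated level increments before the path has gained one level. -/
lemma sum_trunc_le {u : Fin d → ℝ} {K : ℝ} (hK : 0 ≤ K) {X : Path d}
    (hX : Monotone fun n => level u (X n)) (n : ℕ) :
    ∑ i ∈ Finset.range n, {X : Path d | NotHit u i X}.indicator (1 : Path d → ℝ≥0∞) X *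
      ENNReal.ofReal (min (level u (X (i + 1) - X i)) K) ≤ ENNReal.ofReal (1 + K) := by
  set s : ℕ → ℝ≥0∞ := fun i => {X : Path d | NotHit u i X}.indicator (1 : Path d → ℝ≥0∞) X *
      ENNReal.ofReal (min (level u (X (i + 1) - X i)) K) with hs
  -- The induction carries a sharper bound before the hit, namely the level gained so far, which is
  -- then less than `1`. The jump that reaches the next level adds at most `K`, and later terms
  -- vanish.
  suffices h : ∀ n, (NotHit u n X →
      ∑ i ∈ Finset.range n, s i ≤ ENNReal.ofReal (level u (X n) - level u (X 0))) ∧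
      ∑ i ∈ Finset.range n, s i ≤ ENNReal.ofReal (1 + K) from (h n).2
  intro n
  induction n with
  | zero => simp
  | succ n ih =>
    rw [Finset.sum_range_succ]
    by_cases hn : NotHit u n X
    · have h1 := ih.1 hn
      have h2 : s n = ENNReal.ofReal (min (level u (X (n + 1) - X n)) K) := by
        simp [hs, hn]
      have h3 : 0 ≤ level u (X n) - level u (X 0) := sub_nonneg.2 (hX (Nat.zero_le n))
      have h4 : level u (X (n + 1) - X n) = level u (X (n + 1)) - level u (X n) := level_sub _ _ _
      have h5 : 0 ≤ level u (X (n + 1) - X n) := by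
        rw [h4]; exact sub_nonneg.2 (hX (Nat.le_succ n))
      have h6 : ∑ i ∈ Finset.range n, s i + s n ≤ ENNReal.ofReal
          (level u (X n) - level u (X 0) + min (level u (X (n + 1) - X n)) K) := by
        rw [h2, ENNReal.ofReal_add h3 (le_min h5 hK)]
        gcongr
      have h7 := hn n le_rfl
      refine ⟨fun _ => h6.trans (ENNReal.ofReal_le_ofReal ?_),
        h6.trans (ENNReal.ofReal_le_ofReal ?_)⟩
      · have := min_le_left (level u (X (n + 1) - X n)) K
        linarith
      · have := min_le_right (level u (X (n + 1) - X n)) K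
        linarith
    · have h2 : s n = 0 := by simp [hs, hn]
      rw [h2, add_zero]
      exact ⟨fun h => absurd (fun j hj => h j (by omega)) hn, ih.2⟩

lemma jumpMean_shift (g : Site d → ℝ≥0∞) (x : Site d) (ω : Env d) :
    jumpMean g (shift x ω) = ∑' z, g z * ω x z := by
  simp [jumpMean, shift]

/-- Optional stopping by hand: every step taken before the hit has conditional mean truncated gain
at least `ε`, whereas the total truncated gain is at most `1 + K`. The bound depends neither on the
good environment nor on the starting point. -/
lemma lintegral_sigma1_le {u : Fin d → ℝ} {K ε M : ℝ} (hK : 0 ≤ K) (hε : 0 < ε) {ω : Env d}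
    (hω : ∀ x, GoodSite u K ε M (ω x)) (z : Site d) :
    ∫⁻ X, (sigma1 u X : ℝ≥0∞) ∂quenchedLaw ω z ≤ ENNReal.ofReal ((1 + K) / ε) := by
  have hmeas : ∀ i, Measurable ({X : Path d | NotHit u i X}.indicator (1 : Path d → ℝ≥0∞)) :=
    fun i => measurable_one.indicator (measurableSet_notHit u i)
  simp only [sigma1_eq_tsum]
  rw [lintegral_tsum fun i => (hmeas i).aemeasurable, ENNReal.tsum_eq_iSup_nat]
  refine iSup_le fun n => ?_
  rw [ENNReal.ofReal_div_of_pos hε, ENNReal.le_div_iff_mul_le (Or.inl (by simpa using hε))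
    (Or.inl ENNReal.ofReal_ne_top), Finset.sum_mul]
  set g : Site d → ℝ≥0∞ := fun z => ENNReal.ofReal (min (level u z) K)
  calc ∑ i ∈ Finset.range n,
        (∫⁻ X, {X : Path d | NotHit u i X}.indicator 1 X ∂quenchedLaw ω z) * ENNReal.ofReal ε
      ≤ ∑ i ∈ Finset.range n, ∫⁻ X, {X : Path d | NotHit u i X}.indicator 1 X *
          g (X (i + 1) - X i) ∂quenchedLaw ω z := by
        refine Finset.sum_le_sum fun i _ => ?_
        rw [lintegral_mul_jump, ← lintegral_mul_const _ (hmeas i)]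
        · refine lintegral_mono fun X => ?_
          rw [jumpMean_shift]
          exact mul_le_mul_right (hω (X i)).trunc _
        · intro X X' h
          have := NotHit.congr (u := u) h
          by_cases hX : NotHit u i X
          · simp [hX, this.1 hX]
          · simp [hX, mt this.2 hX]
    _ = ∫⁻ X, ∑ i ∈ Finset.range n, {X : Path d | NotHit u i X}.indicator 1 X *
          g (X (i + 1) - X i) ∂quenchedLaw ω z :=
        (lintegral_finsetSum _ fun i _ => (hmeas i).mul (measurable_path_comp_sub g _ _)).symm
    _ ≤ ∫⁻ _, ENNReal.ofReal (1 + K) ∂quenchedLaw ω z := by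
        refine lintegral_mono_ae ?_
        filter_upwards [quenchedLaw_ae_monotone u (fun x => (hω x).forward) z] with X hX
        exact sum_trunc_le hK hX n
    _ = ENNReal.ofReal (1 + K) := by simp

/-- A path from the origin whose level never decreases and grows without bound. -/
structure Regular (u : Fin d → ℝ) (X : Path d) : Prop where
  zero : X 0 = 0
  mono : Monotone fun n => level u (X n)
  hits : ∀ n, ∃ m, level u (X n) + 1 ≤ level u (X m)

/-- By the Markov property, the uniform bound on the mean of `σ_1` also applies to the walk seen
from each time `n`, so another level is gained after every time. -/
lemma quenchedLaw_ae_regular {u : Fin d → ℝ} {K ε M : ℝ} (hK : 0 ≤ K) (hε : 0 < ε) {ω : Env d}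
    (hω : ∀ x, GoodSite u K ε M (ω x)) : ∀ᵐ X ∂quenchedLaw ω 0, Regular u X := by
  have h : ∀ n, ∀ᵐ X ∂quenchedLaw ω 0, (sigma1 u (pathShift n X) : ℝ≥0∞) < ∞ := by
    intro n
    refine ae_lt_top ((measurable_sigma1 u).comp (measurable_pathShift n)) (ne_of_lt ?_)
    change ∫⁻ X, (fun _ : Path d => fun Y : Path d => (sigma1 u Y : ℝ≥0∞)) X (pathShift n X)
      ∂quenchedLaw ω 0 < ∞
    rw [lintegral_pathShift ω 0 n _ (fun _ => measurable_sigma1 u) fun _ _ _ => rfl]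
    refine lt_of_le_of_lt (lintegral_mono fun X => lintegral_sigma1_le (M := M) hK hε
      (fun x => ?_) 0) (b := ∫⁻ _, ENNReal.ofReal ((1 + K) / ε) ∂quenchedLaw ω 0) ?_
    · exact hω _
    · simp
  filter_upwards [quenchedLaw_ae_zero ω 0, quenchedLaw_ae_monotone u (fun x => (hω x).forward) 0,
    ae_all_iff.2 h] with X h0 hm hs
  refine ⟨h0, hm, fun n => ?_⟩
  by_contra hn
  push Not at hn
  have := hs n
  rw [sigma1_eq_top] at this
  · simp at this
  · intro m
    simp only [pathShift, level_sub, add_zero]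
    have := hn (n + m)
    linarith

/-! ### Regeneration times -/

lemma pathShift_pathShift (m n : ℕ) (X : Path d) :
    pathShift m (pathShift n X) = pathShift (n + m) X := by
  funext k; simp [pathShift, add_assoc]

lemma Regular.pathShift {u : Fin d → ℝ} {X : Path d} (hX : Regular u X) (n : ℕ) :
    Regular u (pathShift n X) := by
  refine ⟨by simp [RWRE.pathShift], fun a b hab => ?_, fun a => ?_⟩
  · simp only [RWRE.pathShift, level_sub]
    have := hX.mono (show n + a ≤ n + b by omega)
    simp only at this
    linarith
  · obtain ⟨m, hm⟩ := hX.hits (n + a)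
    have h1 : n ≤ m := by
      by_contra hlt
      have := hX.mono (show m ≤ n + a by omega)
      simp only at this
      linarith
    refine ⟨m - n, ?_⟩
    simp only [RWRE.pathShift, level_sub]
    rw [Nat.add_sub_cancel' h1]
    linarith

lemma Regular.exists_hit {u : Fin d → ℝ} {X : Path d} (hX : Regular u X) :
    ∃ n, level u (X 0) + 1 ≤ level u (X n) := hX.hits 0

/-- The environment and the walk seen from the walk at time `n`. -/
def seenFrom (n : ℕ) (s : Env d × Path d) : Env d × Path d := (shift (s.2 n) s.1, pathShift n s.2)

lemma seenFrom_seenFrom (m n : ℕ) (s : Env d × Path d) :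
    seenFrom m (seenFrom n s) = seenFrom (n + m) s := by
  simp [seenFrom, pathShift_pathShift, shift_shift, pathShift]

lemma measurable_shift_apply (n : ℕ) :
    Measurable fun s : Env d × Path d => shift (s.2 n) s.1 := by
  have h : Measurable fun q : Env d × Site d => shift q.2 q.1 :=
    measurable_from_prod_countable_left fun x => measurable_shift x
  exact h.comp (measurable_fst.prodMk ((measurable_pi_apply n).comp measurable_snd))

lemma measurable_seenFrom (n : ℕ) : Measurable (seenFrom n : Env d × Path d → _) :=
  (measurable_shift_apply n).prodMk ((measurable_pathShift n).comp measurable_snd)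

/-- The successive regeneration times: each is the first time at which the walk has gained one
level since the preceding one. -/
def reg (u : Fin d → ℝ) : ℕ → Path d → ℕ
  | 0, _ => 0
  | k + 1, X => reg u k X + sig u (pathShift (reg u k X) X)

lemma reg_succ (u : Fin d → ℝ) (k : ℕ) (X : Path d) :
    reg u (k + 1) X = reg u k X + sig u (pathShift (reg u k X) X) := rfl

@[simp] lemma reg_zero (u : Fin d → ℝ) (X : Path d) : reg u 0 X = 0 := rfl

lemma reg_add (u : Fin d → ℝ) (i k : ℕ) (X : Path d) :
    reg u (i + k) X = reg u i X + reg u k (pathShift (reg u i X) X) := by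
  induction k with
  | zero => simp
  | succ k ih =>
    rw [← add_assoc, reg_succ, reg_succ, ih, pathShift_pathShift, add_assoc]

lemma reg_one {u : Fin d → ℝ} {X : Path d} (h0 : X 0 = 0) : reg u 1 X = sig u X := by
  have : pathShift 0 X = X := by funext k; simp [pathShift, h0]
  rw [reg_succ, reg_zero, this, zero_add]

lemma measurable_reg (u : Fin d → ℝ) (k : ℕ) : Measurable fun X : Path d => reg u k X := by
  induction k with
  | zero => exact measurable_const
  | succ k ih =>
    have h : Measurable fun q : Path d × ℕ => sig u (pathShift q.2 q.1) :=
      measurable_from_prod_countable_left fun n => (measurable_sig u).comp (measurable_pathShift n)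
    have h1 : Measurable fun X : Path d => (X, reg u k X) := measurable_id.prodMk ih
    have h2 := h.comp h1
    simp only [reg_succ]
    exact ih.add h2

/-- The environment and the walk seen from the walk at its `k`-th regeneration time. -/
def regShift (u : Fin d → ℝ) (k : ℕ) (s : Env d × Path d) : Env d × Path d :=
  seenFrom (reg u k s.2) s

lemma measurable_regShift (u : Fin d → ℝ) (k : ℕ) :
    Measurable (regShift u k : Env d × Path d → _) := by
  have h : Measurable fun q : (Env d × Path d) × ℕ => seenFrom q.2 q.1 :=
    measurable_from_prod_countable_left fun n => measurable_seenFrom n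
  exact h.comp (measurable_id.prodMk ((measurable_reg u k).comp measurable_snd))

lemma regShift_regShift (u : Fin d → ℝ) (i k : ℕ) (s : Env d × Path d) :
    regShift u k (regShift u i s) = regShift u (i + k) s := by
  simp only [regShift, seenFrom_seenFrom, reg_add]
  rfl

namespace Regular

variable {u : Fin d → ℝ} {X : Path d} (hX : Regular u X)
include hX

lemma reg_lt_succ (k : ℕ) : reg u k X < reg u (k + 1) X := by
  rw [reg_succ]
  have := sig_pos (hX.pathShift (reg u k X)).exists_hit
  omega

lemma strictMono_reg : StrictMono fun k => reg u k X := strictMono_nat_of_lt_succ hX.reg_lt_succ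

lemma level_reg_succ (k : ℕ) : level u (X (reg u k X)) + 1 ≤ level u (X (reg u (k + 1) X)) := by
  have := (sig_spec (hX.pathShift (reg u k X)).exists_hit).1
  simp only [RWRE.pathShift, level_sub, add_zero] at this
  rw [reg_succ]
  linarith

lemma level_lt_of_lt_reg_succ {k j : ℕ} (hj : j < reg u (k + 1) X) :
    level u (X j) < level u (X (reg u k X)) + 1 := by
  by_cases h : j < reg u k X
  · have := hX.mono h.le
    simp only at this
    linarith
  · obtain ⟨i, rfl⟩ := Nat.exists_eq_add_of_le (not_lt.1 h)
    rw [reg_succ] at hj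
    have := (sig_spec (hX.pathShift (reg u k X)).exists_hit).2 i (by omega)
    simp only [RWRE.pathShift, level_sub, add_zero] at this
    linarith

/-- The strict inequality is essential: no site at the level of the regeneration position or above
has been visited earlier. -/
lemma level_lt_reg {k j : ℕ} (hj : j < reg u k X) : level u (X j) < level u (X (reg u k X)) := by
  cases k with
  | zero => simp at hj
  | succ k => exact (hX.level_lt_of_lt_reg_succ hj).trans_le (hX.level_reg_succ k)

lemma le_level_reg_add (i k : ℕ) :
    level u (X (reg u i X)) + k ≤ level u (X (reg u (i + k) X)) := by
  induction k with
  | zero => simp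
  | succ k ih =>
    have := hX.level_reg_succ (i + k)
    rw [← add_assoc]
    push_cast
    linarith

lemma le_level_reg (k : ℕ) : (k : ℝ) ≤ level u (X (reg u k X)) := by
  have := hX.le_level_reg_add 0 k
  simpa [hX.zero] using this

lemma level_nonneg (n : ℕ) : 0 ≤ level u (X n) := by
  have := hX.mono (Nat.zero_le n)
  simpa [hX.zero] using this

lemma le_reg (k : ℕ) : k ≤ reg u k X := hX.strictMono_reg.le_apply

/-- The stopping-time property: agreement up to the regeneration time suffices, and `X'` need not be
regular. -/
lemma reg_congr {X' : Path d} {k : ℕ} (h : ∀ i ≤ reg u k X, X i = X' i) :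
    reg u k X' = reg u k X := by
  induction k with
  | zero => rfl
  | succ k ih =>
    have hlt := hX.reg_lt_succ k
    have e := ih fun i hi => h i (by omega)
    rw [reg_succ, e, reg_succ, add_right_inj]
    have hs := sig_spec (hX.pathShift (reg u k X)).exists_hit
    have hp : ∀ j ≤ sig u (RWRE.pathShift (reg u k X) X),
        RWRE.pathShift (reg u k X) X' j = RWRE.pathShift (reg u k X) X j := by
      intro j hj
      rw [reg_succ] at h
      simp only [RWRE.pathShift]
      rw [h _ (by omega), h _ (by omega)]
    refine sig_eq ?_ fun j hj => ?_
    · rw [hp _ le_rfl, hp 0 (Nat.zero_le _)]; exact hs.1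
    · rw [hp _ hj.le, hp 0 (Nat.zero_le _)]; exact hs.2 j hj

end Regular

/-! ### The regeneration property -/

section
variable (μ : Measure (PMF (Site d))) [IsProbabilityMeasure μ]

instance : IsProbabilityMeasure (annealedLaw (iidEnvLaw μ) 0) := by
  unfold annealedLaw; infer_instance

lemma lintegral_annealedLaw (P : Measure (Env d)) [SFinite P] {f : Env d × Path d → ℝ≥0∞}
    (hf : Measurable f) :
    ∫⁻ s, f s ∂annealedLaw P 0 = ∫⁻ ω, ∫⁻ X, f (ω, X) ∂quenchedLaw ω 0 ∂P :=
  Measure.lintegral_compProd hf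

variable {μ} {u : Fin d → ℝ} {K ε M : ℝ}

/-- The half-space of the sites with nonnegative level. -/
def upper (u : Fin d → ℝ) : Set (Site d) := {y | 0 ≤ level u y}

lemma Ballistic.annealedLaw_ae_regular (hB : Ballistic μ u K ε M) :
    ∀ᵐ s ∂annealedLaw (iidEnvLaw μ) 0, Regular u s.2 := by
  have hmeas : MeasurableSet {X : Path d | Regular u X} := by
    have : {X : Path d | Regular u X} = {X | X 0 = 0} ∩
        ({X | ∀ n, level u (X n) ≤ level u (X (n + 1))} ∩
        {X | ∀ n, ∃ m, level u (X n) + 1 ≤ level u (X m)}) := by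
      ext X
      exact ⟨fun h => ⟨h.1, fun n => h.2 (Nat.le_succ n), h.3⟩,
        fun h => ⟨h.1, monotone_nat_of_le_succ h.2.1, h.2.2⟩⟩
    rw [this]
    refine (measurable_pi_apply 0 (measurableSet_singleton _)).inter (MeasurableSet.inter ?_ ?_)
    · rw [Set.ofPred_forall]
      exact MeasurableSet.iInter fun n => measurableSet_le (measurable_path_comp (level u) n)
        (measurable_path_comp (level u) (n + 1))
    · rw [Set.ofPred_forall]
      refine MeasurableSet.iInter fun n => ?_
      rw [Set.ofPred_exists]
      exact MeasurableSet.iUnion fun m => measurableSet_le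
        ((measurable_path_comp (level u) n).add_const 1) (measurable_path_comp (level u) m)
  refine (Measure.ae_compProd_iff (measurable_snd hmeas)).2 ?_
  filter_upwards [hB.good] with ω hω
  exact quenchedLaw_ae_regular hB.K_nonneg hB.ε_pos hω

/-- The regeneration property for one fixed initial segment `w` ending strictly above its earlier
sites. The probability of `w` reads only levels below `w n`, the later walk only levels from `w n`
on, and the two parts of the environment are independent. -/
lemma lintegral_regeneration_piece (hB : Ballistic μ u K ε M) {n : ℕ} {w : Path d} (hw0 : w 0 = 0)
    (hw : ∀ i < n, level u (w i) < level u (w n)) (Ψ : Env d → Env d × Path d → ℝ≥0∞)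
    (hΨ : Measurable (Function.uncurry Ψ))
    (hdep : ∀ ω ω' : Env d, (∀ y, level u y < level u (w n) → ω y = ω' y) → Ψ ω = Ψ ω') :
    ∫⁻ s in Set.univ ×ˢ pathCyl n w, Ψ s.1 (shift (w n) s.1, pathShift n s.2)
        ∂annealedLaw (iidEnvLaw μ) 0 =
      ∫⁻ s in Set.univ ×ˢ pathCyl n w,
        ∫⁻ t, Ψ s.1 (patch (upper u) t.1 (shift (w n) s.1), t.2) ∂annealedLaw (iidEnvLaw μ) 0
        ∂annealedLaw (iidEnvLaw μ) 0 := by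
  have hcyl := measurableSet_pathCyl n w
  have hΨω : ∀ ω, Measurable (Ψ ω) := fun ω => hΨ.comp measurable_prodMk_left
  have m1 : Measurable fun s : Env d × Path d => Ψ s.1 (shift (w n) s.1, pathShift n s.2) :=
    hΨ.comp (measurable_fst.prodMk (((measurable_shift (w n)).comp measurable_fst).prodMk
      ((measurable_pathShift n).comp measurable_snd)))
  have m2 : Measurable fun q : Env d × (Env d × Path d) =>
      Ψ q.1 (patch (upper u) q.2.1 (shift (w n) q.1), q.2.2) :=
    hΨ.comp (measurable_fst.prodMk (((measurable_patch (upper u)).comp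
      ((measurable_fst.comp measurable_snd).prodMk
      ((measurable_shift (w n)).comp measurable_fst))).prodMk
      (measurable_snd.comp measurable_snd)))
  have m3 : Measurable fun ω : Env d =>
      ∫⁻ t, Ψ ω (patch (upper u) t.1 (shift (w n) ω), t.2) ∂annealedLaw (iidEnvLaw μ) 0 :=
    m2.lintegral_prod_right'
  have m4 : Measurable fun s : Env d × Path d =>
      ∫⁻ t, Ψ s.1 (patch (upper u) t.1 (shift (w n) s.1), t.2) ∂annealedLaw (iidEnvLaw μ) 0 :=
    m3.comp measurable_fst
  unfold annealedLaw at *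
  rw [Measure.setLIntegral_compProd m1 MeasurableSet.univ hcyl,
    Measure.setLIntegral_compProd m4 MeasurableSet.univ hcyl,
    Measure.restrict_univ]
  set c : Env d → ℝ≥0∞ := fun ω => quenchedLaw ω 0 (pathCyl n w) with hc
  have hcm : Measurable c := (quenchedKernel 0).measurable_coe hcyl
  set H : Env d → ℝ≥0∞ := fun ω =>
    c ω * ∫⁻ Y, Ψ ω (shift (w n) ω, Y) ∂quenchedLaw (shift (w n) ω) 0 with hH
  have hHm : Measurable H := by
    refine hcm.mul ?_
    have : Measurable fun q : Env d × Path d => Ψ q.1 (shift (w n) q.1, q.2) :=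
      hΨ.comp (measurable_fst.prodMk (((measurable_shift (w n)).comp measurable_fst).prodMk
        measurable_snd))
    exact this.lintegral_kernel_prod_right'
      (κ := (quenchedKernel (d := d) 0).comap (shift (w n)) (measurable_shift (w n)))
  have h1 : ∀ ω, ∫⁻ X in pathCyl n w, Ψ ω (shift (w n) ω, pathShift n X) ∂quenchedKernel 0 ω =
      H ω := by
    intro ω
    change ∫⁻ X in pathCyl n w, Ψ ω (shift (w n) ω, pathShift n X) ∂quenchedLaw ω 0 = H ω
    have mY : Measurable fun Y : Path d => Ψ ω (shift (w n) ω, Y) :=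
      (hΨω ω).comp measurable_prodMk_left
    rw [← lintegral_map mY (measurable_pathShift n), restrict_pathCyl_map_pathShift,
      lintegral_smul_measure, smul_eq_mul]
  have h2 : ∀ ω, ∫⁻ _ in pathCyl n w, ∫⁻ t, Ψ ω (patch (upper u) t.1 (shift (w n) ω), t.2)
      ∂(iidEnvLaw μ ⊗ₘ quenchedKernel 0) ∂quenchedKernel 0 ω =
      c ω * ∫⁻ t, Ψ ω (patch (upper u) t.1 (shift (w n) ω), t.2)
      ∂(iidEnvLaw μ ⊗ₘ quenchedKernel 0) := by
    intro ω
    rw [setLIntegral_const, mul_comm]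
    rfl
  simp only [h1, h2]
  -- The environment is rebuilt from two independent copies: `ω` strictly below the level of `w n`,
  -- and a translate of `ω'` elsewhere, so that after shifting to `w n` the copy `ω'` fills the
  -- nonnegative levels.
  set S : Set (Site d) := {y | level u y < level u (w n)} with hS
  have hmp : MeasurePreserving (fun q : Env d × Env d => patch S q.1 (shift (-w n) q.2))
      ((iidEnvLaw μ).prod (iidEnvLaw μ)) (iidEnvLaw μ) :=
    (measurePreserving_patch μ S).comp
      ((MeasurePreserving.id _).prod (measurePreserving_shift μ (-w n)))
  have hHc : Measurable fun q : Env d × Env d => H (patch S q.1 (shift (-w n) q.2)) :=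
    hHm.comp hmp.measurable
  rw [← hmp.lintegral_comp hHm, lintegral_prod _ hHc.aemeasurable]
  refine lintegral_congr fun ω => ?_
  have hpast : ∀ ω', ∀ y, level u y < level u (w n) → patch S ω (shift (-w n) ω') y = ω y :=
    fun ω' y hy => patch_of_mem _ _ hy
  have hfut : ∀ ω', shift (w n) (patch S ω (shift (-w n) ω')) =
      patch (upper u) ω' (shift (w n) ω) := by
    intro ω'
    funext y
    by_cases hy : 0 ≤ level u y
    · rw [patch_of_mem _ _ (show y ∈ upper u from hy), shift, patch_of_notMem]
      · simp [shift]
      · simp [hS, level_add, hy]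
    · rw [patch_of_notMem _ _ (show y ∉ upper u from hy), shift, patch_of_mem]
      · rfl
      · simp only [hS, Set.mem_ofPred_eq, level_add]
        linarith [not_le.1 hy]
  have hcc : ∀ ω', c (patch S ω (shift (-w n) ω')) = c ω := by
    intro ω'
    simp only [hc, quenchedLaw_pathCyl, if_pos hw0]
    refine Finset.prod_congr rfl fun i hi => ?_
    rw [hpast ω' _ (hw i (Finset.mem_range.1 hi))]
  have mω : Measurable fun t : Env d × Path d =>
      Ψ ω (patch (upper u) t.1 (shift (w n) ω), t.2) := m2.comp measurable_prodMk_left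
  rw [Measure.lintegral_compProd mω, ← lintegral_const_mul _
    (mω.lintegral_kernel_prod_right' (κ := quenchedKernel 0))]
  refine lintegral_congr_ae ?_
  filter_upwards [hB.good] with ω' hω'
  have hqk : quenchedKernel 0 ω' = quenchedLaw ω' 0 := rfl
  -- The future walk does not see the glued past, because it cannot step below level zero.
  have : quenchedLaw (patch (upper u) ω' (shift (w n) ω)) 0 = quenchedLaw ω' 0 := by
    refine quenchedLaw_congr u (fun x hx => ?_) fun x hx => patch_of_mem _ _ hx
    rw [patch_of_mem _ _ (show x ∈ upper u from hx)]
    exact (hω' x).forward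
  simp only [hH, hcc, hfut, hdep _ ω (hpast ω'), this, hqk]

/-- A function of the environment and the walk which, on regular walks, depends only on the walk
and the environment before the `k`-th regeneration. -/
def PastLocal {α : Type*} (u : Fin d → ℝ) (k : ℕ) (F : Env d × Path d → α) : Prop :=
  ∀ ω ω' X X', Regular u X → Regular u X' → (∀ i ≤ reg u k X, X i = X' i) →
    (∀ y, level u y < level u (X (reg u k X)) → ω y = ω' y) → F (ω, X) = F (ω', X')

/-- A function of the environment and the walk which, on regular walks, depends only on the walk
and the environment on nonnegative levels. -/
def PlusLocal {α : Type*} (u : Fin d → ℝ) (G : Env d × Path d → α) : Prop :=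
  ∀ ω ω' X, Regular u X → (∀ y, 0 ≤ level u y → ω y = ω' y) → G (ω, X) = G (ω', X)

/-- The regeneration property: the environment and the walk after the `k`-th regeneration are an
independent copy, glued to the past. -/
lemma lintegral_regeneration (hB : Ballistic μ u K ε M) (k : ℕ)
    (Φ : Env d × Path d → Env d × Path d → ℝ≥0∞) (hΦ : Measurable (Function.uncurry Φ))
    (hdep : PastLocal u k Φ) :
    ∫⁻ s, Φ s (regShift u k s) ∂annealedLaw (iidEnvLaw μ) 0 =
      ∫⁻ s, ∫⁻ t, Φ s (patch (upper u) t.1 (shift (s.2 (reg u k s.2)) s.1), t.2)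
        ∂annealedLaw (iidEnvLaw μ) 0 ∂annealedLaw (iidEnvLaw μ) 0 := by
  set LL := annealedLaw (iidEnvLaw μ) 0 with hLL
  -- A countable partition according to the value of the regeneration time and the path up to it.
  set E : (Σ n : ℕ, Finset.Iic n → Site d) → Set (Env d × Path d) := fun a =>
    {s | reg u k s.2 = a.1} ∩ Set.univ ×ˢ pathCyl a.1 (extendPath a.1 a.2) with hE
  have hEm : ∀ a, MeasurableSet (E a) := fun a =>
    (((measurable_reg u k).comp measurable_snd) (measurableSet_singleton a.1)).inter
      (MeasurableSet.univ.prod (measurableSet_pathCyl _ _))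
  have hEd : Pairwise (Function.onFun Disjoint E) := by
    rintro ⟨n, h⟩ ⟨n', h'⟩ hne
    refine Set.disjoint_left.2 fun s hs hs' => hne ?_
    have e : n = n' := hs.1.symm.trans hs'.1
    subst e
    congr 1
    by_contra hh
    exact Set.disjoint_left.1 (pairwise_disjoint_pathCyl n hh) hs.2.2 hs'.2.2
  have hEU : ⋃ a, E a = Set.univ := by
    refine Set.eq_univ_of_forall fun s => Set.mem_iUnion.2 ?_
    have : s.2 ∈ ⋃ h, pathCyl (reg u k s.2) (extendPath (reg u k s.2) h) := by
      rw [iUnion_pathCyl]; trivial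
    obtain ⟨h, hh⟩ := Set.mem_iUnion.1 this
    exact ⟨⟨_, h⟩, rfl, trivial, hh⟩
  have hsplit : ∀ f : Env d × Path d → ℝ≥0∞, ∫⁻ s, f s ∂LL = ∑' a, ∫⁻ s in E a, f s ∂LL :=
    fun f => by rw [← lintegral_iUnion hEm hEd, hEU, setLIntegral_univ]
  rw [hsplit, hsplit]
  refine tsum_congr fun a => ?_
  have hreg := hB.annealedLaw_ae_regular
  -- If a regular representative exists, the stopping-time property identifies the piece with a full
  -- cylinder up to a null set. Otherwise the piece itself is null.
  by_cases hex : ∃ X, Regular u X ∧ reg u k X = a.1 ∧ X ∈ pathCyl a.1 (extendPath a.1 a.2)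
  · obtain ⟨w, hw, hwn, hwc⟩ := hex
    obtain ⟨n, h⟩ := a
    simp only at hwn hwc
    have hcyl : pathCyl n (extendPath n h) = pathCyl n w := by
      ext X
      exact ⟨fun hX i hi => (hX i hi).trans (hwc i hi).symm,
        fun hX i hi => (hX i hi).trans (hwc i hi)⟩
    have hEae : E ⟨n, h⟩ =ᵐ[LL] Set.univ ×ˢ pathCyl n w := by
      filter_upwards [hreg] with s hs
      refine propext ⟨fun hh => ?_, fun hh => ?_⟩
      · have := hh.2
        rw [hcyl] at this
        exact this
      · have h2 : s.2 ∈ pathCyl n w := hh.2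
        refine ⟨?_, trivial, ?_⟩
        · change reg u k s.2 = n
          rw [← hwn]
          exact hw.reg_congr fun i hi => (h2 i (hwn ▸ hi)).symm
        · change s.2 ∈ pathCyl n (extendPath n h)
          rw [hcyl]; exact h2
    have hΦw : ∀ s : Env d × Path d, Regular u s.2 → s.2 ∈ pathCyl n w →
        Φ s = Φ (s.1, w) ∧ reg u k s.2 = n ∧ s.2 n = w n := by
      intro s hs h2
      refine ⟨(hdep s.1 s.1 w s.2 hw hs (fun i hi => (h2 i (hwn ▸ hi)).symm)
        fun _ _ => rfl).symm, ?_, h2 n le_rfl⟩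
      rw [← hwn]
      exact hw.reg_congr fun i hi => (h2 i (hwn ▸ hi)).symm
    rw [setLIntegral_congr hEae, setLIntegral_congr hEae]
    have hms : MeasurableSet ((Set.univ : Set (Env d)) ×ˢ pathCyl n w) :=
      MeasurableSet.univ.prod (measurableSet_pathCyl _ _)
    have := lintegral_regeneration_piece hB (n := n) (w := w) hw.zero
      (fun i hi => by rw [← hwn] at hi ⊢; exact hw.level_lt_reg hi) (fun ω => Φ (ω, w))
      (hΦ.comp ((measurable_fst.prodMk measurable_const).prodMk measurable_snd))
      (fun ω ω' hωω' => hdep ω ω' w w hw hw (fun _ _ => rfl) fun y hy => hωω' y (hwn ▸ hy))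
    refine Eq.trans (setLIntegral_congr_fun_ae hms ?_)
      (this.trans (setLIntegral_congr_fun_ae hms ?_))
    · filter_upwards [hreg] with s hs h2
      obtain ⟨e1, e2, e3⟩ := hΦw s hs h2.2
      rw [e1, regShift, e2, seenFrom, e3]
    · filter_upwards [hreg] with s hs h2
      obtain ⟨e1, e2, e3⟩ := hΦw s hs h2.2
      simp only [e1, e2, e3]
      rfl
  · have h0 : LL (E a) = 0 := by
      refine measure_mono_null ?_ (ae_iff.1 hreg)
      exact fun s hs hr => hex ⟨s.2, hr, hs.1, hs.2.2⟩
    rw [setLIntegral_measure_zero _ _ h0, setLIntegral_measure_zero _ _ h0]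

/-- The past and the future of a regeneration time are independent. -/
lemma lintegral_mul_regShift (hB : Ballistic μ u K ε M) (k : ℕ)
    {F G : Env d × Path d → ℝ≥0∞} (hF : Measurable F) (hFloc : PastLocal u k F)
    (hG : Measurable G) (hGloc : PlusLocal u G) :
    ∫⁻ s, F s * G (regShift u k s) ∂annealedLaw (iidEnvLaw μ) 0 =
      (∫⁻ s, F s ∂annealedLaw (iidEnvLaw μ) 0) * ∫⁻ s, G s ∂annealedLaw (iidEnvLaw μ) 0 := by
  rw [lintegral_regeneration hB k (fun s t => F s * G t)
    ((hF.comp measurable_fst).mul (hG.comp measurable_snd)) fun ω ω' X X' h1 h2 h3 h4 => by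
      simp only [hFloc ω ω' X X' h1 h2 h3 h4], ← lintegral_mul_const _ hF]
  refine lintegral_congr fun s => ?_
  rw [← lintegral_const_mul _ hG]
  refine lintegral_congr_ae ?_
  filter_upwards [hB.annealedLaw_ae_regular] with t ht
  rw [hGloc _ t.1 t.2 ht fun y hy => patch_of_mem _ _ hy]

lemma lintegral_comp_regShift (hB : Ballistic μ u K ε M) (k : ℕ)
    {G : Env d × Path d → ℝ≥0∞} (hG : Measurable G) (hGloc : PlusLocal u G) :
    ∫⁻ s, G (regShift u k s) ∂annealedLaw (iidEnvLaw μ) 0 =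
      ∫⁻ s, G s ∂annealedLaw (iidEnvLaw μ) 0 := by
  simpa using lintegral_mul_regShift hB k (F := fun _ => 1) measurable_const
    (fun _ _ _ _ _ _ _ _ => rfl) hG hGloc

end

/-! ### Sums over the blocks between regeneration times -/

/-- The annealed Markov property. -/
lemma lintegral_mul_seenFrom (P : Measure (Env d)) [SFinite P] {R : Path d → Prop}
    (hR : ∀ᵐ ω ∂P, ∀ᵐ X ∂quenchedLaw ω 0, R X) (n : ℕ) {F : Path d → ℝ≥0∞} (hF : Measurable F)
    (hdep : ∀ X X', R X → R X' → (∀ i ≤ n, X i = X' i) → F X = F X')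
    {G : Env d × Path d → ℝ≥0∞} (hG : Measurable G) :
    ∫⁻ s, F s.2 * G (seenFrom n s) ∂annealedLaw P 0 =
      ∫⁻ s, F s.2 * ∫⁻ Y, G (shift (s.2 n) s.1, Y) ∂quenchedLaw (shift (s.2 n) s.1) 0
        ∂annealedLaw P 0 := by
  have m1 : Measurable fun s : Env d × Path d => F s.2 * G (seenFrom n s) :=
    (hF.comp measurable_snd).mul (hG.comp (measurable_seenFrom n))
  have m2 : Measurable fun η : Env d => ∫⁻ Y, G (η, Y) ∂quenchedLaw η 0 :=
    hG.lintegral_kernel_prod_right' (κ := quenchedKernel 0)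
  have m3 : Measurable fun s : Env d × Path d =>
      F s.2 * ∫⁻ Y, G (shift (s.2 n) s.1, Y) ∂quenchedLaw (shift (s.2 n) s.1) 0 :=
    (hF.comp measurable_snd).mul (m2.comp (measurable_shift_apply n))
  rw [lintegral_annealedLaw P m1, lintegral_annealedLaw P m3]
  refine lintegral_congr_ae ?_
  filter_upwards [hR] with ω hω
  have hGω : ∀ η, Measurable fun Y => G (η, Y) := fun η => hG.comp measurable_prodMk_left
  have := lintegral_pathShift_of_ae ω 0 n (R := fun X => R X) hω
    (fun X Y => F X * G (shift (X n) ω, Y)) (fun X => (hGω _).const_mul _)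
    (fun X X' h1 h2 h => by simp only [hdep X X' h1 h2 h, h n le_rfl])
  refine this.trans (lintegral_congr fun X => ?_)
  exact lintegral_const_mul _ (hGω _)

lemma lintegral_mul_jump_annealed (P : Measure (Env d)) [SFinite P] {R : Path d → Prop}
    (hR : ∀ᵐ ω ∂P, ∀ᵐ X ∂quenchedLaw ω 0, R X) (n : ℕ) {F : Path d → ℝ≥0∞} (hF : Measurable F)
    (hdep : ∀ X X', R X → R X' → (∀ i ≤ n, X i = X' i) → F X = F X') (g : Site d → ℝ≥0∞) :
    ∫⁻ s, F s.2 * g (s.2 (n + 1) - s.2 n) ∂annealedLaw P 0 =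
      ∫⁻ s, F s.2 * jumpMean g (shift (s.2 n) s.1) ∂annealedLaw P 0 := by
  have := lintegral_mul_seenFrom P hR n hF hdep (G := fun s => g (s.2 1))
    ((measurable_path_comp g 1).comp measurable_snd)
  refine this.trans (lintegral_congr fun s => ?_)
  rw [lintegral_quenchedLaw_one]
  rfl

lemma lintegral_mul_env_annealed (P : Measure (Env d)) [SFinite P] {R : Path d → Prop}
    (hR : ∀ᵐ ω ∂P, ∀ᵐ X ∂quenchedLaw ω 0, R X) (n : ℕ) {F : Path d → ℝ≥0∞} (hF : Measurable F)
    (hdep : ∀ X X', R X → R X' → (∀ i ≤ n, X i = X' i) → F X = F X')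
    {f : Env d → ℝ≥0∞} (hf : Measurable f) :
    ∫⁻ s, F s.2 * f (shift (s.2 (n + 1)) s.1) ∂annealedLaw P 0 =
      ∫⁻ s, F s.2 * ∫⁻ η, f η ∂envKernel (shift (s.2 n) s.1) ∂annealedLaw P 0 := by
  have := lintegral_mul_seenFrom P hR n hF hdep (G := fun s => f (shift (s.2 1) s.1))
    (hf.comp (measurable_shift_apply 1))
  refine Eq.trans (lintegral_congr fun s => ?_) (this.trans (lintegral_congr fun s => ?_))
  · simp [seenFrom, shift_shift, pathShift]
  · rw [lintegral_envKernel _ hf, lintegral_quenchedLaw_one _ fun z => f (shift z _)]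
    rfl

/-- The sum of a function of the environment and the walk, seen from the walk, between the `k`-th
and the next regeneration time. -/
def blockSum {β : Type*} [AddCommMonoid β] (u : Fin d → ℝ) (k : ℕ) (f : Env d × Path d → β)
    (s : Env d × Path d) : β :=
  ∑ n ∈ Finset.Ico (reg u k s.2) (reg u (k + 1) s.2), f (seenFrom n s)

lemma blockSum_regShift {β : Type*} [AddCommMonoid β] (u : Fin d → ℝ) (k i : ℕ)
    (f : Env d × Path d → β) (s : Env d × Path d) :
    blockSum u k f (regShift u i s) = blockSum u (i + k) f s := by
  simp only [blockSum, regShift, seenFrom_seenFrom]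
  rw [add_assoc, reg_add u i k, reg_add u i (k + 1)]
  rw [add_comm (reg u i s.2), add_comm (reg u i s.2),
    ← Finset.sum_Ico_add (fun n => f (seenFrom n s))]
  rfl

lemma measurable_blockSum {β : Type*} [AddCommMonoid β] [MeasurableSpace β] [MeasurableAdd₂ β]
    (u : Fin d → ℝ) (k : ℕ) {f : Env d × Path d → β} (hf : Measurable f) :
    Measurable (blockSum u k f) := by
  have h : Measurable fun q : (Env d × Path d) × (ℕ × ℕ) =>
      ∑ n ∈ Finset.Ico q.2.1 q.2.2, f (seenFrom n q.1) :=
    measurable_from_prod_countable_left fun q =>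
      Finset.measurable_sum (Finset.Ico q.1 q.2) fun n _ => hf.comp (measurable_seenFrom n)
  have h1 : Measurable fun s : Env d × Path d => (s, (reg u k s.2, reg u (k + 1) s.2)) :=
    measurable_id.prodMk (((measurable_reg u k).comp measurable_snd).prodMk
      ((measurable_reg u (k + 1)).comp measurable_snd))
  exact h.comp h1

lemma PlusLocal.comp_regShift {α : Type*} {u : Fin d → ℝ} {G : Env d × Path d → α}
    (hG : PlusLocal u G) (k : ℕ) : PlusLocal u fun s => G (regShift u k s) := by
  intro ω ω' X hX h
  refine hG _ _ _ (hX.pathShift _) fun y hy => h _ ?_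
  rw [level_add]
  exact add_nonneg hy (hX.level_nonneg _)

lemma PlusLocal.comp {α β : Type*} {u : Fin d → ℝ} {G : Env d × Path d → α}
    (hG : PlusLocal u G) (f : α → β) : PlusLocal u fun s => f (G s) :=
  fun ω ω' X hX h => congrArg f (hG ω ω' X hX h)

lemma PastLocal.comp {α β : Type*} {u : Fin d → ℝ} {k : ℕ} {G : Env d × Path d → α}
    (hG : PastLocal u k G) (f : α → β) : PastLocal u k fun s => f (G s) :=
  fun ω ω' X X' h1 h2 h3 h4 => congrArg f (hG ω ω' X X' h1 h2 h3 h4)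

/-- A function of the environment and the first step of the walk which depends only on the
environment on the levels in `[-k, L)`. -/
structure StepLocal {α : Type*} (u : Fin d → ℝ) (k L : ℕ) (f : Env d × Path d → α) : Prop where
  lower : ∀ ω ω' X, (∀ y, -(k : ℝ) ≤ level u y → ω y = ω' y) → f (ω, X) = f (ω', X)
  upper : ∀ ω ω' X X', X 0 = X' 0 → X 1 = X' 1 → (∀ y, level u y < L → ω y = ω' y) →
    f (ω, X) = f (ω', X')

/-- During the `k`-th block the walk is at level at least `k`, so looking back `k` levels never
leaves the nonnegative levels. -/
lemma plusLocal_blockSum {β : Type*} [AddCommMonoid β] {u : Fin d → ℝ} {k : ℕ}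
    {f : Env d × Path d → β}
    (hf : ∀ ω ω' X, (∀ y, -(k : ℝ) ≤ level u y → ω y = ω' y) → f (ω, X) = f (ω', X)) :
    PlusLocal u (blockSum u k f) := by
  intro ω ω' X hX h
  refine Finset.sum_congr rfl fun n hn => ?_
  refine hf _ _ _ fun y hy => h _ ?_
  have h1 := hX.le_level_reg k
  have h2 := hX.mono (Finset.mem_Ico.1 hn).1
  simp only at h2
  rw [level_add]
  linarith

/-- In the `k`-th block the walk is below its position at regeneration `k + 1`, and `L` further
regenerations climb at least `L` levels. Hence all sites read lie below regeneration `k + 1 + L`. -/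
lemma pastLocal_blockSum {β : Type*} [AddCommMonoid β] {u : Fin d → ℝ} {k L : ℕ}
    {f : Env d × Path d → β}
    (hf : ∀ ω ω' X X', X 0 = X' 0 → X 1 = X' 1 → (∀ y, level u y < L → ω y = ω' y) →
      f (ω, X) = f (ω', X')) : PastLocal u (k + 1 + L) (blockSum u k f) := by
  intro ω ω' X X' hX hX' h1 h2
  have ha : reg u k X ≤ reg u (k + 1) X := (hX.reg_lt_succ k).le
  have hb : reg u (k + 1) X ≤ reg u (k + 1 + L) X := hX.strictMono_reg.monotone (by omega)
  have e1 : reg u k X' = reg u k X := hX.reg_congr fun i hi => h1 i (by omega)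
  have e2 : reg u (k + 1) X' = reg u (k + 1) X := hX.reg_congr fun i hi => h1 i (by omega)
  unfold blockSum
  simp only [e1, e2]
  refine Finset.sum_congr rfl fun n hn => ?_
  have hn' := (Finset.mem_Ico.1 hn).2
  have en : X n = X' n := h1 n (by omega)
  refine hf _ _ _ _ (by simp [pathShift]) ?_ fun y hy => ?_
  · simp only [pathShift]
    rw [h1 (n + 1) (by omega), en]
  · simp only [shift]
    rw [← en]
    refine h2 _ ?_
    have h3 := hX.level_lt_reg hn'
    have h4 := hX.le_level_reg_add (k + 1) L
    rw [level_add]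
    linarith

/-- Time `n` lies in the `k`-th block. -/
def inBlock (u : Fin d → ℝ) (k n : ℕ) : Set (Path d) :=
  {X | reg u k X ≤ n ∧ n < reg u (k + 1) X}

lemma measurableSet_inBlock (u : Fin d → ℝ) (k n : ℕ) :
    MeasurableSet (inBlock u k n : Set (Path d)) :=
  (measurableSet_le (measurable_reg u k) measurable_const).inter
    (measurableSet_lt measurable_const (measurable_reg u (k + 1)))

/-- Membership of time `n` in a block is known at time `n`, which permits the Markov property inside
block sums. -/
lemma mem_inBlock_of_congr {u : Fin d → ℝ} {k n : ℕ} {X X' : Path d} (hX : Regular u X)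
    (hX' : Regular u X') (h : ∀ i ≤ n, X i = X' i) (hm : X ∈ inBlock u k n) :
    X' ∈ inBlock u k n := by
  have hm1 := hm.1
  have hm2 := hm.2
  refine ⟨?_, ?_⟩
  · rw [hX.reg_congr fun i hi => h i (hi.trans hm.1)]; exact hm.1
  · by_contra hlt
    have := hX'.reg_congr fun i hi => (h i (hi.trans (not_lt.1 hlt))).symm
    omega

lemma indicator_congr_of_iff {α β γ : Type*} [Zero γ] {s : Set α} {t : Set β} {a : α} {b : β}
    (h : a ∈ s ↔ b ∈ t) (c : γ) : s.indicator (fun _ => c) a = t.indicator (fun _ => c) b := by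
  by_cases ha : a ∈ s
  · simp [ha, h.1 ha]
  · simp [ha, mt h.2 ha]

lemma indicator_inBlock_congr {u : Fin d → ℝ} {k n : ℕ} (X X' : Path d) (hX : Regular u X)
    (hX' : Regular u X') (h : ∀ i ≤ n, X i = X' i) :
    (inBlock u k n).indicator (fun _ => (1 : ℝ≥0∞)) X =
      (inBlock u k n).indicator (fun _ => 1) X' :=
  indicator_congr_of_iff ⟨mem_inBlock_of_congr hX hX' h,
    mem_inBlock_of_congr hX' hX fun i hi => (h i hi).symm⟩ 1

lemma blockSum_eq_tsum (u : Fin d → ℝ) (k : ℕ) (f : Env d × Path d → ℝ≥0∞)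
    (s : Env d × Path d) :
    blockSum u k f s = ∑' n, (inBlock u k n).indicator (fun _ => 1) s.2 * f (seenFrom n s) := by
  rw [tsum_eq_sum (s := Finset.Ico (reg u k s.2) (reg u (k + 1) s.2))]
  · refine Finset.sum_congr rfl fun n hn => ?_
    have : s.2 ∈ inBlock u k n := Finset.mem_Ico.1 hn
    simp [this]
  · intro n hn
    have : s.2 ∉ inBlock u k n := fun h => hn (Finset.mem_Ico.2 h)
    simp [this]

lemma measurable_indicator_inBlock (u : Fin d → ℝ) (k n : ℕ) :
    Measurable ((inBlock u k n).indicator fun _ : Path d => (1 : ℝ≥0∞)) :=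
  measurable_const.indicator (measurableSet_inBlock u k n)

/-! ### Means of block sums -/

section
variable {μ : Measure (PMF (Site d))} [IsProbabilityMeasure μ] {u : Fin d → ℝ} {K ε M : ℝ}

lemma Ballistic.quenchedLaw_ae_regular (hB : Ballistic μ u K ε M) :
    ∀ᵐ ω ∂iidEnvLaw μ, ∀ᵐ X ∂quenchedLaw ω 0, Regular u X := by
  filter_upwards [hB.good] with ω hω
  exact RWRE.quenchedLaw_ae_regular hB.K_nonneg hB.ε_pos hω

lemma lintegral_blockSum (μ : Measure (PMF (Site d))) [IsProbabilityMeasure μ]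
    (u : Fin d → ℝ) (k : ℕ) {f : Env d × Path d → ℝ≥0∞} (hf : Measurable f) :
    ∫⁻ s, blockSum u k f s ∂annealedLaw (iidEnvLaw μ) 0 =
      ∑' n, ∫⁻ s, (inBlock u k n).indicator (fun _ => 1) s.2 * f (seenFrom n s)
        ∂annealedLaw (iidEnvLaw μ) 0 := by
  simp only [blockSum_eq_tsum]
  exact lintegral_tsum fun n => (((measurable_indicator_inBlock u k n).comp measurable_snd).mul
    (hf.comp (measurable_seenFrom n))).aemeasurable

/-- Writing the block sum as a sum over all times, the indicator of the block depends only on the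
path so far, so each jump can be replaced by its conditional mean. -/
lemma lintegral_blockSum_jump (hB : Ballistic μ u K ε M) (k : ℕ) (g : Site d → ℝ≥0∞) :
    ∫⁻ s, blockSum u k (fun s => g (s.2 1 - s.2 0)) s ∂annealedLaw (iidEnvLaw μ) 0 =
      ∫⁻ s, blockSum u k (fun s => jumpMean g s.1) s ∂annealedLaw (iidEnvLaw μ) 0 := by
  have m1 : Measurable fun s : Env d × Path d => g (s.2 1 - s.2 0) :=
    (measurable_path_comp_sub g 1 0).comp measurable_snd
  have m2 : Measurable fun s : Env d × Path d => jumpMean g s.1 :=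
    (measurable_jumpMean g).comp measurable_fst
  rw [lintegral_blockSum _ _ _ m1, lintegral_blockSum _ _ _ m2]
  refine tsum_congr fun n => ?_
  have := lintegral_mul_jump_annealed (iidEnvLaw μ) hB.quenchedLaw_ae_regular n
    (measurable_indicator_inBlock u k n) indicator_inBlock_congr g
  refine Eq.trans (lintegral_congr fun s => ?_) this
  simp [seenFrom, pathShift]

/-- The annealed mean of `σ_1`. -/
def meanSigma (μ : Measure (PMF (Site d))) [IsProbabilityMeasure μ] (u : Fin d → ℝ) : ℝ≥0∞ :=
  ∫⁻ s, (sigma1 u s.2 : ℝ≥0∞) ∂annealedLaw (iidEnvLaw μ) 0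

lemma lintegral_sigma1_pathShift_le (hB : Ballistic μ u K ε M) (n : ℕ) :
    ∫⁻ s, (sigma1 u (pathShift n s.2) : ℝ≥0∞) ∂annealedLaw (iidEnvLaw μ) 0 ≤
      ENNReal.ofReal ((1 + K) / ε) := by
  have h := lintegral_mul_seenFrom (iidEnvLaw μ) (R := fun _ => True)
    (ae_of_all _ fun _ => ae_of_all _ fun _ => trivial) n (F := fun _ => 1) measurable_const
    (fun _ _ _ _ _ => rfl) (G := fun s => (sigma1 u s.2 : ℝ≥0∞))
    ((measurable_sigma1 u).comp measurable_snd)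
  simp only [one_mul] at h
  refine h.le.trans ?_
  have m2 : Measurable fun η : Env d => ∫⁻ Y, (sigma1 u Y : ℝ≥0∞) ∂quenchedLaw η 0 :=
    ((measurable_sigma1 u).comp measurable_snd).lintegral_kernel_prod_right'
      (κ := quenchedKernel 0)
  have m3 : Measurable fun s : Env d × Path d =>
      ∫⁻ Y, (sigma1 u Y : ℝ≥0∞) ∂quenchedLaw (shift (s.2 n) s.1) 0 :=
    m2.comp (measurable_shift_apply n)
  rw [lintegral_annealedLaw _ m3]
  calc _ ≤ ∫⁻ ω, ∫⁻ _, ENNReal.ofReal ((1 + K) / ε) ∂quenchedLaw ω 0 ∂iidEnvLaw μ := by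
        refine lintegral_mono_ae ?_
        filter_upwards [hB.good] with ω hω
        exact lintegral_mono fun X =>
          lintegral_sigma1_le (M := M) hB.K_nonneg hB.ε_pos (fun x => hω _) 0
    _ = _ := by simp

lemma meanSigma_lt_top (hB : Ballistic μ u K ε M) : meanSigma μ u < ∞ := by
  refine lt_of_le_of_lt (le_of_eq ?_)
    ((lintegral_sigma1_pathShift_le hB 0).trans_lt ENNReal.ofReal_lt_top)
  refine lintegral_congr_ae ?_
  filter_upwards [hB.annealedLaw_ae_regular] with s hs
  have : pathShift 0 s.2 = s.2 := by funext k; simp [pathShift, hs.zero]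
  rw [this]

lemma one_le_meanSigma (hB : Ballistic μ u K ε M) : 1 ≤ meanSigma μ u := by
  calc (1 : ℝ≥0∞) = ∫⁻ _, 1 ∂annealedLaw (iidEnvLaw μ) 0 := by simp
    _ ≤ _ := by
      refine lintegral_mono_ae ?_
      filter_upwards [hB.annealedLaw_ae_regular] with s hs
      rw [sigma1_eq_sig hs.exists_hit]
      have := sig_pos hs.exists_hit
      simp only [ENat.toENNReal_coe]
      exact_mod_cast this

lemma meanSigma_ne_zero (hB : Ballistic μ u K ε M) : meanSigma μ u ≠ 0 :=
  (zero_lt_one.trans_le (one_le_meanSigma hB)).ne'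

lemma toReal_meanSigma_pos (hB : Ballistic μ u K ε M) : 0 < (meanSigma μ u).toReal :=
  ENNReal.toReal_pos (meanSigma_ne_zero hB) (meanSigma_lt_top hB).ne

lemma lintegral_blockSum_zero (hB : Ballistic μ u K ε M) (k : ℕ) {f : Env d × Path d → ℝ≥0∞}
    (hf : Measurable f) (hloc : PlusLocal u (blockSum u 0 f)) :
    ∫⁻ s, blockSum u k f s ∂annealedLaw (iidEnvLaw μ) 0 =
      ∫⁻ s, blockSum u 0 f s ∂annealedLaw (iidEnvLaw μ) 0 := by
  rw [← lintegral_comp_regShift hB k (measurable_blockSum u 0 hf) hloc]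
  refine lintegral_congr fun s => ?_
  rw [blockSum_regShift, add_zero]

lemma lintegral_blockSum_one (hB : Ballistic μ u K ε M) (k : ℕ) :
    ∫⁻ s, blockSum u k (fun _ => (1 : ℝ≥0∞)) s ∂annealedLaw (iidEnvLaw μ) 0 = meanSigma μ u := by
  rw [lintegral_blockSum_zero hB k measurable_const
    (plusLocal_blockSum fun _ _ _ _ => rfl)]
  refine lintegral_congr_ae ?_
  filter_upwards [hB.annealedLaw_ae_regular] with s hs
  rw [sigma1_eq_sig hs.exists_hit, ← reg_one hs.zero]
  simp [blockSum]

end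

/-! ### Laws of large numbers -/

/-- Interpolation of the convergence of averages along a sequence of times. -/
lemma tendsto_div_of_tendsto_subseq {S b : ℕ → ℝ} {τ : ℕ → ℕ} (hτ : StrictMono τ) {a s β : ℝ}
    (ha0 : 0 < a) (ha : Tendsto (fun J : ℕ => (τ J : ℝ) / J) atTop (𝓝 a))
    (hs : Tendsto (fun J : ℕ => S (τ J) / J) atTop (𝓝 s))
    (hb : ∀ n, |S (n + 1) - S n| ≤ b n)
    (hβ : Tendsto (fun J : ℕ => (∑ k ∈ Finset.range (τ J), b k) / J) atTop (𝓝 β)) :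
    Tendsto (fun N : ℕ => S N / N) atTop (𝓝 (s / a)) := by
  set B : ℕ → ℝ := fun n => ∑ k ∈ Finset.range n, b k with hB
  have hb0 : ∀ n, 0 ≤ b n := fun n => (abs_nonneg _).trans (hb n)
  have hBmono : Monotone B := fun m n h =>
    Finset.sum_le_sum_of_subset_of_nonneg (Finset.range_mono h) fun i _ _ => hb0 i
  have hSB : ∀ m n, m ≤ n → |S n - S m| ≤ B n - B m := by
    intro m n h
    induction n, h using Nat.le_induction with
    | base => simp
    | succ n hmn ih =>
      have h1 : B (n + 1) = B n + b n := Finset.sum_range_succ _ _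
      calc |S (n + 1) - S m| = |(S (n + 1) - S n) + (S n - S m)| := by ring_nf
        _ ≤ |S (n + 1) - S n| + |S n - S m| := abs_add_le _ _
        _ ≤ b n + (B n - B m) := add_le_add (hb n) ih
        _ = _ := by rw [h1]; ring
  -- `j N` is the last index whose time `τ` does not exceed `N`; the bound `N` on the search loses
  -- nothing since `J ≤ τ J`.
  set j : ℕ → ℕ := fun N => Nat.findGreatest (fun J => τ J ≤ N) N with hj
  have hj1 : ∀ N, τ 0 ≤ N → τ (j N) ≤ N := fun N hN =>
    Nat.findGreatest_spec (P := fun J => τ J ≤ N) (Nat.zero_le N) hN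
  have hj2 : ∀ N, N < τ (j N + 1) := by
    intro N
    by_contra hle
    have h1 : j N + 1 ≤ N := (hτ.le_apply).trans (not_lt.1 hle)
    exact Nat.findGreatest_is_greatest (P := fun J => τ J ≤ N) (Nat.lt_succ_self _) h1
      (not_lt.1 hle)
  have hjt : Tendsto j atTop atTop := by
    refine tendsto_atTop.2 fun J => ?_
    filter_upwards [eventually_ge_atTop (τ J)] with N hN
    exact Nat.le_findGreatest ((hτ.le_apply).trans hN) hN
  have hratio : Tendsto (fun J : ℕ => ((J + 1 : ℕ) : ℝ) / J) atTop (𝓝 1) := by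
    have : Tendsto (fun J : ℕ => 1 + (J : ℝ)⁻¹) atTop (𝓝 (1 + 0)) :=
      tendsto_const_nhds.add tendsto_inv_atTop_nhds_zero_nat
    rw [add_zero] at this
    refine this.congr' ?_
    filter_upwards [eventually_gt_atTop 0] with J hJ
    have : (J : ℝ) ≠ 0 := by positivity
    push_cast
    field_simp
  have hshift : ∀ {f : ℕ → ℝ} {c : ℝ}, Tendsto (fun J : ℕ => f J / J) atTop (𝓝 c) →
      Tendsto (fun J : ℕ => f (J + 1) / J) atTop (𝓝 c) := by
    intro f c hf
    have h1 := (hf.comp (tendsto_add_atTop_nat 1)).mul hratio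
    rw [mul_one] at h1
    refine h1.congr' ?_
    filter_upwards [eventually_gt_atTop 0] with J hJ
    have : (J : ℝ) ≠ 0 := by positivity
    have : ((J + 1 : ℕ) : ℝ) ≠ 0 := by positivity
    simp only [Function.comp]
    field_simp
  -- The total variation inside a single interval is negligible, since the averages of `B` at
  -- consecutive times have the same limit.
  have hD : Tendsto (fun J : ℕ => (B (τ (J + 1)) - B (τ J)) / J) atTop (𝓝 0) := by
    have := (hshift (f := fun J => B (τ J)) hβ).sub hβ
    rw [sub_self] at this
    refine this.congr fun J => ?_
    simp only [hB, sub_div]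
  have hN : Tendsto (fun N : ℕ => (N : ℝ) / j N) atTop (𝓝 a) := by
    refine tendsto_of_tendsto_of_tendsto_of_le_of_le' (ha.comp hjt)
      ((hshift (f := fun J => (τ J : ℝ)) ha).comp hjt) ?_ ?_
    · filter_upwards [eventually_ge_atTop (τ 0)] with N hN
      simp only [Function.comp]
      gcongr
      exact hj1 N hN
    · filter_upwards with N
      simp only [Function.comp]
      gcongr
      exact (hj2 N).le
  have hSN : Tendsto (fun N : ℕ => S N / j N) atTop (𝓝 s) := by
    have h1 : Tendsto (fun N : ℕ => (S N - S (τ (j N))) / j N) atTop (𝓝 0) := by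
      refine squeeze_zero_norm' ?_ (hD.comp hjt)
      filter_upwards [eventually_ge_atTop (τ 0)] with N hN
      simp only [Function.comp]
      rw [norm_div, Real.norm_eq_abs, Real.norm_natCast]
      gcongr
      refine (hSB _ _ (hj1 N hN)).trans ?_
      have := hBmono (hj2 N).le
      linarith
    have h2 := h1.add (hs.comp hjt)
    rw [zero_add] at h2
    refine h2.congr fun N => ?_
    simp only [Function.comp]
    rw [← add_div]
    ring
  refine (hSN.div hN ha0.ne').congr' ?_
  filter_upwards [hjt.eventually_gt_atTop 0, eventually_gt_atTop 0] with N h1 h2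
  have : (j N : ℝ) ≠ 0 := by positivity
  have : (N : ℝ) ≠ 0 := by positivity
  simp only [Pi.div_apply]
  field_simp

section
variable {μ : Measure (PMF (Site d))} [IsProbabilityMeasure μ] {u : Fin d → ℝ} {K ε M : ℝ}

lemma measure_preimage_regShift (hB : Ballistic μ u K ε M) {β : Type*} [MeasurableSpace β]
    (k : ℕ) {φ : Env d × Path d → β} (hφ : Measurable φ) (hloc : PlusLocal u φ) {A : Set β}
    (hA : MeasurableSet A) :
    annealedLaw (iidEnvLaw μ) 0 ((fun s => φ (regShift u k s)) ⁻¹' A) =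
      annealedLaw (iidEnvLaw μ) 0 (φ ⁻¹' A) := by
  have h := lintegral_comp_regShift hB k (G := fun s => A.indicator (fun _ => 1) (φ s))
    ((measurable_const.indicator hA).comp hφ) (hloc.comp _)
  have hφk : Measurable fun s => φ (regShift u k s) := hφ.comp (measurable_regShift u k)
  rw [← lintegral_indicator_one (hφ hA), ← lintegral_indicator_one (hφk hA)]
  exact h

lemma map_comp_regShift (hB : Ballistic μ u K ε M) {β : Type*} [MeasurableSpace β]
    (k : ℕ) {φ : Env d × Path d → β} (hφ : Measurable φ) (hloc : PlusLocal u φ) :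
    (annealedLaw (iidEnvLaw μ) 0).map (fun s => φ (regShift u k s)) =
      (annealedLaw (iidEnvLaw μ) 0).map φ := by
  have hφk : Measurable fun s => φ (regShift u k s) := hφ.comp (measurable_regShift u k)
  ext A hA
  rw [Measure.map_apply hφk hA, Measure.map_apply hφ hA]
  exact measure_preimage_regShift hB k hφ hloc hA

/-- Shifting by the common `i` regenerations reduces to the pair of indices `0` and `j - i`; there
`φ` is determined before regeneration `κ`, and the second function reads only what comes from it on.
-/
lemma indepFun_regShift (hB : Ballistic μ u K ε M) {κ : ℕ} {φ : Env d × Path d → ℝ}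
    (hφ : Measurable φ) (hplus : PlusLocal u φ) (hpast : PastLocal u κ φ) {i j : ℕ}
    (hij : i + κ ≤ j) :
    IndepFun (fun s => φ (regShift u i s)) (fun s => φ (regShift u j s))
      (annealedLaw (iidEnvLaw μ) 0) := by
  obtain ⟨l, rfl⟩ := Nat.exists_eq_add_of_le hij
  rw [indepFun_iff_measure_inter_preimage_eq_mul]
  intro A B hA hB'
  rw [measure_preimage_regShift hB _ hφ hplus hA, measure_preimage_regShift hB _ hφ hplus hB']
  set F : Env d × Path d → ℝ≥0∞ := fun s => A.indicator (fun _ => 1) (φ s)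
  set G : Env d × Path d → ℝ≥0∞ := fun s => B.indicator (fun _ => 1) (φ s)
  have mF : Measurable F := (measurable_const.indicator hA).comp hφ
  have mG : Measurable G := (measurable_const.indicator hB').comp hφ
  have h1 := lintegral_mul_regShift hB κ mF (hpast.comp _)
    (G := fun s => G (regShift u l s)) (mG.comp (measurable_regShift u l))
    ((hplus.comp fun x => B.indicator (fun _ => (1 : ℝ≥0∞)) x).comp_regShift l)
  rw [lintegral_comp_regShift hB l mG (hplus.comp _)] at h1
  have h2 := lintegral_comp_regShift hB i (G := fun s => F s * G (regShift u (κ + l) s))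
    (mF.mul (mG.comp (measurable_regShift u (κ + l)))) (by
      intro ω ω' X hX h
      have e1 := hplus ω ω' X hX h
      have e2 := hplus.comp_regShift (κ + l) ω ω' X hX h
      simp only at e2
      simp only [F, G, e1, e2])
  simp only [regShift_regShift] at h1 h2
  rw [h1] at h2
  have eF : ∫⁻ s, F s ∂annealedLaw (iidEnvLaw μ) 0 = annealedLaw (iidEnvLaw μ) 0 (φ ⁻¹' A) := by
    rw [← lintegral_indicator_one (hφ hA)]; rfl
  have eG : ∫⁻ s, G s ∂annealedLaw (iidEnvLaw μ) 0 = annealedLaw (iidEnvLaw μ) 0 (φ ⁻¹' B) := by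
    rw [← lintegral_indicator_one (hφ hB')]; rfl
  rw [eF, eG] at h2
  have hφk : ∀ k, Measurable fun s => φ (regShift u k s) := fun k =>
    hφ.comp (measurable_regShift u k)
  rw [← h2, ← lintegral_indicator_one ((hφk i hA).inter (hφk (i + κ + l) hB'))]
  refine lintegral_congr fun s => ?_
  simp only [F, G, Set.indicator, Set.mem_inter_iff, Set.mem_preimage, ← add_assoc,
    Pi.one_apply]
  split_ifs <;> simp_all

/-- The strong law of large numbers for functions of finitely many blocks. -/
lemma ae_tendsto_regShift (hB : Ballistic μ u K ε M) {κ : ℕ} (hκ : 0 < κ)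
    {φ : Env d × Path d → ℝ} (hφ : Measurable φ) (hplus : PlusLocal u φ)
    (hpast : PastLocal u κ φ) (hint : Integrable φ (annealedLaw (iidEnvLaw μ) 0)) :
    ∀ᵐ s ∂annealedLaw (iidEnvLaw μ) 0,
      Tendsto (fun J : ℕ => (∑ i ∈ Finset.range (κ * J), φ (regShift u i s)) / J) atTop
        (𝓝 (κ * ∫ s, φ s ∂annealedLaw (iidEnvLaw μ) 0)) := by
  have hmap := fun k => map_comp_regShift hB k hφ hplus
  have hm : ∀ k, Measurable fun s => φ (regShift u k s) := fun k =>
    hφ.comp (measurable_regShift u k)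
  have hid : ∀ k, IdentDistrib (fun s => φ (regShift u k s)) φ
      (annealedLaw (iidEnvLaw μ) 0) (annealedLaw (iidEnvLaw μ) 0) := fun k =>
    ⟨(hm k).aemeasurable, hφ.aemeasurable, hmap k⟩
  -- Along a residue class modulo `κ` the functions are pairwise independent and identically
  -- distributed, so the strong law applies to each class separately.
  have hr : ∀ r : ℕ, ∀ᵐ s ∂annealedLaw (iidEnvLaw μ) 0,
      Tendsto (fun J : ℕ => (J : ℝ)⁻¹ • ∑ j ∈ Finset.range J, φ (regShift u (κ * j + r) s)) atTop
        (𝓝 (∫ s, φ s ∂annealedLaw (iidEnvLaw μ) 0)) := by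
    intro r
    have h := strong_law_ae (μ := annealedLaw (iidEnvLaw μ) 0)
      (fun j s => φ (regShift u (κ * j + r) s)) ((hid _).integrable_iff.2 hint) ?_
      fun j => (hid _).trans (hid _).symm
    · rwa [(hid _).integral_eq] at h
    · intro a b hab
      simp only [Function.onFun]
      have hlt : ∀ {a b : ℕ}, a < b → κ * a + r + κ ≤ κ * b + r := by
        intro a b h
        have : κ * (a + 1) ≤ κ * b := Nat.mul_le_mul_left κ h
        rw [mul_add] at this
        omega
      rcases lt_or_gt_of_ne hab with h | h
      · exact indepFun_regShift hB hφ hplus hpast (hlt h)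
      · exact (indepFun_regShift hB hφ hplus hpast (hlt h)).symm
  filter_upwards [ae_all_iff.2 hr] with s hs
  have h1 := tendsto_finsetSum (Finset.range κ) fun r _ => hs r
  rw [Finset.sum_const, Finset.card_range, nsmul_eq_mul] at h1
  refine h1.congr fun J => ?_
  have h2 : ∀ J : ℕ, ∑ i ∈ Finset.range (κ * J), φ (regShift u i s) =
      ∑ r ∈ Finset.range κ, ∑ j ∈ Finset.range J, φ (regShift u (κ * j + r) s) := by
    intro J
    induction J with
    | zero => simp
    | succ J ih =>
      rw [mul_add, mul_one, Finset.sum_range_add, ih, ← Finset.sum_add_distrib]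
      exact Finset.sum_congr rfl fun r _ => (Finset.sum_range_succ _ _).symm
  rw [h2, div_eq_inv_mul, Finset.mul_sum]
  simp only [smul_eq_mul]

lemma Regular.sum_range_reg {X : Path d} (hX : Regular u X) (ω : Env d) (k n : ℕ)
    (f : Env d × Path d → ℝ) :
    ∑ i ∈ Finset.range (reg u (k + n) X), f (seenFrom i (ω, X)) =
      ∑ i ∈ Finset.range (reg u k X), f (seenFrom i (ω, X)) +
        ∑ i ∈ Finset.range n, blockSum u k f (regShift u i (ω, X)) := by
  induction n with
  | zero => simp
  | succ n ih =>
    rw [Finset.sum_range_succ, ← add_assoc k n 1, ← add_assoc, ← ih, blockSum_regShift, add_comm n k]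
    exact (Finset.sum_range_add_sum_Ico _ (hX.reg_lt_succ (k + n)).le).symm

/-- The first `k` blocks are split off because a functional looking back `k` levels is plus-local
only from the `k`-th block on; their contribution is a fixed number and vanishes in the average. -/
lemma ae_tendsto_sum_range_reg (hB : Ballistic μ u K ε M) {k L : ℕ} {f : Env d × Path d → ℝ}
    (hf : Measurable f) (hloc : StepLocal u k L f)
    (hint : Integrable (blockSum u k f) (annealedLaw (iidEnvLaw μ) 0)) :
    ∀ᵐ s ∂annealedLaw (iidEnvLaw μ) 0,
      Tendsto (fun J : ℕ => (∑ i ∈ Finset.range (reg u (k + (k + 1 + L) * J) s.2),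
        f (seenFrom i s)) / J) atTop
        (𝓝 ((k + 1 + L : ℕ) * ∫ s, blockSum u k f s ∂annealedLaw (iidEnvLaw μ) 0)) := by
  filter_upwards [ae_tendsto_regShift hB (by omega : 0 < k + 1 + L) (measurable_blockSum u k hf)
    (plusLocal_blockSum hloc.lower) (pastLocal_blockSum hloc.upper) hint,
    hB.annealedLaw_ae_regular] with s hs hreg
  have h1 : Tendsto (fun J : ℕ => (∑ i ∈ Finset.range (reg u k s.2), f (seenFrom i s)) / (J : ℝ))
      atTop (𝓝 0) := tendsto_const_div_atTop_nhds_zero_nat _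
  have h2 := h1.add hs
  rw [zero_add] at h2
  refine h2.congr fun J => ?_
  rw [← add_div]
  congr 1
  exact (hreg.sum_range_reg s.1 k _ f).symm

lemma integral_blockSum_one (hB : Ballistic μ u K ε M) (k : ℕ) :
    Integrable (blockSum u k fun _ => (1 : ℝ)) (annealedLaw (iidEnvLaw μ) 0) ∧
    ∫ s, blockSum u k (fun _ => (1 : ℝ)) s ∂annealedLaw (iidEnvLaw μ) 0 =
      (meanSigma μ u).toReal := by
  have h0 : ∀ s : Env d × Path d, blockSum u k (fun _ => (1 : ℝ)) s =
      (blockSum u k (fun _ => (1 : ℝ≥0∞)) s).toReal := by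
    intro s
    rw [blockSum, blockSum, ENNReal.toReal_sum (by simp)]
    simp only [ENNReal.toReal_one]
  have hm : AEMeasurable (blockSum u k fun _ => (1 : ℝ≥0∞)) (annealedLaw (iidEnvLaw μ) 0) :=
    (measurable_blockSum u k measurable_const).aemeasurable
  have h1 := lintegral_blockSum_one hB k
  have hfin := meanSigma_lt_top hB
  constructor
  · rw [funext h0]
    exact integrable_toReal_of_lintegral_ne_top hm (by rw [h1]; exact hfin.ne)
  · simp only [h0]
    rw [integral_toReal hm, h1]
    exact ae_lt_top' hm (by rw [h1]; exact hfin.ne)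

/-- The law of large numbers for additive functionals of the environment and the walk. -/
lemma ae_tendsto_average (hB : Ballistic μ u K ε M) {k L : ℕ} {f b : Env d × Path d → ℝ}
    (hf : Measurable f) (hfloc : StepLocal u k L f) (hb : Measurable b)
    (hbloc : StepLocal u k L b) (hfb : ∀ s, |f s| ≤ b s)
    (hint : Integrable (blockSum u k b) (annealedLaw (iidEnvLaw μ) 0)) :
    ∀ᵐ s ∂annealedLaw (iidEnvLaw μ) 0,
      Tendsto (fun N : ℕ => (∑ i ∈ Finset.range N, f (seenFrom i s)) / N) atTop
        (𝓝 ((∫ s, blockSum u k f s ∂annealedLaw (iidEnvLaw μ) 0) / (meanSigma μ u).toReal)) := by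
  have hfint : Integrable (blockSum u k f) (annealedLaw (iidEnvLaw μ) 0) := by
    refine hint.mono' (measurable_blockSum u k hf).aestronglyMeasurable (ae_of_all _ fun s => ?_)
    exact (norm_sum_le _ _).trans (Finset.sum_le_sum fun n _ => hfb _)
  have h1 := integral_blockSum_one hB k
  filter_upwards [ae_tendsto_sum_range_reg hB hf hfloc hfint,
    ae_tendsto_sum_range_reg hB hb hbloc hint,
    ae_tendsto_sum_range_reg hB (k := k) (L := L) (f := fun _ => (1 : ℝ)) measurable_const
      ⟨fun _ _ _ _ => rfl, fun _ _ _ _ _ _ _ => rfl⟩ h1.1, hB.annealedLaw_ae_regular]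
    with s e1 e2 e3 hreg
  have hκ : (0 : ℝ) < (k + 1 + L : ℕ) := by positivity
  have hm := toReal_meanSigma_pos hB
  rw [h1.2] at e3
  -- Both the functional and the time are summed over groups of `k + 1 + L` blocks; this common
  -- factor cancels in the quotient.
  have hlim := tendsto_div_of_tendsto_subseq
    (S := fun N => ∑ i ∈ Finset.range N, f (seenFrom i s)) (b := fun i => b (seenFrom i s))
    (τ := fun J => reg u (k + (k + 1 + L) * J) s.2)
    (fun J J' h => hreg.strictMono_reg (by
      have : (k + 1 + L) * J < (k + 1 + L) * J' := Nat.mul_lt_mul_of_pos_left h (by omega)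
      omega))
    (mul_pos hκ hm) (by simpa using e3) e1
    (fun n => by rw [Finset.sum_range_succ, add_sub_cancel_left]; exact hfb _) e2
  rwa [mul_div_mul_left _ _ hκ.ne'] at hlim

end

/-! ### Gluing independent blocks behind the walk -/

/-- The environment `ω` on nonnegative levels, and behind it the environments of `k` independent
blocks. -/
def glue (u : Fin d → ℝ) : ℕ → Env d → (ℕ → Env d × Path d) → Env d
  | 0, ω, _ => ω
  | k + 1, ω, ξ => patch (upper u) ω
      (shift ((ξ 0).2 (reg u 1 (ξ 0).2)) (glue u k (ξ 0).1 fun i => ξ (i + 1)))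

lemma glue_succ (u : Fin d → ℝ) (k : ℕ) (ω : Env d) (ξ : ℕ → Env d × Path d) :
    glue u (k + 1) ω ξ = patch (upper u) ω
      (shift ((ξ 0).2 (reg u 1 (ξ 0).2)) (glue u k (ξ 0).1 fun i => ξ (i + 1))) := rfl

lemma measurable_shift_uncurry : Measurable fun q : Site d × Env d => shift q.1 q.2 :=
  measurable_from_prod_countable_right fun x => measurable_shift x

lemma measurable_path_at {τ : Path d → ℕ} (hτ : Measurable τ) :
    Measurable fun X : Path d => X (τ X) := by
  have h : Measurable fun q : Path d × ℕ => q.1 q.2 :=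
    measurable_from_prod_countable_left fun n => measurable_pi_apply n
  exact h.comp (measurable_id.prodMk hτ)

lemma measurable_glue (u : Fin d → ℝ) (k : ℕ) :
    Measurable fun q : Env d × (ℕ → Env d × Path d) => glue u k q.1 q.2 := by
  induction k with
  | zero => exact measurable_fst
  | succ k ih =>
    have h0 : Measurable fun q : Env d × (ℕ → Env d × Path d) => q.2 0 :=
      (measurable_pi_apply 0).comp measurable_snd
    have h1 : Measurable fun q : Env d × (ℕ → Env d × Path d) =>
        (q.2 0).2 (reg u 1 (q.2 0).2) :=
      (measurable_path_at (measurable_reg u 1)).comp (measurable_snd.comp h0)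
    have h2 : Measurable fun q : Env d × (ℕ → Env d × Path d) =>
        ((q.2 0).1, fun i => q.2 (i + 1)) :=
      (measurable_fst.comp h0).prodMk (measurable_pi_lambda _ fun i =>
        (measurable_pi_apply (i + 1)).comp measurable_snd)
    have h3 := measurable_shift_uncurry.comp (h1.prodMk (ih.comp h2))
    exact (measurable_patch (upper u)).comp (measurable_fst.prodMk h3)

/-- The environment `ω` on nonnegative levels, and behind it the environments of infinitely many
independent blocks. -/
def glueLim (u : Fin d → ℝ) (ω : Env d) (ξ : ℕ → Env d × Path d) : Env d :=
  fun y => glue u ⌈-level u y⌉₊ ω ξ y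

lemma measurable_glueLim (u : Fin d → ℝ) :
    Measurable fun q : Env d × (ℕ → Env d × Path d) => glueLim u q.1 q.2 :=
  measurable_pi_lambda _ fun y => (measurable_pi_apply y).comp (measurable_glue u _)

lemma glue_succ_apply {u : Fin d → ℝ} {k : ℕ} {ω : Env d} {ξ : ℕ → Env d × Path d}
    (hξ : ∀ i, Regular u (ξ i).2) {y : Site d} (hy : -(k : ℝ) ≤ level u y) :
    glue u (k + 1) ω ξ y = glue u k ω ξ y := by
  induction k generalizing ω ξ y with
  | zero =>
    rw [glue_succ, patch_of_mem]
    · rfl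
    · simpa [upper] using hy
  | succ k ih =>
    by_cases h : y ∈ upper u
    · rw [glue_succ u (k + 1), glue_succ u k ω, patch_of_mem _ _ h, patch_of_mem _ _ h]
    · rw [glue_succ u (k + 1), glue_succ u k ω, patch_of_notMem _ _ h, patch_of_notMem _ _ h]
      simp only [shift]
      refine ih (fun i => hξ (i + 1)) ?_
      have h1 := (hξ 0).le_level_reg 1
      rw [level_add]
      push_cast at hy h1
      linarith

lemma glueLim_apply {u : Fin d → ℝ} {k : ℕ} {ω : Env d} {ξ : ℕ → Env d × Path d}
    (hξ : ∀ i, Regular u (ξ i).2) {y : Site d} (hy : -(k : ℝ) ≤ level u y) :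
    glueLim u ω ξ y = glue u k ω ξ y := by
  have hk : ⌈-level u y⌉₊ ≤ k := Nat.ceil_le.2 (by linarith)
  unfold glueLim
  induction k, hk using Nat.le_induction with
  | base => rfl
  | succ k hk ih =>
    have h1 : -(k : ℝ) ≤ level u y := by
      have := (Nat.le_ceil (-level u y)).trans (by exact_mod_cast hk : _ ≤ (k : ℝ))
      linarith
    rw [glue_succ_apply hξ h1]
    exact ih h1

/-- Adding an independent factor in front of an infinite product. -/
lemma measurePreserving_cons {α : Type*} [MeasurableSpace α] (ν : Measure α)
    [IsProbabilityMeasure ν] :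
    MeasurePreserving (fun q : (ℕ → α) × α => (fun n => Nat.casesOn n q.2 q.1 : ℕ → α))
      ((Measure.infinitePi fun _ : ℕ => ν).prod ν) (Measure.infinitePi fun _ : ℕ => ν) := by
  have hm : Measurable fun q : (ℕ → α) × α => (fun n => Nat.casesOn n q.2 q.1 : ℕ → α) := by
    refine measurable_pi_lambda _ fun n => ?_
    cases n with
    | zero => exact measurable_snd
    | succ n => exact (measurable_pi_apply n).comp measurable_fst
  refine ⟨hm, ?_⟩
  refine Measure.eq_infinitePi _ fun s t ht => ?_
  classical
  rw [Measure.map_apply hm (MeasurableSet.pi s.countable_toSet fun i _ => ht i)]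
  set s' : Finset ℕ := s.preimage Nat.succ Nat.succ_injective.injOn with hs'
  have hpre : (fun q : (ℕ → α) × α => (fun n => Nat.casesOn n q.2 q.1 : ℕ → α)) ⁻¹' Set.pi s t =
      (Set.pi s' fun i => t (i + 1)) ×ˢ (if 0 ∈ s then t 0 else Set.univ) := by
    ext q
    simp only [Set.mem_preimage, Set.mem_pi, Set.mem_prod, hs', Finset.coe_preimage,
      Finset.mem_coe]
    constructor
    · intro h
      refine ⟨fun i hi => h (i + 1) hi, ?_⟩
      split_ifs with h0
      · exact h 0 h0
      · trivial
    · rintro ⟨h1, h2⟩ i hi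
      cases i with
      | zero => rw [if_pos hi] at h2; exact h2
      | succ i => exact h1 i hi
  rw [hpre, Measure.prod_prod, Measure.infinitePi_pi _ fun i _ => ht _]
  have hprod : ∏ i ∈ s', ν (t (i + 1)) = ∏ i ∈ s.erase 0, ν (t i) := by
    refine Finset.prod_bij (fun i _ => i + 1) ?_ ?_ ?_ ?_
    · intro i hi
      exact Finset.mem_erase.2 ⟨by omega, by simpa [hs'] using hi⟩
    · intro i _ j _ h; omega
    · intro i hi
      obtain ⟨h0, h1⟩ := Finset.mem_erase.1 hi
      obtain ⟨k, rfl⟩ := Nat.exists_eq_succ_of_ne_zero h0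
      exact ⟨k, by simpa [hs'] using h1, rfl⟩
    · intro i _; rfl
  rw [hprod]
  by_cases h0 : 0 ∈ s
  · rw [if_pos h0, Finset.prod_erase_mul s (fun i => ν (t i)) h0]
  · rw [if_neg h0, measure_univ, mul_one, Finset.erase_eq_of_notMem h0]

/-! ### The equilibrium measure as the occupation measure of a block -/

section
variable (μ : Measure (PMF (Site d))) [IsProbabilityMeasure μ] (u : Fin d → ℝ)

/-- The law of the independent blocks behind the walk. -/
def blocksLaw : Measure (ℕ → Env d × Path d) :=
  Measure.infinitePi fun _ : ℕ => annealedLaw (iidEnvLaw μ) 0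

instance : IsProbabilityMeasure (blocksLaw μ) := by
  unfold blocksLaw; infer_instance

/-- The law of the glued environment and the walk. -/
def gluedLaw : Measure (Env d × Path d) :=
  ((blocksLaw μ).prod (annealedLaw (iidEnvLaw μ) 0)).map fun q => (glueLim u q.2.1 q.1, q.2.2)

/-- The equilibrium measure of the environment chain: the occupation measure of the environment
seen from the walk during one block. -/
def equilibrium : Measure (Env d) :=
  (meanSigma μ u)⁻¹ • Measure.sum fun n : ℕ =>
    ((gluedLaw μ u).restrict {s | s.2 ∈ inBlock u 0 n}).map fun s => shift (s.2 n) s.1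

variable {μ u} {K ε M : ℝ}

/-- By repeated regeneration, the environment seen from the `k`-th regeneration has the law of a
fresh one with `k` independent blocks behind it. Here `ξ 0` is the block just completed and larger
indices lie further in the past. -/
lemma lintegral_comp_regShift_eq_glue (hB : Ballistic μ u K ε M) (k : ℕ)
    {H : Env d × Path d → ℝ≥0∞} (hH : Measurable H) :
    ∫⁻ s, H (regShift u k s) ∂annealedLaw (iidEnvLaw μ) 0 =
      ∫⁻ ξ, ∫⁻ t, H (glue u k t.1 ξ, t.2) ∂annealedLaw (iidEnvLaw μ) 0 ∂blocksLaw μ := by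
  induction k generalizing H with
  | zero =>
    simp only [glue, lintegral_const, measure_univ, mul_one]
    refine lintegral_congr_ae ?_
    filter_upwards [hB.annealedLaw_ae_regular] with s hs
    have : pathShift 0 s.2 = s.2 := by funext k; simp [pathShift, hs.zero]
    simp [regShift, seenFrom, hs.zero, this]
  | succ k ih =>
    rw [lintegral_regeneration hB (k + 1) (fun _ t => H t) (hH.comp measurable_snd)
      fun _ _ _ _ _ _ _ _ => rfl]
    set g : Env d → ℝ≥0∞ := fun η =>
      ∫⁻ t, H (patch (upper u) t.1 η, t.2) ∂annealedLaw (iidEnvLaw μ) 0 with hg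
    have mg : Measurable g := by
      have : Measurable fun q : Env d × (Env d × Path d) =>
          H (patch (upper u) q.2.1 q.1, q.2.2) :=
        hH.comp (((measurable_patch (upper u)).comp
          ((measurable_fst.comp measurable_snd).prodMk measurable_fst)).prodMk
          (measurable_snd.comp measurable_snd))
      exact this.lintegral_prod_right'
    -- The last regeneration is averaged out first; what remains is a function of the environment
    -- and the walk seen from regeneration `k`, to which the induction hypothesis applies.
    set H' : Env d × Path d → ℝ≥0∞ := fun s => g (shift (s.2 (reg u 1 s.2)) s.1) with hH'
    have mH' : Measurable H' := by
      have h1 : Measurable fun s : Env d × Path d => s.2 (reg u 1 s.2) :=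
        (measurable_path_at (measurable_reg u 1)).comp measurable_snd
      exact mg.comp (measurable_shift_uncurry.comp (h1.prodMk measurable_fst))
    have e1 : ∀ s : Env d × Path d, g (shift (s.2 (reg u (k + 1) s.2)) s.1) =
        H' (regShift u k s) := by
      intro s
      have := congrArg Prod.fst (regShift_regShift u k 1 s)
      simp only [hH']
      exact congrArg g this.symm
    have e2 : ∀ ξ : ℕ → Env d × Path d,
        ∫⁻ t, H (glue u (k + 1) t.1 ξ, t.2) ∂annealedLaw (iidEnvLaw μ) 0 =
          H' (glue u k (ξ 0).1 fun i => ξ (i + 1), (ξ 0).2) := fun ξ => rfl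
    change ∫⁻ s, g (shift (s.2 (reg u (k + 1) s.2)) s.1) ∂annealedLaw (iidEnvLaw μ) 0 = _
    simp only [e1, e2]
    rw [ih mH']
    have m1 : Measurable fun ξ : ℕ → Env d × Path d =>
        H' (glue u k (ξ 0).1 fun i => ξ (i + 1), (ξ 0).2) := by
      have h0 : Measurable fun ξ : ℕ → Env d × Path d => ((ξ 0).1, fun i => ξ (i + 1)) :=
        (measurable_fst.comp (measurable_pi_apply 0)).prodMk
          (measurable_pi_lambda _ fun i => measurable_pi_apply (i + 1))
      exact mH'.comp (((measurable_glue u k).comp h0).prodMk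
        (measurable_snd.comp (measurable_pi_apply 0)))
    have hc := measurePreserving_cons (annealedLaw (iidEnvLaw μ) 0)
    have h1 := hc.lintegral_comp m1
    have h2 := lintegral_prod _ (m1.comp hc.measurable).aemeasurable
      (μ := Measure.infinitePi fun _ : ℕ => annealedLaw (iidEnvLaw μ) 0)
      (ν := annealedLaw (iidEnvLaw μ) 0)
    exact h2.symm.trans h1

lemma lintegral_equilibrium {f : Env d → ℝ≥0∞} (hf : Measurable f) :
    ∫⁻ ω, f ω ∂equilibrium μ u =
      (meanSigma μ u)⁻¹ * ∫⁻ s, blockSum u 0 (fun s => f s.1) s ∂gluedLaw μ u := by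
  have hm : ∀ n, MeasurableSet {s : Env d × Path d | s.2 ∈ inBlock u 0 n} := fun n =>
    measurable_snd (measurableSet_inBlock u 0 n)
  unfold equilibrium
  rw [lintegral_smul_measure, lintegral_sum_measure, smul_eq_mul]
  simp only [blockSum_eq_tsum]
  have hmn : ∀ n, Measurable fun s : Env d × Path d =>
      (inBlock u 0 n).indicator (fun _ => (1 : ℝ≥0∞)) s.2 * f (seenFrom n s).1 := fun n =>
    ((measurable_indicator_inBlock u 0 n).comp measurable_snd).mul
      ((hf.comp measurable_fst).comp (measurable_seenFrom n))
  rw [lintegral_tsum fun n => (hmn n).aemeasurable]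
  congr 1
  refine tsum_congr fun n => ?_
  rw [lintegral_map hf (measurable_shift_apply n), ← lintegral_indicator (hm n)]
  refine lintegral_congr fun s => ?_
  by_cases h : s.2 ∈ inBlock u 0 n
  · rw [Set.indicator_of_mem (show s ∈ {s : Env d × Path d | s.2 ∈ inBlock u 0 n} from h)]
    simp [h, seenFrom]
  · rw [Set.indicator_of_notMem (show s ∉ {s : Env d × Path d | s.2 ∈ inBlock u 0 n} from h)]
    simp [h]

/-- A function which depends only on the environment on the levels `≥ -k`. -/
def EnvLocal {α : Type*} (u : Fin d → ℝ) (k : ℕ) (f : Env d → α) : Prop :=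
  ∀ ω ω', (∀ y, -(k : ℝ) ≤ level u y → ω y = ω' y) → f ω = f ω'

/-- The equilibrium measure on the functions which depend only on the levels `≥ -k`. -/
lemma lintegral_equilibrium_of_envLocal (hB : Ballistic μ u K ε M) {k : ℕ} {f : Env d → ℝ≥0∞}
    (hf : Measurable f) (hloc : EnvLocal u k f) :
    ∫⁻ ω, f ω ∂equilibrium μ u =
      (meanSigma μ u)⁻¹ *
        ∫⁻ s, blockSum u k (fun s => f s.1) s ∂annealedLaw (iidEnvLaw μ) 0 := by
  have mb : Measurable (blockSum u 0 fun s : Env d × Path d => f s.1) :=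
    measurable_blockSum u 0 (hf.comp measurable_fst)
  have mE : Measurable fun q : (ℕ → Env d × Path d) × (Env d × Path d) =>
      (glueLim u q.2.1 q.1, q.2.2) :=
    ((measurable_glueLim u).comp ((measurable_fst.comp measurable_snd).prodMk
      measurable_fst)).prodMk (measurable_snd.comp measurable_snd)
  rw [lintegral_equilibrium hf]
  congr 1
  have e1 : ∀ s : Env d × Path d, blockSum u k (fun s => f s.1) s =
      blockSum u 0 (fun s => f s.1) (regShift u k s) := fun s => by
    rw [blockSum_regShift, add_zero]
  simp only [e1]
  have mbE : Measurable fun q : (ℕ → Env d × Path d) × (Env d × Path d) =>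
      blockSum u 0 (fun s => f s.1) (glueLim u q.2.1 q.1, q.2.2) := mb.comp mE
  rw [lintegral_comp_regShift_eq_glue hB k mb, gluedLaw, lintegral_map mb mE,
    lintegral_prod _ mbE.aemeasurable]
  have hreg : ∀ᵐ ξ ∂blocksLaw μ, ∀ i, Regular u (ξ i).2 := by
    refine ae_all_iff.2 fun i => ?_
    have h := measurePreserving_eval_infinitePi
      (fun _ : ℕ => annealedLaw (iidEnvLaw μ) (0 : Site d)) i
    exact h.quasiMeasurePreserving.ae hB.annealedLaw_ae_regular
  refine lintegral_congr_ae ?_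
  filter_upwards [hreg] with ξ hξ
  refine lintegral_congr_ae ?_
  filter_upwards [hB.annealedLaw_ae_regular] with t ht
  refine Finset.sum_congr rfl fun n _ => hloc _ _ fun y hy => ?_
  simp only [seenFrom, shift]
  refine glueLim_apply hξ ?_
  have := ht.level_nonneg n
  rw [level_add]
  linarith

lemma isProbabilityMeasure_equilibrium (hB : Ballistic μ u K ε M) :
    IsProbabilityMeasure (equilibrium μ u) := by
  constructor
  have := lintegral_equilibrium_of_envLocal hB (k := 0) (f := fun _ => 1) measurable_const
    fun _ _ _ => rfl
  rw [lintegral_blockSum_one hB, lintegral_one] at this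
  rw [this, ENNReal.inv_mul_cancel (meanSigma_ne_zero hB) (meanSigma_lt_top hB).ne]

lemma ae_shift_notMem {A : Set (Env d)} (hA : iidEnvLaw μ A = 0) :
    ∀ᵐ s ∂annealedLaw (iidEnvLaw μ) 0, ∀ n, shift (s.2 n) s.1 ∉ A := by
  have h : ∀ x : Site d, ∀ᵐ s ∂annealedLaw (iidEnvLaw μ) 0, shift x s.1 ∉ A := by
    intro x
    have h1 : ∀ᵐ ω ∂iidEnvLaw μ, shift x ω ∉ A :=
      (measurePreserving_shift μ x).quasiMeasurePreserving.ae (measure_eq_zero_iff_ae_notMem.1 hA)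
    have h2 : (annealedLaw (iidEnvLaw μ) 0).fst = iidEnvLaw μ := Measure.fst_compProd _ _
    rw [← h2] at h1
    exact ae_of_ae_map measurable_fst.aemeasurable h1
  filter_upwards [ae_all_iff.2 h] with s hs n using hs (s.2 n)

/-- All translates of a null set are null and there are countably many of them, so the environment
seen from the actual walk never enters `A`. Locality transfers this to the glued block. -/
lemma equilibrium_null (hB : Ballistic μ u K ε M) {k : ℕ} {A : Set (Env d)}
    (hA : MeasurableSet A) (hloc : EnvLocal u k fun ω => ω ∈ A) (h0 : iidEnvLaw μ A = 0) :
    equilibrium μ u A = 0 := by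
  have h := lintegral_equilibrium_of_envLocal hB (k := k) (f := A.indicator fun _ => 1)
    (measurable_const.indicator hA) fun ω ω' h => by
      have := hloc ω ω' h
      exact indicator_congr_of_iff (iff_of_eq this) 1
  have h1 : ∫⁻ ω, A.indicator (fun _ => 1) ω ∂equilibrium μ u = equilibrium μ u A :=
    lintegral_indicator_one hA
  rw [← h1, h]
  have : ∫⁻ s, blockSum u k (fun s => A.indicator (fun _ => (1 : ℝ≥0∞)) s.1) s
      ∂annealedLaw (iidEnvLaw μ) 0 = 0 := by
    rw [← lintegral_zero]
    refine lintegral_congr_ae ?_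
    filter_upwards [ae_shift_notMem h0] with s hs
    exact Finset.sum_eq_zero fun n _ => Set.indicator_of_notMem (hs n) _
  rw [this, mul_zero]

end

/-! ### The half-space σ-fields -/

lemma measurableSet_of_halfSpace {u : Fin d → ℝ} {k : ℤ} {A : Set (Env d)}
    (hA : MeasurableSet[halfSpace u k] A) :
    MeasurableSet A ∧
      ∀ ω ω' : Env d, (∀ y, (k : ℝ) ≤ level u y → ω y = ω' y) → (ω ∈ A ↔ ω' ∈ A) := by
  set r : Env d → ({x : Site d // (k : ℝ) ≤ level u x} → PMF (Site d)) := fun ω x => ω x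
  have hr : Measurable r := measurable_pi_lambda _ fun x => measurable_pi_apply _
  have hle : halfSpace u k ≤ MeasurableSpace.comap r inferInstance := by
    refine iSup_le fun x => ?_
    have : (fun ω : Env d => ω x) = (fun q => q x) ∘ r := rfl
    rw [this, ← MeasurableSpace.comap_comp]
    exact MeasurableSpace.comap_mono (measurable_pi_apply x).comap_le
  obtain ⟨B, hB, rfl⟩ := hle _ hA
  refine ⟨hr hB, fun ω ω' h => ?_⟩
  have : r ω = r ω' := funext fun x => h x x.2
  simp only [Set.mem_preimage, this]

/-- Overwriting the environment below level `-k` by a constant is measurable for the half-space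
σ-field and does not affect membership in `A`. With the preceding converse, half-space events may be
handled through locality alone. -/
lemma measurableSet_halfSpace {u : Fin d → ℝ} {k : ℕ} {A : Set (Env d)}
    (hA : MeasurableSet A) (hloc : EnvLocal u k fun ω => ω ∈ A) :
    MeasurableSet[halfSpace u (-k)] A := by
  set c : Env d → Env d := fun ω => patch {y | -(k : ℝ) ≤ level u y} ω fun _ => PMF.pure 0 with hc
  have hcm : @Measurable _ _ (halfSpace u (-k)) _ c := by
    refine @measurable_pi_lambda _ _ _ (halfSpace u (-k)) _ _ fun y => ?_
    by_cases hy : -(k : ℝ) ≤ level u y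
    · have : (fun ω => c ω y) = fun ω : Env d => ω y := by
        funext ω; exact patch_of_mem _ _ hy
      rw [this]
      refine Measurable.mono (comap_measurable fun ω : Env d => ω y) ?_ le_rfl
      exact le_iSup (fun x : {x : Site d // ((-k : ℤ) : ℝ) ≤ level u x} =>
        MeasurableSpace.comap (fun ω : Env d => ω x) inferInstance) ⟨y, by push_cast; exact hy⟩
    · have : (fun ω => c ω y) = fun _ : Env d => PMF.pure 0 := by
        funext ω; exact patch_of_notMem _ _ hy
      rw [this]
      exact measurable_const
  have : A = c ⁻¹' A := by
    ext ω
    exact iff_of_eq (hloc ω (c ω) fun y hy => (patch_of_mem _ _ hy).symm)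
  rw [this]
  exact hcm hA

lemma exists_level_bounds (u : Fin d → ℝ) (s : Finset (Site d)) :
    ∃ k L : ℕ, ∀ y ∈ s, -(k : ℝ) ≤ level u y ∧ level u y < L := by
  obtain ⟨k, hk⟩ := exists_nat_gt (∑ y ∈ s, |level u y|)
  refine ⟨k, k, fun y hy => ?_⟩
  have : |level u y| ≤ ∑ y ∈ s, |level u y| :=
    Finset.single_le_sum (f := fun y => |level u y|) (fun _ _ => abs_nonneg _) hy
  have := abs_lt.1 (this.trans_lt hk)
  exact ⟨this.1.le, this.2⟩

lemma measurableCylinders_local (u : Fin d → ℝ) {A : Set (Env d)}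
    (hA : A ∈ measurableCylinders fun _ : Site d => PMF (Site d)) :
    MeasurableSet A ∧ ∃ k L : ℕ, ∀ ω ω' : Env d,
      (∀ y, -(k : ℝ) ≤ level u y → level u y < L → ω y = ω' y) → (ω ∈ A ↔ ω' ∈ A) := by
  refine ⟨MeasurableSet.of_mem_measurableCylinders hA, ?_⟩
  obtain ⟨s, S, -, rfl⟩ := (mem_measurableCylinders _).1 hA
  obtain ⟨k, L, h⟩ := exists_level_bounds u s
  refine ⟨k, L, fun ω ω' hω => ?_⟩
  have : s.restrict ω = s.restrict ω' := by
    funext y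
    exact hω y (h y y.2).1 (h y y.2).2
  simp only [mem_cylinder, this]

/-! ### Invariance of the equilibrium measure -/

lemma sum_Ico_succ_add {β : Type*} [AddCommMonoid β] (g : ℕ → β) {a b : ℕ} (h : a ≤ b) :
    ∑ n ∈ Finset.Ico a b, g (n + 1) + g a = ∑ n ∈ Finset.Ico a b, g n + g b := by
  induction b, h using Nat.le_induction with
  | base => simp
  | succ b hab ih =>
    rw [Finset.sum_Ico_succ_top hab, Finset.sum_Ico_succ_top hab, add_right_comm, ih]

/-- The environment chain, restricted to jumps with nonnegative level. -/
def forwardMean (u : Fin d → ℝ) (f : Env d → ℝ≥0∞) (ω : Env d) : ℝ≥0∞ :=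
  ∑' z, (upper u).indicator (fun z => f (shift z ω)) z * ω 0 z

lemma measurable_forwardMean (u : Fin d → ℝ) {f : Env d → ℝ≥0∞} (hf : Measurable f) :
    Measurable (forwardMean u f) := by
  refine Measurable.tsum fun z => ?_
  refine Measurable.mul ?_ ((measurable_pmf_apply z).comp (measurable_pi_apply (0 : Site d)))
  by_cases hz : z ∈ upper u
  · simp only [Set.indicator_of_mem hz]
    exact hf.comp (measurable_shift z)
  · simp only [Set.indicator_of_notMem hz]
    exact measurable_const

lemma forwardMean_eq {u : Fin d → ℝ} {f : Env d → ℝ≥0∞} (hf : Measurable f) {ω : Env d}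
    (hω : Forward u (ω 0)) : forwardMean u f ω = ∫⁻ η, f η ∂envKernel ω := by
  rw [lintegral_envKernel ω hf]
  refine tsum_congr fun z => ?_
  by_cases hz : z ∈ upper u
  · rw [Set.indicator_of_mem hz]
  · rw [hω z (not_le.1 hz), mul_zero, mul_zero]

/-- Dropping the backward jumps is what preserves locality for every environment, not only almost
every one: a backward jump would let the shifted function read below level `-k`. -/
lemma envLocal_forwardMean {u : Fin d → ℝ} {k : ℕ} {f : Env d → ℝ≥0∞} (hf : EnvLocal u k f) :
    EnvLocal u k (forwardMean u f) := by
  intro ω ω' h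
  refine tsum_congr fun z => ?_
  rw [h 0 (by simp)]
  by_cases hz : z ∈ upper u
  · rw [Set.indicator_of_mem hz, Set.indicator_of_mem hz,
      hf (shift z ω) (shift z ω') fun y hy => h _ ?_]
    have : 0 ≤ level u z := hz
    rw [level_add]
    linarith
  · rw [Set.indicator_of_notMem hz, Set.indicator_of_notMem hz]

lemma measurableSet_forward (u : Fin d → ℝ) :
    MeasurableSet {q : PMF (Site d) | Forward u q} := by
  have : {q : PMF (Site d) | Forward u q} =
      ⋂ z : Site d, ⋂ _ : level u z < 0, {q : PMF (Site d) | q z = 0} := by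
    ext q; simp [Forward]
  rw [this]
  exact MeasurableSet.iInter fun z => MeasurableSet.iInter fun _ =>
    measurable_pmf_apply z (measurableSet_singleton 0)

section
variable {μ : Measure (PMF (Site d))} [IsProbabilityMeasure μ] {u : Fin d → ℝ} {K ε M : ℝ}

/-- A measure for which the null sets of `P` in the half-spaces are null sets. -/
def HalfSpaceAC (μ : Measure (PMF (Site d))) [IsProbabilityMeasure μ] (u : Fin d → ℝ)
    (Q : Measure (Env d)) : Prop :=
  ∀ (k : ℕ) (A : Set (Env d)), MeasurableSet A → EnvLocal u k (fun ω => ω ∈ A) →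
    iidEnvLaw μ A = 0 → Q A = 0

lemma HalfSpaceAC.ae_site {Q : Measure (Env d)} (hQ : HalfSpaceAC μ u Q)
    {r : PMF (Site d) → Prop} (hr : MeasurableSet {q | r q}) (x : Site d)
    (h : ∀ᵐ ω ∂iidEnvLaw μ, r (ω x)) : ∀ᵐ ω ∂Q, r (ω x) := by
  obtain ⟨k, hk⟩ := exists_nat_ge (-level u x)
  refine ae_iff.2 (hQ k _ ?_ (fun ω ω' hω => ?_) (ae_iff.1 h))
  · exact (measurable_pi_apply x hr).compl
  · have := hω x (by linarith)
    simp only [Set.mem_ofPred_eq, this]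

lemma HalfSpaceAC.ae_forward (hB : Ballistic μ u K ε M) {Q : Measure (Env d)}
    (hQ : HalfSpaceAC μ u Q) : ∀ᵐ ω ∂Q, ∀ x, Forward u (ω x) :=
  ae_all_iff.2 fun x => hQ.ae_site (measurableSet_forward u) x (by
    filter_upwards [hB.good] with ω hω using (hω x).forward)

lemma Ballistic.ae_forward (hB : Ballistic μ u K ε M) :
    ∀ᵐ s ∂annealedLaw (iidEnvLaw μ) 0, ∀ x, Forward u (s.1 x) := by
  have h2 : (annealedLaw (iidEnvLaw μ) (0 : Site d)).fst = iidEnvLaw μ := Measure.fst_compProd _ _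
  have h1 : ∀ᵐ ω ∂(annealedLaw (iidEnvLaw μ) (0 : Site d)).fst, ∀ x, Forward u (ω x) := by
    rw [h2]
    filter_upwards [hB.good] with ω hω x using (hω x).forward
  exact ae_of_ae_map measurable_fst.aemeasurable h1

lemma halfSpaceAC_equilibrium (hB : Ballistic μ u K ε M) :
    HalfSpaceAC μ u (equilibrium μ u) :=
  fun _ _ hA hloc h0 => equilibrium_null hB hA hloc h0

/-- Applying the kernel inside a block shifts the summation by one time step, so the block sum
changes only by its two boundary terms. These are the function at regenerations `k` and `k + 1`,
which have equal means. -/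
lemma lintegral_envKernel_equilibrium (hB : Ballistic μ u K ε M) {k : ℕ} {f : Env d → ℝ≥0∞}
    (hf : Measurable f) (hloc : EnvLocal u k f) (hle : ∀ ω, f ω ≤ 1) :
    ∫⁻ ω, ∫⁻ η, f η ∂envKernel ω ∂equilibrium μ u = ∫⁻ ω, f ω ∂equilibrium μ u := by
  have h1 : ∫⁻ ω, ∫⁻ η, f η ∂envKernel ω ∂equilibrium μ u =
      ∫⁻ ω, forwardMean u f ω ∂equilibrium μ u := by
    refine lintegral_congr_ae ?_
    filter_upwards [(halfSpaceAC_equilibrium hB).ae_forward hB] with ω hω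
    exact (forwardMean_eq hf (hω 0)).symm
  rw [h1, lintegral_equilibrium_of_envLocal hB (measurable_forwardMean u hf)
    (envLocal_forwardMean hloc), lintegral_equilibrium_of_envLocal hB hf hloc]
  congr 1
  have mκ : Measurable fun ω : Env d => ∫⁻ η, f η ∂envKernel ω :=
    hf.lintegral_kernel (κ := envKernel)
  have h2 : ∫⁻ s, blockSum u k (fun s => forwardMean u f s.1) s ∂annealedLaw (iidEnvLaw μ) 0 =
      ∫⁻ s, blockSum u k (fun s => ∫⁻ η, f η ∂envKernel s.1) s ∂annealedLaw (iidEnvLaw μ) 0 := by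
    refine lintegral_congr_ae ?_
    filter_upwards [hB.ae_forward] with s hs
    refine Finset.sum_congr rfl fun n _ => forwardMean_eq hf ?_
    exact hs _
  set F : ℕ → Env d × Path d → ℝ≥0∞ := fun n s => f (shift (s.2 n) s.1) with hF
  have mF : ∀ n, Measurable (F n) := fun n => hf.comp (measurable_shift_apply n)
  set S : Env d × Path d → ℝ≥0∞ := fun s =>
    ∑ n ∈ Finset.Ico (reg u k s.2) (reg u (k + 1) s.2), F (n + 1) s with hS
  have hStsum : ∀ s, S s = ∑' n, (inBlock u k n).indicator (fun _ => 1) s.2 * F (n + 1) s := by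
    intro s
    rw [tsum_eq_sum (s := Finset.Ico (reg u k s.2) (reg u (k + 1) s.2))]
    · refine Finset.sum_congr rfl fun n hn => ?_
      have : s.2 ∈ inBlock u k n := Finset.mem_Ico.1 hn
      simp [this]
    · intro n hn
      have : s.2 ∉ inBlock u k n := fun h => hn (Finset.mem_Ico.2 h)
      simp [this]
  have h3 : ∫⁻ s, blockSum u k (fun s => ∫⁻ η, f η ∂envKernel s.1) s
      ∂annealedLaw (iidEnvLaw μ) 0 = ∫⁻ s, S s ∂annealedLaw (iidEnvLaw μ) 0 := by
    have mκ' : Measurable fun s : Env d × Path d => ∫⁻ η, f η ∂envKernel s.1 :=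
      mκ.comp measurable_fst
    rw [lintegral_blockSum _ _ _ mκ']
    simp only [hStsum]
    have mn : ∀ n, Measurable fun s : Env d × Path d =>
        (inBlock u k n).indicator (fun _ => (1 : ℝ≥0∞)) s.2 * F (n + 1) s := fun n =>
      ((measurable_indicator_inBlock u k n).comp measurable_snd).mul (mF (n + 1))
    rw [lintegral_tsum fun n => (mn n).aemeasurable]
    refine tsum_congr fun n => ?_
    exact (lintegral_mul_env_annealed (iidEnvLaw μ) hB.quenchedLaw_ae_regular n
      (measurable_indicator_inBlock u k n) indicator_inBlock_congr hf).symm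
  rw [h2, h3]
  set T : ℕ → Env d × Path d → ℝ≥0∞ := fun j s => f (regShift u j s).1 with hT
  have mT : ∀ j, Measurable (T j) := fun j =>
    hf.comp (measurable_fst.comp (measurable_regShift u j))
  have mSum : Measurable (blockSum u k fun s : Env d × Path d => f s.1) :=
    measurable_blockSum u k (hf.comp measurable_fst)
  have htel : ∀ᵐ s ∂annealedLaw (iidEnvLaw μ) 0,
      S s + T k s = blockSum u k (fun s => f s.1) s + T (k + 1) s := by
    filter_upwards [hB.annealedLaw_ae_regular] with s hs
    exact sum_Ico_succ_add (fun n => F n s) (hs.reg_lt_succ k).le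
  -- At regeneration `k` the walk is at level at least `k`, so the function reads only nonnegative
  -- levels and is insensitive to one extra regeneration.
  have hTeq : ∫⁻ s, T (k + 1) s ∂annealedLaw (iidEnvLaw μ) 0 =
      ∫⁻ s, T k s ∂annealedLaw (iidEnvLaw μ) 0 := by
    rw [← lintegral_comp_regShift hB 1 (mT k)]
    · simp only [hT, regShift_regShift, add_comm]
    · intro ω ω' X hX h
      refine hloc _ _ fun y hy => h _ ?_
      have := hX.le_level_reg k
      rw [level_add]
      linarith
  -- Boundedness of `f` is needed here, since the boundary term has to be cancelled in `ℝ≥0∞`.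
  have hTfin : ∫⁻ s, T k s ∂annealedLaw (iidEnvLaw μ) 0 ≠ ∞ := by
    refine ne_of_lt (lt_of_le_of_lt (lintegral_mono fun s => hle _) (b := ∫⁻ _, 1
      ∂annealedLaw (iidEnvLaw μ) 0) ?_)
    simp
  have := lintegral_congr_ae htel
  rw [lintegral_add_right _ (mT k), lintegral_add_right _ (mT (k + 1)), hTeq] at this
  exact (ENNReal.add_left_inj hTfin).1 this

lemma measurableSet_indicator_local {k : ℕ} {A : Set (Env d)}
    (hloc : EnvLocal u k fun ω => ω ∈ A) :
    EnvLocal u k (A.indicator fun _ => (1 : ℝ≥0∞)) := fun ω ω' h =>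
  indicator_congr_of_iff (iff_of_eq (hloc ω ω' h)) 1

lemma env_measure_ext {Q Q' : Measure (Env d)} [IsFiniteMeasure Q]
    (h : ∀ A ∈ measurableCylinders (fun _ : Site d => PMF (Site d)), Q A = Q' A) : Q = Q' :=
  ext_of_generate_finite _ generateFrom_measurableCylinders.symm
    isPiSystem_measurableCylinders h (h _ (univ_mem_measurableCylinders _))

lemma envLocal_of_cylinder {k L : ℕ} {A : Set (Env d)} (h : ∀ ω ω' : Env d,
    (∀ y, -(k : ℝ) ≤ level u y → level u y < L → ω y = ω' y) → (ω ∈ A ↔ ω' ∈ A)) :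
    EnvLocal u k fun ω => ω ∈ A :=
  fun ω ω' hω => propext (h ω ω' fun y hy _ => hω y hy)

lemma invariant_equilibrium (hB : Ballistic μ u K ε M) :
    envKernel.Invariant (equilibrium μ u) := by
  have := isProbabilityMeasure_equilibrium hB
  refine (env_measure_ext (Q := equilibrium μ u) fun A hA => ?_).symm
  obtain ⟨mA, k, L, hloc⟩ := measurableCylinders_local u hA
  have h := lintegral_envKernel_equilibrium hB (f := A.indicator fun _ => 1)
    (measurable_const.indicator mA) (measurableSet_indicator_local (envLocal_of_cylinder hloc))
    (fun ω => Set.indicator_le_self' (fun _ _ => zero_le) ω)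
  have e : ∀ ν : Measure (Env d), ∫⁻ ω, A.indicator (fun _ => 1) ω ∂ν = ν A := fun ν =>
    lintegral_indicator_one mA
  simp only [e] at h
  rw [Measure.bind_apply mA envKernel.aemeasurable, h]

/-! ### Stationary environments -/

instance (Q : Measure (Env d)) [IsProbabilityMeasure Q] :
    IsProbabilityMeasure (annealedLaw Q 0) := by
  unfold annealedLaw; infer_instance

lemma map_shift_of_invariant {Q : Measure (Env d)} [IsProbabilityMeasure Q]
    (hQ : envKernel.Invariant Q) (n : ℕ) :
    (annealedLaw Q 0).map (fun s => shift (s.2 n) s.1) = Q := by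
  induction n with
  | zero =>
    refine Measure.ext_of_lintegral _ fun f hf => ?_
    have hf0 : Measurable fun s : Env d × Path d => f (shift (s.2 0) s.1) :=
      hf.comp (measurable_shift_apply 0)
    rw [lintegral_map hf (measurable_shift_apply 0), lintegral_annealedLaw Q hf0]
    refine lintegral_congr fun ω => ?_
    have : ∫⁻ X, f (shift (X 0) ω) ∂quenchedLaw ω 0 = ∫⁻ _, f ω ∂quenchedLaw ω 0 := by
      refine lintegral_congr_ae ?_
      filter_upwards [quenchedLaw_ae_zero ω 0] with X hX
      rw [hX, shift_zero]
    simpa using this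
  | succ n ih =>
    refine Measure.ext_of_lintegral _ fun f hf => ?_
    have h := lintegral_mul_env_annealed Q (R := fun _ => True)
      (ae_of_all _ fun _ => ae_of_all _ fun _ => trivial) n (F := fun _ => 1) measurable_const
      (fun _ _ _ _ _ => rfl) hf
    simp only [one_mul] at h
    have mκ : Measurable fun ω : Env d => ∫⁻ η, f η ∂envKernel ω :=
      hf.lintegral_kernel (κ := envKernel)
    rw [lintegral_map hf (measurable_shift_apply (n + 1)), h,
      ← lintegral_map mκ (measurable_shift_apply n), ih, ← Measure.lintegral_bind
      envKernel.aemeasurable hf.aemeasurable, hQ.def]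

end

/-! ### Uniqueness of the equilibrium measure and ergodicity -/

lemma map_seenFrom_of_invariant {Q : Measure (Env d)} [IsProbabilityMeasure Q]
    (hQ : envKernel.Invariant Q) (n : ℕ) :
    (annealedLaw Q 0).map (seenFrom n) = annealedLaw Q 0 := by
  refine Measure.ext_of_lintegral _ fun G hG => ?_
  have h := lintegral_mul_seenFrom Q (R := fun _ => True)
    (ae_of_all _ fun _ => ae_of_all _ fun _ => trivial) n (F := fun _ => 1) measurable_const
    (fun _ _ _ _ _ => rfl) hG
  simp only [one_mul] at h
  have m2 : Measurable fun η : Env d => ∫⁻ Y, G (η, Y) ∂quenchedLaw η 0 :=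
    hG.lintegral_kernel_prod_right' (κ := quenchedKernel 0)
  rw [lintegral_map hG (measurable_seenFrom n), h, lintegral_annealedLaw Q hG,
    ← lintegral_map m2 (measurable_shift_apply n), map_shift_of_invariant hQ n]

lemma ae_annealedLaw_iff (Q : Measure (Env d)) [SFinite Q] {E : Set (Env d × Path d)}
    (hE : MeasurableSet E) :
    (∀ᵐ s ∂annealedLaw Q 0, s ∈ E) ↔ ∀ᵐ ω ∂Q, ∀ᵐ X ∂quenchedLaw ω 0, (ω, X) ∈ E :=
  Measure.ae_compProd_iff hE

/-- An invariant set is almost surely neither entered nor left in one step; stationarity of the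
environment and the walk carries this to every later step. -/
lemma ae_mem_iff_shift_mem {Q : Measure (Env d)} [IsProbabilityMeasure Q]
    (hQ : envKernel.Invariant Q) {B : Set (Env d)} (hB : MeasurableSet B)
    (h : ∀ᵐ ω ∂Q, envKernel ω B = B.indicator 1 ω) (n : ℕ) :
    ∀ᵐ s ∂annealedLaw Q 0, (s.1 ∈ B ↔ shift (s.2 n) s.1 ∈ B) := by
  have mE : ∀ n, MeasurableSet {s : Env d × Path d | shift (s.2 n) s.1 ∈ B} := fun n =>
    measurable_shift_apply n hB
  have step0 : ∀ᵐ s ∂annealedLaw Q 0, s.1 = shift (s.2 0) s.1 ∧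
      (s.1 ∈ B ↔ shift (s.2 1) s.1 ∈ B) := by
    have mE1 : MeasurableSet {s : Env d × Path d | s.1 ∈ B ↔ shift (s.2 1) s.1 ∈ B} :=
      (measurable_fst hB).iff (mE 1)
    refine Filter.Eventually.and ?_ ((ae_annealedLaw_iff Q mE1).2 ?_)
    · have : ∀ᵐ s ∂annealedLaw Q 0, s ∈ {s : Env d × Path d | s.2 0 = 0} := by
        refine (ae_annealedLaw_iff Q
          (((measurable_pi_apply 0).comp measurable_snd) (measurableSet_singleton 0))).2 ?_
        exact ae_of_all _ fun ω => quenchedLaw_ae_zero ω 0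
      filter_upwards [this] with s hs
      have hs : s.2 0 = 0 := hs
      rw [hs, shift_zero]
    · filter_upwards [h] with ω hω
      rw [envKernel_apply ω hB] at hω
      have mX : MeasurableSet {X : Path d | shift (X 1) ω ∈ B} :=
        measurable_prodMk_left (x := ω) (mE 1)
      by_cases hm : ω ∈ B
      · rw [Set.indicator_of_mem hm] at hω
        filter_upwards [(prob_compl_eq_zero_iff mX).2 hω |> compl_mem_ae_iff.2] with X hX
        exact iff_of_true hm (by simpa using hX)
      · rw [Set.indicator_of_notMem hm] at hω
        filter_upwards [compl_mem_ae_iff.2 hω] with X hX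
        exact iff_of_false hm hX
  have step : ∀ n, ∀ᵐ s ∂annealedLaw Q 0,
      (shift (s.2 n) s.1 ∈ B ↔ shift (s.2 (n + 1)) s.1 ∈ B) := by
    intro n
    have h1 := ae_of_ae_map (measurable_seenFrom n).aemeasurable
      ((map_seenFrom_of_invariant hQ n).symm ▸ step0)
    filter_upwards [h1] with s hs
    have := hs.2
    simpa [seenFrom, shift_shift, pathShift] using this
  induction n with
  | zero =>
    filter_upwards [step0] with s hs
    rw [← hs.1]
  | succ n ih =>
    filter_upwards [ih, step n] with s h1 h2
    rw [h1, h2]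

section
variable {μ : Measure (PMF (Site d))} [IsProbabilityMeasure μ] {u : Fin d → ℝ} {K ε M : ℝ}

/-- Almost sure properties of the walk that depend on the environment in a half-space transfer to
environments that are absolutely continuous on half-spaces. -/
lemma HalfSpaceAC.ae_annealedLaw (hB : Ballistic μ u K ε M) {Q : Measure (Env d)}
    [IsProbabilityMeasure Q] (hQ : HalfSpaceAC μ u Q) {k : ℕ} {E : Set (Env d × Path d)}
    (mE : MeasurableSet E)
    (hE : ∀ ω ω' X, (∀ n, 0 ≤ level u (X n)) → (∀ y, -(k : ℝ) ≤ level u y → ω y = ω' y) →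
      ((ω, X) ∈ E ↔ (ω', X) ∈ E))
    (h : ∀ᵐ s ∂annealedLaw (iidEnvLaw μ) 0, s ∈ E) : ∀ᵐ s ∂annealedLaw Q 0, s ∈ E := by
  -- Below level `-k` the environment is replaced by the walk that stays put. This makes the
  -- exceptional set `bad` genuinely local, so that absolute continuity on the half-space can be
  -- applied to it.
  set c : Env d → Env d := fun ω => patch {y | -(k : ℝ) ≤ level u y} ω fun _ => PMF.pure 0 with hc
  have mc : Measurable c := (measurable_patch _).comp (measurable_id.prodMk measurable_const)
  have hcω : ∀ ω y, -(k : ℝ) ≤ level u y → ω y = c ω y := fun ω y hy =>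
    (patch_of_mem ω _ hy).symm
  set bad : Set (Env d) := {ω | quenchedLaw (c ω) 0 (Prod.mk (c ω) ⁻¹' Eᶜ) ≠ 0} with hbad
  have mbad : MeasurableSet bad := by
    have m := (Kernel.measurable_kernel_prodMk_left (κ := quenchedKernel (0 : Site d)) mE.compl).comp
      mc
    exact (m (measurableSet_singleton 0)).compl
  -- For environments without backward jumps the replacement changes neither the quenched law nor
  -- the event.
  have key : ∀ ω : Env d, (∀ x, Forward u (ω x)) →
      ((∀ᵐ X ∂quenchedLaw ω 0, (ω, X) ∈ E) ↔ ω ∉ bad) := by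
    intro ω hω
    have e1 : quenchedLaw ω 0 = quenchedLaw (c ω) 0 :=
      quenchedLaw_congr u (fun x _ => hω x) fun x hx => hcω ω x (by
        have : (0 : ℝ) ≤ k := k.cast_nonneg
        linarith)
    have e2 : ∀ᵐ X ∂quenchedLaw ω 0, ∀ n, 0 ≤ level u (X n) := by
      filter_upwards [quenchedLaw_ae_monotone u hω 0, quenchedLaw_ae_zero ω 0] with X h1 h2 n
      have := h1 (Nat.zero_le n)
      simp only [h2, level_zero] at this
      exact this
    have e3 : (∀ᵐ X ∂quenchedLaw ω 0, (ω, X) ∈ E) ↔ ∀ᵐ X ∂quenchedLaw ω 0, (c ω, X) ∈ E := by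
      refine Filter.eventually_congr ?_
      filter_upwards [e2] with X hX using hE _ _ X hX (hcω ω)
    rw [e3, e1, hbad]
    simp only [Set.mem_ofPred_eq, not_not]
    exact Iff.rfl
  have hloc : EnvLocal u k fun ω => ω ∈ bad := by
    intro ω ω' hω
    have : c ω = c ω' := by
      funext y
      by_cases hy : -(k : ℝ) ≤ level u y
      · rw [← hcω ω y hy, ← hcω ω' y hy, hω y hy]
      · simp only [hc]
        rw [patch_of_notMem ω _ hy, patch_of_notMem ω' _ hy]
    simp only [hbad, Set.mem_ofPred_eq, this]
  have h0 : iidEnvLaw μ bad = 0 := by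
    rw [ae_annealedLaw_iff _ mE] at h
    have : ∀ᵐ ω ∂iidEnvLaw μ, ω ∉ bad := by
      filter_upwards [h, hB.good] with ω h1 h2 using (key ω fun x => (h2 x).forward).1 h1
    exact measure_eq_zero_iff_ae_notMem.2 this
  rw [ae_annealedLaw_iff _ mE]
  filter_upwards [measure_eq_zero_iff_ae_notMem.1 (hQ k bad mbad hloc h0), hQ.ae_forward hB]
    with ω h1 h2 using (key ω h2).2 h1

lemma integral_blockSum_indicator (hB : Ballistic μ u K ε M) {k : ℕ} {A : Set (Env d)}
    (mA : MeasurableSet A) (hloc : EnvLocal u k fun ω => ω ∈ A) :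
    (∫ s, blockSum u k (fun s => A.indicator (fun _ => (1 : ℝ)) s.1) s
      ∂annealedLaw (iidEnvLaw μ) 0) / (meanSigma μ u).toReal = (equilibrium μ u).real A := by
  have h0 : ∀ s : Env d × Path d, blockSum u k (fun s => A.indicator (fun _ => (1 : ℝ)) s.1) s =
      (blockSum u k (fun s => A.indicator (fun _ => (1 : ℝ≥0∞)) s.1) s).toReal := by
    intro s
    rw [blockSum, blockSum, ENNReal.toReal_sum (fun n _ => by
      by_cases h : (seenFrom n s).1 ∈ A <;> simp [h])]
    refine Finset.sum_congr rfl fun n _ => ?_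
    by_cases h : (seenFrom n s).1 ∈ A <;> simp [h]
  have mi : Measurable (A.indicator fun _ => (1 : ℝ≥0∞)) := measurable_const.indicator mA
  have hm : Measurable (blockSum u k fun s : Env d × Path d =>
      A.indicator (fun _ => (1 : ℝ≥0∞)) s.1) := measurable_blockSum u k (mi.comp measurable_fst)
  have h1 := lintegral_equilibrium_of_envLocal hB mi (measurableSet_indicator_local hloc)
  have e : ∫⁻ ω, A.indicator (fun _ => 1) ω ∂equilibrium μ u = equilibrium μ u A :=
    lintegral_indicator_one mA
  rw [e] at h1
  simp only [h0]
  rw [integral_toReal hm.aemeasurable, measureReal_def, h1, ENNReal.toReal_mul, ENNReal.toReal_inv,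
    div_eq_inv_mul]
  refine ae_lt_top hm (ne_of_lt (lt_of_le_of_lt (lintegral_mono fun s => ?_)
    ((lintegral_blockSum_one hB k).trans_lt (meanSigma_lt_top hB))))
  exact Finset.sum_le_sum fun n _ => Set.indicator_le_self' (fun _ _ => zero_le) _

lemma measurable_average {A : Set (Env d)} (mA : MeasurableSet A) (N : ℕ) :
    Measurable fun s : Env d × Path d =>
      (∑ i ∈ Finset.range N, A.indicator (fun _ => (1 : ℝ)) (shift (s.2 i) s.1)) / N :=
  (Finset.measurable_sum _ fun i _ =>
    (measurable_const.indicator mA).comp (measurable_shift_apply i)).div_const _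

/-- The ergodic theorem for cylinders of the environment. -/
lemma HalfSpaceAC.ae_tendsto_average (hB : Ballistic μ u K ε M) {Q : Measure (Env d)}
    [IsProbabilityMeasure Q] (hQ : HalfSpaceAC μ u Q) {A : Set (Env d)}
    (hA : A ∈ measurableCylinders (fun _ : Site d => PMF (Site d))) :
    ∀ᵐ s ∂annealedLaw Q 0, Tendsto (fun N : ℕ =>
      (∑ i ∈ Finset.range N, A.indicator (fun _ => (1 : ℝ)) (shift (s.2 i) s.1)) / N) atTop
      (𝓝 ((equilibrium μ u).real A)) := by
  obtain ⟨mA, k, L, hloc⟩ := measurableCylinders_local u hA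
  have hlocal := envLocal_of_cylinder hloc
  refine hQ.ae_annealedLaw hB (k := k) (measurableSet_tendsto _ (measurable_average mA)) ?_ ?_
  · intro ω ω' X hX h
    have : ∀ i, A.indicator (fun _ => (1 : ℝ)) (shift (X i) ω) =
        A.indicator (fun _ => (1 : ℝ)) (shift (X i) ω') := by
      intro i
      refine indicator_congr_of_iff (iff_of_eq (hlocal _ _ fun y hy => h _ ?_)) 1
      rw [level_add]
      linarith [hX i]
    change Tendsto _ _ _ ↔ Tendsto _ _ _
    simp only [this]
  · have h1 := RWRE.ae_tendsto_average hB (k := k) (L := L)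
      (f := fun s => A.indicator (fun _ => (1 : ℝ)) s.1) (b := fun _ => 1)
      ((measurable_const.indicator mA).comp measurable_fst)
      ⟨fun ω ω' X h => indicator_congr_of_iff (iff_of_eq (hlocal _ _ h)) 1,
        fun ω ω' X X' _ _ h => indicator_congr_of_iff (hloc _ _ fun y _ hy => h y hy) 1⟩
      measurable_const ⟨fun _ _ _ _ => rfl, fun _ _ _ _ _ _ _ => rfl⟩
      (fun s => by by_cases h : s.1 ∈ A <;> simp [h]) (integral_blockSum_one hB k).1
    rw [integral_blockSum_indicator hB mA hlocal] at h1
    exact h1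

/-- The mean of the indicator of `B` times the average of `A` is computed twice: for every positive
number of steps it equals `Q (B ∩ A)`, by stationarity and invariance of `B`, and by dominated
convergence it tends to the product. -/
lemma HalfSpaceAC.measureReal_inter (hB : Ballistic μ u K ε M) {Q : Measure (Env d)}
    [IsProbabilityMeasure Q] (hQ : HalfSpaceAC μ u Q) (hinv : envKernel.Invariant Q)
    {B : Set (Env d)} (mB : MeasurableSet B)
    (hBinv : ∀ n, ∀ᵐ s ∂annealedLaw Q 0, (s.1 ∈ B ↔ shift (s.2 n) s.1 ∈ B))
    {A : Set (Env d)} (hA : A ∈ measurableCylinders (fun _ : Site d => PMF (Site d))) :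
    Q.real (B ∩ A) = Q.real B * (equilibrium μ u).real A := by
  have mA := (measurableCylinders_local u hA).1
  set I : Set (Env d) → Env d → ℝ := fun S => S.indicator fun _ => 1 with hI
  have mI : ∀ {S}, MeasurableSet S → Measurable (I S) := fun hS => measurable_const.indicator hS
  have I_le : ∀ S ω, ‖I S ω‖ ≤ 1 := fun S ω => by
    by_cases h : ω ∈ S <;> simp [hI, h]
  have hfst : ∀ {S : Set (Env d)}, MeasurableSet S → ∀ n,
      ∫ s, I S (shift (s.2 n) s.1) ∂annealedLaw Q 0 = Q.real S := by
    intro S hS n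
    rw [← integral_map (measurable_shift_apply n).aemeasurable (mI hS).aestronglyMeasurable,
      map_shift_of_invariant hinv n]
    exact integral_indicator_one hS
  set F : ℕ → Env d × Path d → ℝ := fun N s =>
    I B s.1 * ((∑ i ∈ Finset.range N, I A (shift (s.2 i) s.1)) / N) with hF
  have mIB : Measurable fun s : Env d × Path d => I B s.1 := (mI mB).comp measurable_fst
  have hlim : Tendsto (fun N => ∫ s, F N s ∂annealedLaw Q 0) atTop
      (𝓝 (∫ s, I B s.1 * (equilibrium μ u).real A ∂annealedLaw Q 0)) := by
    refine tendsto_integral_of_dominated_convergence (fun _ => 1)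
      (fun N => (mIB.mul (measurable_average mA N)).aestronglyMeasurable)
      (integrable_const 1) (fun N => ae_of_all _ fun s => ?_) ?_
    · rw [norm_mul, norm_div]
      refine mul_le_one₀ (I_le B _) (by positivity) ?_
      refine div_le_one_of_le₀ ?_ (norm_nonneg _)
      refine (norm_sum_le _ _).trans ((Finset.sum_le_sum fun i _ => I_le A _).trans ?_)
      simp
    · filter_upwards [hQ.ae_tendsto_average hB hA] with s hs using hs.const_mul _
  have hval : ∫ s, I B s.1 * (equilibrium μ u).real A ∂annealedLaw Q 0 =
      Q.real B * (equilibrium μ u).real A := by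
    rw [integral_mul_const]
    congr 1
    rw [← hfst mB 0]
    refine integral_congr_ae ?_
    filter_upwards [hBinv 0] with s hs
    by_cases h : s.1 ∈ B
    · simp [hI, h, hs.1 h]
    · simp [hI, h, mt hs.2 h]
  have hterm : ∀ i, ∫ s, I B s.1 * I A (shift (s.2 i) s.1) ∂annealedLaw Q 0 = Q.real (B ∩ A) := by
    intro i
    rw [← hfst (mB.inter mA) i]
    refine integral_congr_ae ?_
    filter_upwards [hBinv i] with s hs
    by_cases h : s.1 ∈ B
    · by_cases h' : shift (s.2 i) s.1 ∈ A <;> simp [hI, h, hs.1 h, h']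
    · simp [hI, h, mt hs.2 h]
  have hconst : ∀ N : ℕ, 1 ≤ N → ∫ s, F N s ∂annealedLaw Q 0 = Q.real (B ∩ A) := by
    intro N hN
    have e : ∀ s, F N s = (∑ i ∈ Finset.range N, I B s.1 * I A (shift (s.2 i) s.1)) / N := by
      intro s
      rw [← Finset.mul_sum, mul_div_assoc]
    simp only [e]
    rw [integral_div, integral_finsetSum]
    · simp only [hterm, Finset.sum_const, Finset.card_range, nsmul_eq_mul]
      have : (N : ℝ) ≠ 0 := by positivity
      field_simp
    · intro i _
      refine Integrable.of_bound (C := 1)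
        (mIB.mul ((mI mA).comp (measurable_shift_apply i))).aestronglyMeasurable
        (ae_of_all _ fun s => ?_)
      rw [norm_mul]
      exact mul_le_one₀ (I_le B _) (norm_nonneg _) (I_le A _)
  rw [hval] at hlim
  refine tendsto_nhds_unique (tendsto_const_nhds.congr' ?_) hlim
  filter_upwards [eventually_ge_atTop 1] with N hN using (hconst N hN).symm

/-- The case `B = univ` on cylinders. Ergodicity of `Q` plays no role. -/
lemma HalfSpaceAC.eq_equilibrium (hB : Ballistic μ u K ε M) {Q : Measure (Env d)}
    [IsProbabilityMeasure Q] (hQ : HalfSpaceAC μ u Q) (hinv : envKernel.Invariant Q) :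
    Q = equilibrium μ u := by
  have := isProbabilityMeasure_equilibrium hB
  refine env_measure_ext fun A hA => ?_
  have h := hQ.measureReal_inter hB hinv MeasurableSet.univ (fun n => by simp) hA
  rw [Set.univ_inter, probReal_univ, one_mul] at h
  exact (measureReal_eq_measureReal_iff).1 h

/-- The product formula extends from cylinders to all measurable sets; evaluated at `B` itself it
says that the mass of `B` equals its own square. -/
lemma isErgodicChain_equilibrium (hB : Ballistic μ u K ε M) :
    IsErgodicChain envKernel (equilibrium μ u) := by
  intro B mB hinvB
  have := isProbabilityMeasure_equilibrium hB
  have hinv := invariant_equilibrium hB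
  have h : (equilibrium μ u).restrict B = (equilibrium μ u B) • equilibrium μ u := by
    refine env_measure_ext fun A hA => ?_
    have h := (halfSpaceAC_equilibrium hB).measureReal_inter hB hinv mB
      (ae_mem_iff_shift_mem hinv mB hinvB) hA
    rw [Measure.restrict_apply (measurableCylinders_local u hA).1, Set.inter_comm,
      Measure.smul_apply, smul_eq_mul,
      ← ENNReal.toReal_eq_toReal_iff' (measure_ne_top _ _)
        (ENNReal.mul_ne_top (measure_ne_top _ _) (measure_ne_top _ _)), ENNReal.toReal_mul]
    exact h
  have h2 := congrArg (fun ν => ν B) h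
  simp only [Measure.restrict_apply_self, Measure.smul_apply, smul_eq_mul] at h2
  by_cases h0 : equilibrium μ u B = 0
  · exact Or.inl h0
  · refine Or.inr ?_
    have h3 : equilibrium μ u B * 1 = equilibrium μ u B * equilibrium μ u B := by
      rw [mul_one]; exact h2
    exact ((ENNReal.mul_right_inj h0 (measure_ne_top _ _)).1 h3).symm

lemma isEquilibrium_equilibrium (hB : Ballistic μ u K ε M) :
    IsEquilibrium (iidEnvLaw μ) u (equilibrium μ u) where
  isProbabilityMeasure := isProbabilityMeasure_equilibrium hB
  invariant := invariant_equilibrium hB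
  absolutelyContinuous k hk A hA h0 := by
    obtain ⟨mA, hloc⟩ := measurableSet_of_halfSpace hA
    refine equilibrium_null hB (k := (-k).toNat) mA (fun ω ω' h => propext (hloc ω ω' fun y hy =>
      h y ?_)) h0
    have : (((-k).toNat : ℤ) : ℝ) = ((-k : ℤ) : ℝ) := by rw [Int.toNat_of_nonneg (by omega)]
    push_cast at this
    rw [this]
    linarith
  ergodic := isErgodicChain_equilibrium hB

lemma IsEquilibrium.halfSpaceAC {Q : Measure (Env d)}
    (hQ : IsEquilibrium (iidEnvLaw μ) u Q) : HalfSpaceAC μ u Q := fun k A mA hloc h0 =>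
  hQ.absolutelyContinuous (-k) (by simp) A (measurableSet_halfSpace mA hloc) h0

lemma IsEquilibrium.eq_equilibrium (hB : Ballistic μ u K ε M) {Q : Measure (Env d)}
    (hQ : IsEquilibrium (iidEnvLaw μ) u Q) : Q = equilibrium μ u :=
  have := hQ.isProbabilityMeasure
  hQ.halfSpaceAC.eq_equilibrium hB hQ.invariant

end

/-! ### Wald's identity with bounded error -/

/-- A function of the first step of the walk. -/
def jump {β : Type*} (g : Site d → β) (s : Env d × Path d) : β := g (s.2 1 - s.2 0)

lemma jump_seenFrom {β : Type*} (g : Site d → β) (n : ℕ) (s : Env d × Path d) :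
    jump g (seenFrom n s) = g (s.2 (n + 1) - s.2 n) := by simp [jump, seenFrom, pathShift]

lemma measurable_jump {β : Type*} [MeasurableSpace β] (g : Site d → β) :
    Measurable (jump g : Env d × Path d → β) :=
  (measurable_path_comp_sub g 1 0).comp measurable_snd

lemma stepLocal_jump {β : Type*} (u : Fin d → ℝ) (g : Site d → β) : StepLocal u 0 0 (jump g) :=
  ⟨fun _ _ _ _ => rfl, fun _ _ _ _ h0 h1 _ => by simp only [jump, h0, h1]⟩

section
variable {μ : Measure (PMF (Site d))} [IsProbabilityMeasure μ] {u : Fin d → ℝ} {K ε M : ℝ}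

lemma Regular.sum_blockSum {X : Path d} (hX : Regular u X) (ω : Env d) (n : ℕ)
    (f : Env d × Path d → ℝ≥0∞) :
    ∑ j ∈ Finset.range n, blockSum u j f (ω, X) =
      ∑ i ∈ Finset.range (reg u n X), f (seenFrom i (ω, X)) := by
  induction n with
  | zero => simp
  | succ n ih =>
    rw [Finset.sum_range_succ, ih]
    exact Finset.sum_range_add_sum_Ico _ (hX.reg_lt_succ n).le

/-- The blocks that begin before time `n` cover the time interval `[0, n)`, and the last of them
ends as soon as the walk has gained one level after time `n`. -/
lemma Regular.sum_le_tsum_blockSum {X : Path d} (hX : Regular u X) (ω : Env d) (n : ℕ)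
    (f : Env d × Path d → ℝ≥0∞) :
    ∑ i ∈ Finset.range n, f (seenFrom i (ω, X)) ≤
        ∑' j, {X | reg u j X < n}.indicator (fun _ => 1) X * blockSum u j f (ω, X) ∧
      ∑' j, {X | reg u j X < n}.indicator (fun _ => 1) X * blockSum u j f (ω, X) ≤
        ∑ i ∈ Finset.range n, f (seenFrom i (ω, X)) +
          ∑' m, {X | NotHit u m X}.indicator (fun _ => 1) (RWRE.pathShift n X) *
            f (seenFrom (n + m) (ω, X)) := by
  classical
  have hex : ∃ j, n ≤ reg u j X := ⟨n, hX.le_reg n⟩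
  -- `J` is the number of blocks that begin before time `n`; together they occupy the times before
  -- `reg u J X ≥ n`.
  set J := Nat.find hex with hJ
  have hJn : n ≤ reg u J X := Nat.find_spec hex
  have hlt : ∀ j, reg u j X < n ↔ j < J := fun j =>
    ⟨fun h => by
      by_contra hj
      have : reg u J X ≤ reg u j X := hX.strictMono_reg.monotone (not_lt.1 hj)
      omega, fun h => not_le.1 (Nat.find_min hex h)⟩
  have e : ∑' j, {X | reg u j X < n}.indicator (fun _ => 1) X * blockSum u j f (ω, X) =
      ∑ i ∈ Finset.range (reg u J X), f (seenFrom i (ω, X)) := by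
    rw [← hX.sum_blockSum, tsum_eq_sum (s := Finset.range J)]
    · refine Finset.sum_congr rfl fun j hj => ?_
      rw [Set.indicator_of_mem (show X ∈ {X | reg u j X < n} from
        (hlt j).2 (Finset.mem_range.1 hj)), one_mul]
    · intro j hj
      rw [Set.indicator_of_notMem (show X ∉ {X | reg u j X < n} from
        fun h => hj (Finset.mem_range.2 ((hlt j).1 h))), zero_mul]
  rw [e]
  obtain ⟨r, hr⟩ := Nat.exists_eq_add_of_le hJn
  rw [hr, Finset.sum_range_add]
  refine ⟨le_self_add, add_le_add_right ?_ _⟩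
  refine le_trans (Finset.sum_le_sum fun m hm => ?_) (ENNReal.sum_le_tsum (Finset.range r))
  have hmr := Finset.mem_range.1 hm
  rw [Set.indicator_of_mem, one_mul]
  intro i hi
  obtain ⟨j, hj⟩ : ∃ j, J = j + 1 := Nat.exists_eq_succ_of_ne_zero (by
    intro h0
    rw [h0, reg_zero] at hr
    omega)
  -- The block covering the times past `n` began before `n`. Within it the walk stays less than one
  -- level above its start, hence also less than one level above its position at time `n`.
  have h1 : reg u j X < n := (hlt j).2 (by omega)
  have h2 := hX.level_lt_of_lt_reg_succ (k := j) (j := n + i) (by rw [← hj, hr]; omega)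
  have h3 := hX.mono h1.le
  simp only at h3
  simp only [RWRE.pathShift, level_sub, add_zero]
  linarith

/-- The mean number of blocks that begin before time `n`. -/
def meanBlocks (μ : Measure (PMF (Site d))) [IsProbabilityMeasure μ] (u : Fin d → ℝ) (n : ℕ) :
    ℝ≥0∞ :=
  ∑' j, ∫⁻ s, {X : Path d | reg u j X < n}.indicator (fun _ => 1) s.2 ∂annealedLaw (iidEnvLaw μ) 0

/-- Wald's identity: whether the `j`-th block begins before `n` is decided by the path up to its
start, hence is independent of the sum over that block. -/
lemma lintegral_tsum_blockSum (hB : Ballistic μ u K ε M) (n : ℕ) {f : Env d × Path d → ℝ≥0∞}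
    (hf : Measurable f) (hloc : PlusLocal u (blockSum u 0 f)) :
    ∫⁻ s, ∑' j, {X : Path d | reg u j X < n}.indicator (fun _ => 1) s.2 * blockSum u j f s
        ∂annealedLaw (iidEnvLaw μ) 0 =
      meanBlocks μ u n * ∫⁻ s, blockSum u 0 f s ∂annealedLaw (iidEnvLaw μ) 0 := by
  have mi : ∀ j, Measurable fun s : Env d × Path d =>
      {X : Path d | reg u j X < n}.indicator (fun _ => (1 : ℝ≥0∞)) s.2 := fun j =>
    (measurable_const.indicator (measurableSet_lt (measurable_reg u j) measurable_const)).comp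
      measurable_snd
  have mp : ∀ j, Measurable fun s : Env d × Path d =>
      {X : Path d | reg u j X < n}.indicator (fun _ => (1 : ℝ≥0∞)) s.2 * blockSum u j f s :=
    fun j => (mi j).mul (measurable_blockSum u j hf)
  rw [lintegral_tsum fun j => (mp j).aemeasurable, meanBlocks,
    ← ENNReal.tsum_mul_right]
  refine tsum_congr fun j => ?_
  rw [← lintegral_mul_regShift hB j (mi j) _ (measurable_blockSum u 0 hf) hloc]
  · simp only [blockSum_regShift, add_zero]
  · intro ω ω' X X' hX hX' h _
    refine indicator_congr_of_iff ?_ 1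
    simp only [Set.mem_ofPred_eq, hX.reg_congr h]

lemma lintegral_jump_le {g : Site d → ℝ≥0∞} {c : ℝ≥0∞}
    (hg : ∀ᵐ ω ∂iidEnvLaw μ, ∀ x, jumpMean g (shift x ω) ≤ c) (n : ℕ) {F : Path d → ℝ≥0∞}
    (hF : Measurable F) (hdep : ∀ X X', (∀ i ≤ n, X i = X' i) → F X = F X') :
    ∫⁻ s, F s.2 * g (s.2 (n + 1) - s.2 n) ∂annealedLaw (iidEnvLaw μ) 0 ≤
      c * ∫⁻ s, F s.2 ∂annealedLaw (iidEnvLaw μ) 0 := by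
  have m1 : Measurable fun s : Env d × Path d => F s.2 * jumpMean g (shift (s.2 n) s.1) :=
    (hF.comp measurable_snd).mul ((measurable_jumpMean g).comp (measurable_shift_apply n))
  have m2 : Measurable fun s : Env d × Path d => F s.2 := hF.comp measurable_snd
  rw [lintegral_mul_jump_annealed (iidEnvLaw μ) (R := fun _ => True)
    (ae_of_all _ fun _ => ae_of_all _ fun _ => trivial) n hF (fun X X' _ _ => hdep X X') g,
    ← lintegral_const_mul _ m2, lintegral_annealedLaw _ m1,
    lintegral_annealedLaw _ (m2.const_mul c)]
  refine lintegral_mono_ae ?_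
  filter_upwards [hg] with ω hω
  refine lintegral_mono fun X => ?_
  rw [mul_comm]
  exact mul_le_mul_left (hω _) _

/-- Past time `n`, each step before the next level is gained costs at most `c` in conditional mean,
and the mean number of such steps is bounded uniformly in `n`. -/
lemma lintegral_overshoot_le (hB : Ballistic μ u K ε M) {g : Site d → ℝ≥0∞} {c : ℝ≥0∞}
    (hg : ∀ᵐ ω ∂iidEnvLaw μ, ∀ x, jumpMean g (shift x ω) ≤ c) (n : ℕ) :
    ∫⁻ s, ∑' m, {X : Path d | NotHit u m X}.indicator (fun _ => 1) (pathShift n s.2) *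
        jump g (seenFrom (n + m) s) ∂annealedLaw (iidEnvLaw μ) 0 ≤
      c * ENNReal.ofReal ((1 + K) / ε) := by
  have mN : ∀ m, Measurable fun X : Path d =>
      {X : Path d | NotHit u m X}.indicator (fun _ => (1 : ℝ≥0∞)) (pathShift n X) := fun m =>
    (measurable_const.indicator (measurableSet_notHit u m)).comp (measurable_pathShift n)
  have mN' : ∀ m, Measurable fun s : Env d × Path d =>
      {X : Path d | NotHit u m X}.indicator (fun _ => (1 : ℝ≥0∞)) (pathShift n s.2) := fun m =>
    (mN m).comp measurable_snd
  have mp : ∀ m, Measurable fun s : Env d × Path d =>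
      {X : Path d | NotHit u m X}.indicator (fun _ => (1 : ℝ≥0∞)) (pathShift n s.2) *
        jump g (seenFrom (n + m) s) := fun m =>
    (mN' m).mul ((measurable_jump g).comp (measurable_seenFrom (n + m)))
  rw [lintegral_tsum fun m => (mp m).aemeasurable]
  calc _ ≤ ∑' m, c * ∫⁻ s, {X : Path d | NotHit u m X}.indicator (fun _ => 1) (pathShift n s.2)
          ∂annealedLaw (iidEnvLaw μ) 0 := by
        refine ENNReal.tsum_le_tsum fun m => ?_
        simp only [jump_seenFrom]
        refine lintegral_jump_le hg (n + m) (mN m) fun X X' h => ?_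
        refine indicator_congr_of_iff (NotHit.congr fun i hi => ?_) 1
        simp only [pathShift, h (n + i) (by omega), h n (by omega)]
    _ = c * ∫⁻ s, (sigma1 u (pathShift n s.2) : ℝ≥0∞) ∂annealedLaw (iidEnvLaw μ) 0 := by
        rw [ENNReal.tsum_mul_left, ← lintegral_tsum fun m => (mN' m).aemeasurable]
        simp only [sigma1_eq_tsum]
        rfl
    _ ≤ _ := mul_le_mul_right (lintegral_sigma1_pathShift_le hB n) _

lemma lintegral_sum_jump_bounds (hB : Ballistic μ u K ε M) {g : Site d → ℝ≥0∞} {c : ℝ≥0∞}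
    (hg : ∀ᵐ ω ∂iidEnvLaw μ, ∀ x, jumpMean g (shift x ω) ≤ c) (n : ℕ) :
    ∑ i ∈ Finset.range n, ∫⁻ s, jump g (seenFrom i s) ∂annealedLaw (iidEnvLaw μ) 0 ≤
        meanBlocks μ u n * ∫⁻ s, blockSum u 0 (jump g) s ∂annealedLaw (iidEnvLaw μ) 0 ∧
      meanBlocks μ u n * ∫⁻ s, blockSum u 0 (jump g) s ∂annealedLaw (iidEnvLaw μ) 0 ≤
        ∑ i ∈ Finset.range n, ∫⁻ s, jump g (seenFrom i s) ∂annealedLaw (iidEnvLaw μ) 0 +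
          c * ENNReal.ofReal ((1 + K) / ε) := by
  have mj : ∀ i, Measurable fun s : Env d × Path d => jump g (seenFrom i s) := fun i =>
    (measurable_jump g).comp (measurable_seenFrom i)
  rw [← lintegral_tsum_blockSum hB n (measurable_jump g)
    (plusLocal_blockSum (stepLocal_jump u g).lower), ← lintegral_finsetSum _ fun i _ => mj i]
  constructor
  · refine lintegral_mono_ae ?_
    filter_upwards [hB.annealedLaw_ae_regular] with s hs
    exact (hs.sum_le_tsum_blockSum s.1 n _).1
  · refine le_trans ?_ (add_le_add_right (lintegral_overshoot_le hB hg n) _)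
    rw [← lintegral_add_left (Finset.measurable_sum _ fun i _ => mj i)]
    refine lintegral_mono_ae ?_
    filter_upwards [hB.annealedLaw_ae_regular] with s hs
    exact (hs.sum_le_tsum_blockSum s.1 n _).2

/-- The preceding bounds for the function `1`, whose block sum is the block length. -/
lemma meanBlocks_bounds (hB : Ballistic μ u K ε M) (n : ℕ) :
    (n : ℝ≥0∞) ≤ meanBlocks μ u n * meanSigma μ u ∧
      meanBlocks μ u n * meanSigma μ u ≤ n + ENNReal.ofReal ((1 + K) / ε) := by
  have h := lintegral_sum_jump_bounds hB (g := fun _ => 1) (c := 1)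
    (ae_of_all _ fun ω x => by simp [jumpMean, (ω x).tsum_coe, shift]) n
  have e : (fun s : Env d × Path d => blockSum u 0 (jump fun _ => (1 : ℝ≥0∞)) s) =
      blockSum u 0 fun _ => 1 := rfl
  rw [e, lintegral_blockSum_one hB] at h
  simpa [jump] using h

end

/-! ### The drift and the velocity -/

/-- The positive part of a function, with values in `ℝ≥0∞`. -/
def posPart {α : Type*} (r : α → ℝ) (a : α) : ℝ≥0∞ := ENNReal.ofReal (r a)

lemma toReal_posPart_sub {α : Type*} (r : α → ℝ) (a : α) :
    (posPart r a).toReal - (posPart (-r) a).toReal = r a := by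
  simp only [posPart, Pi.neg_apply, ENNReal.toReal_ofReal']
  exact max_zero_sub_max_neg_zero_eq_self (r a)

lemma posPart_ne_top {α : Type*} (r : α → ℝ) (a : α) : posPart r a ≠ ∞ := ENNReal.ofReal_ne_top

/-- The length of a jump. -/
def len (z : Site d) : ℝ := l1 (toReal z)

lemma jumpMean_mono {g g' : Site d → ℝ≥0∞} (h : ∀ z, g z ≤ g' z) (ω : Env d) :
    jumpMean g ω ≤ jumpMean g' ω :=
  ENNReal.tsum_le_tsum fun z => mul_le_mul_left (h z) _

lemma posPart_le_len {r : Site d → ℝ} (hr : ∀ z, |r z| ≤ len z) (z : Site d) :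
    posPart r z ≤ posPart len z := ENNReal.ofReal_le_ofReal ((le_abs_self _).trans (hr z))

lemma summable_drift {ω : Env d} (hω : jumpMean (posPart len) ω ≠ ∞) :
    Summable fun z : Site d => (ω 0 z).toReal • toReal z := by
  have h := ENNReal.summable_toReal hω
  refine Pi.summable.2 fun i => Summable.of_norm_bounded h fun z => ?_
  rw [Pi.smul_apply, smul_eq_mul, norm_mul, Real.norm_of_nonneg ENNReal.toReal_nonneg,
    ENNReal.toReal_mul, mul_comm, posPart, ENNReal.toReal_ofReal (show 0 ≤ len z from l1_nonneg _)]
  exact mul_le_mul_of_nonneg_right (abs_le_l1 _ i) ENNReal.toReal_nonneg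

/-- A coordinate of a site, as a real number. -/
def coord (i : Fin d) (z : Site d) : ℝ := z i

lemma abs_coord_le (i : Fin d) (z : Site d) : |coord i z| ≤ len z := abs_le_l1 (toReal z) i

lemma drift_apply {ω : Env d} (hω : jumpMean (posPart len) ω ≠ ∞) (i : Fin d) :
    drift ω i =
      (jumpMean (posPart (coord i)) ω).toReal - (jumpMean (posPart (-coord i)) ω).toReal := by
  have hs : ∀ {r : Site d → ℝ}, (∀ z, |r z| ≤ len z) → jumpMean (posPart r) ω ≠ ∞ := fun hr =>
    ne_top_of_le_ne_top hω (jumpMean_mono (posPart_le_len hr) ω)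
  have h1 := hs (abs_coord_le i)
  have h2 := hs (r := -coord i) fun z => by simpa using abs_coord_le i z
  have h3 : ∀ (g : Site d → ℝ≥0∞), jumpMean g ω ≠ ∞ →
      (jumpMean g ω).toReal = ∑' z, (g z * ω 0 z).toReal := fun g hg =>
    ENNReal.tsum_toReal_eq fun z => ENNReal.ne_top_of_tsum_ne_top hg z
  rw [drift, tsum_apply (summable_drift hω), h3 _ h1, h3 _ h2,
    ← (ENNReal.summable_toReal h1).tsum_sub (ENNReal.summable_toReal h2)]
  refine tsum_congr fun z => ?_
  rw [ENNReal.toReal_mul, ENNReal.toReal_mul, ← sub_mul, toReal_posPart_sub, Pi.smul_apply,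
    smul_eq_mul, mul_comm]
  rfl

section
variable {μ : Measure (PMF (Site d))} [IsProbabilityMeasure μ] {u : Fin d → ℝ} {K ε M : ℝ}

lemma Ballistic.ae_jumpMean_shift_le (hB : Ballistic μ u K ε M) :
    ∀ᵐ ω ∂iidEnvLaw μ, ∀ x, jumpMean (posPart len) (shift x ω) ≤ ENNReal.ofReal M := by
  filter_upwards [hB.good] with ω hω x
  rw [jumpMean_shift]
  exact (hω x).moment

lemma ae_equilibrium_jumpMean_le (hB : Ballistic μ u K ε M) :
    ∀ᵐ ω ∂equilibrium μ u, jumpMean (posPart len) ω ≤ ENNReal.ofReal M := by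
  have m : Measurable fun q : PMF (Site d) => ∑' z, posPart len z * q z :=
    Measurable.tsum fun z => (measurable_pmf_apply z).const_mul _
  refine (halfSpaceAC_equilibrium hB).ae_site
    (r := fun q => ∑' z, posPart len z * q z ≤ ENNReal.ofReal M)
    (measurableSet_le m measurable_const) 0 ?_
  filter_upwards [hB.good] with ω hω using (hω 0).moment

/-- The mean of a function of the jump in equilibrium. -/
def meanJump (μ : Measure (PMF (Site d))) [IsProbabilityMeasure μ] (u : Fin d → ℝ)
    (g : Site d → ℝ≥0∞) : ℝ≥0∞ := ∫⁻ ω, jumpMean g ω ∂equilibrium μ u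

lemma meanJump_le (hB : Ballistic μ u K ε M) {g : Site d → ℝ≥0∞} (hg : ∀ z, g z ≤ posPart len z) :
    meanJump μ u g ≤ ENNReal.ofReal M := by
  have := isProbabilityMeasure_equilibrium hB
  calc meanJump μ u g ≤ ∫⁻ _, ENNReal.ofReal M ∂equilibrium μ u := by
        refine lintegral_mono_ae ?_
        filter_upwards [ae_equilibrium_jumpMean_le hB] with ω hω
        exact (jumpMean_mono hg ω).trans hω
    _ = _ := by simp

/-- The mean jump reads the environment only at the origin, so no gluing is involved (`k = 0`) and
the equilibrium formula concerns the first block itself. -/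
lemma lintegral_blockSum_jump_eq (hB : Ballistic μ u K ε M) (g : Site d → ℝ≥0∞) :
    ∫⁻ s, blockSum u 0 (jump g) s ∂annealedLaw (iidEnvLaw μ) 0 =
      meanSigma μ u * meanJump μ u g := by
  have h := lintegral_blockSum_jump hB 0 g
  have e := lintegral_equilibrium_of_envLocal hB (k := 0) (measurable_jumpMean g)
    fun ω ω' h => tsum_congr fun z => by rw [h 0 (by simp)]
  rw [meanJump, e, ← h, ← mul_assoc,
    ENNReal.mul_inv_cancel (meanSigma_ne_zero hB) (meanSigma_lt_top hB).ne, one_mul]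
  rfl

/-- The mean of a real function of the jump in equilibrium. -/
def velocity (μ : Measure (PMF (Site d))) [IsProbabilityMeasure μ] (u : Fin d → ℝ)
    (r : Site d → ℝ) : ℝ := (meanJump μ u (posPart r)).toReal - (meanJump μ u (posPart (-r))).toReal

/-- Each coordinate is split into positive and negative parts, each with equilibrium mean at most
`M`; the drift is their difference wherever the first moment is finite. -/
lemma integral_drift (hB : Ballistic μ u K ε M) :
    Integrable drift (equilibrium μ u) ∧
      ∫ ω, drift ω ∂equilibrium μ u = fun i => velocity μ u (coord i) := by
  have hfin : ∀ {r : Site d → ℝ}, (∀ z, |r z| ≤ len z) →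
      ∫⁻ ω, jumpMean (posPart r) ω ∂equilibrium μ u ≠ ∞ := fun hr =>
    ne_top_of_le_ne_top ENNReal.ofReal_ne_top (meanJump_le hB (posPart_le_len hr))
  have hint : ∀ {r : Site d → ℝ}, (∀ z, |r z| ≤ len z) →
      Integrable (fun ω => (jumpMean (posPart r) ω).toReal) (equilibrium μ u) ∧
      ∫ ω, (jumpMean (posPart r) ω).toReal ∂equilibrium μ u =
        (meanJump μ u (posPart r)).toReal := fun hr =>
    ⟨integrable_toReal_of_lintegral_ne_top (measurable_jumpMean _).aemeasurable (hfin hr),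
      integral_toReal (measurable_jumpMean _).aemeasurable
        (ae_lt_top (measurable_jumpMean _) (hfin hr))⟩
  have hp := fun i : Fin d => hint (abs_coord_le i)
  have hn := fun i : Fin d => hint (r := -coord i) fun z => by simpa using abs_coord_le i z
  have e : ∀ i, (fun ω => drift ω i) =ᵐ[equilibrium μ u] fun ω =>
      (jumpMean (posPart (coord i)) ω).toReal - (jumpMean (posPart (-coord i)) ω).toReal := by
    intro i
    filter_upwards [ae_equilibrium_jumpMean_le hB] with ω hω
    exact drift_apply (ne_top_of_le_ne_top ENNReal.ofReal_ne_top hω) i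
  have hi : ∀ i, Integrable (fun ω => drift ω i) (equilibrium μ u) := fun i =>
    ((hp i).1.sub (hn i).1).congr (e i).symm
  refine ⟨Integrable.of_eval hi, funext fun i => ?_⟩
  rw [eval_integral hi, integral_congr_ae (e i), integral_sub (hp i).1 (hn i).1, (hp i).2,
    (hn i).2, velocity]

lemma integral_blockSum_jump (hB : Ballistic μ u K ε M) {r : Site d → ℝ}
    (hr : ∀ z, |r z| ≤ len z) :
    Integrable (blockSum u 0 (jump r)) (annealedLaw (iidEnvLaw μ) 0) ∧
      ∫ s, blockSum u 0 (jump r) s ∂annealedLaw (iidEnvLaw μ) 0 =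
        (meanSigma μ u).toReal * velocity μ u r := by
  have hm : ∀ r : Site d → ℝ, AEMeasurable (blockSum u 0 (jump (posPart r)))
      (annealedLaw (iidEnvLaw μ) 0) := fun r =>
    (measurable_blockSum u 0 (measurable_jump _)).aemeasurable
  have hint : ∀ {r : Site d → ℝ}, (∀ z, |r z| ≤ len z) →
      Integrable (fun s => (blockSum u 0 (jump (posPart r)) s).toReal)
        (annealedLaw (iidEnvLaw μ) 0) ∧
      ∫ s, (blockSum u 0 (jump (posPart r)) s).toReal ∂annealedLaw (iidEnvLaw μ) 0 =
        (meanSigma μ u).toReal * (meanJump μ u (posPart r)).toReal := by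
    intro r hr
    have h := lintegral_blockSum_jump_eq hB (posPart r)
    have hfin : ∫⁻ s, blockSum u 0 (jump (posPart r)) s ∂annealedLaw (iidEnvLaw μ) 0 ≠ ∞ := by
      rw [h]
      exact ENNReal.mul_ne_top (meanSigma_lt_top hB).ne
        (ne_top_of_le_ne_top ENNReal.ofReal_ne_top (meanJump_le hB (posPart_le_len hr)))
    refine ⟨integrable_toReal_of_lintegral_ne_top (hm r) hfin, ?_⟩
    rw [integral_toReal (hm r) (ae_lt_top' (hm r) hfin), h, ENNReal.toReal_mul]
  have e : blockSum u 0 (jump r) = fun s : Env d × Path d =>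
      (blockSum u 0 (jump (posPart r)) s).toReal -
        (blockSum u 0 (jump (posPart (-r))) s).toReal := by
    funext s
    have ht : ∀ (r : Site d → ℝ) (n : ℕ), jump (posPart r) (seenFrom n s) ≠ ∞ := fun r n =>
      posPart_ne_top _ _
    simp only [blockSum]
    rw [ENNReal.toReal_sum fun n _ => ht r n, ENNReal.toReal_sum fun n _ => ht (-r) n,
      ← Finset.sum_sub_distrib]
    exact Finset.sum_congr rfl fun n _ => (toReal_posPart_sub r _).symm
  have hp := hint hr
  have hn := hint (r := -r) fun z => by simpa using hr z
  rw [e]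
  refine ⟨hp.1.sub hn.1, ?_⟩
  rw [integral_sub hp.1 hn.1, hp.2, hn.2, velocity, mul_sub]

lemma sum_jump_coord (i : Fin d) (s : Env d × Path d) (n : ℕ) :
    ∑ k ∈ Finset.range n, jump (coord i) (seenFrom k s) = coord i (s.2 n) - coord i (s.2 0) := by
  simp only [jump_seenFrom]
  rw [← Finset.sum_range_sub (fun k => coord i (s.2 k))]
  refine Finset.sum_congr rfl fun k _ => ?_
  simp [coord]

/-- The first block ends at `σ_1`, so its jumps telescope to the position at that time. -/
lemma integral_posSigma1 (hB : Ballistic μ u K ε M) :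
    Integrable (fun s => toReal (posSigma1 u s.2)) (annealedLaw (iidEnvLaw μ) 0) ∧
      ∫ s, toReal (posSigma1 u s.2) ∂annealedLaw (iidEnvLaw μ) 0 =
        fun i => (meanSigma μ u).toReal * velocity μ u (coord i) := by
  have e : ∀ i, (fun s : Env d × Path d => toReal (posSigma1 u s.2) i)
      =ᵐ[annealedLaw (iidEnvLaw μ) 0] blockSum u 0 (jump (coord i)) := by
    intro i
    filter_upwards [hB.annealedLaw_ae_regular] with s hs
    rw [blockSum, reg_zero, zero_add, reg_one hs.zero, ← Finset.range_eq_Ico, sum_jump_coord,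
      hs.zero]
    simp [coord, toReal, posSigma1, sig]
  have h := fun i : Fin d => integral_blockSum_jump hB (abs_coord_le i)
  have hi : ∀ i, Integrable (fun s : Env d × Path d => toReal (posSigma1 u s.2) i)
      (annealedLaw (iidEnvLaw μ) 0) := fun i => (h i).1.congr (e i).symm
  refine ⟨Integrable.of_eval hi, funext fun i => ?_⟩
  rw [eval_integral hi, integral_congr_ae (e i), (h i).2]

lemma ae_tendsto_position (hB : Ballistic μ u K ε M) :
    ∀ᵐ s ∂annealedLaw (iidEnvLaw μ) 0,
      Tendsto (fun n : ℕ => (n : ℝ)⁻¹ • toReal (s.2 n)) atTop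
        (𝓝 fun i => velocity μ u (coord i)) := by
  have h : ∀ i : Fin d, ∀ᵐ s ∂annealedLaw (iidEnvLaw μ) 0, Tendsto (fun N : ℕ =>
      (∑ k ∈ Finset.range N, jump (coord i) (seenFrom k s)) / N) atTop
      (𝓝 (velocity μ u (coord i))) := by
    intro i
    have h1 := ae_tendsto_average hB (measurable_jump (coord i)) (stepLocal_jump u _)
      (measurable_jump len) (stepLocal_jump u _) (fun s => abs_coord_le i _)
      (integral_blockSum_jump hB (r := len) fun z => (abs_of_nonneg (l1_nonneg _)).le).1
    rwa [(integral_blockSum_jump hB (abs_coord_le i)).2,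
      mul_div_cancel_left₀ _ (toReal_meanSigma_pos hB).ne'] at h1
  filter_upwards [ae_all_iff.2 h, hB.annealedLaw_ae_regular] with s hs hreg
  refine tendsto_pi_nhds.2 fun i => (hs i).congr fun n => ?_
  rw [sum_jump_coord, hreg.zero]
  simp [coord, toReal, div_eq_inv_mul]

/-! ### The bounded error of the mean position -/

lemma lintegral_jump_seenFrom_le (hB : Ballistic μ u K ε M) {g : Site d → ℝ≥0∞}
    (hg : ∀ z, g z ≤ posPart len z) (k : ℕ) :
    ∫⁻ s, jump g (seenFrom k s) ∂annealedLaw (iidEnvLaw μ) 0 ≤ ENNReal.ofReal M := by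
  have h := lintegral_jump_le (c := ENNReal.ofReal M) (g := g)
    (by
      filter_upwards [hB.ae_jumpMean_shift_le] with ω hω x
      exact (jumpMean_mono hg _).trans (hω x)) k (F := fun _ => 1) measurable_const
    fun _ _ _ => rfl
  simpa [jump_seenFrom] using h

lemma integrable_jump_seenFrom (hB : Ballistic μ u K ε M) {r : Site d → ℝ}
    (hr : ∀ z, |r z| ≤ len z) (k : ℕ) :
    Integrable (fun s => jump r (seenFrom k s)) (annealedLaw (iidEnvLaw μ) 0) := by
  have m : Measurable fun s : Env d × Path d => jump r (seenFrom k s) :=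
    (measurable_jump r).comp (measurable_seenFrom k)
  refine ⟨m.aestronglyMeasurable, ?_⟩
  rw [hasFiniteIntegral_iff_norm]
  refine lt_of_le_of_lt ?_ (ENNReal.ofReal_lt_top (r := M))
  exact lintegral_jump_seenFrom_le hB (g := fun z => ENNReal.ofReal ‖r z‖)
    (fun z => ENNReal.ofReal_le_ofReal (hr z)) k

/-- With `C = (1 + K) / ε`, `S` the sum of means, `a` the equilibrium mean and `w` the mean total
length of the blocks begun before `n`: `S ≤ w * a ≤ S + M * C` and `n ≤ w ≤ n + C`. Since `a ≤ M`,
each of the two deviations costs at most `M * C`, and they act in opposite directions. -/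
lemma abs_sum_toReal_sub_le (hB : Ballistic μ u K ε M) {g : Site d → ℝ≥0∞}
    (hg : ∀ z, g z ≤ posPart len z) (n : ℕ) :
    |∑ k ∈ Finset.range n, (∫⁻ s, jump g (seenFrom k s) ∂annealedLaw (iidEnvLaw μ) 0).toReal -
      n * (meanJump μ u g).toReal| ≤ M * ((1 + K) / ε) := by
  have hC : 0 ≤ (1 + K) / ε := div_nonneg (by linarith [hB.K_nonneg]) hB.ε_pos.le
  have hM := hB.M_nonneg
  have hne : ∀ k ∈ Finset.range n,
      ∫⁻ s, jump g (seenFrom k s) ∂annealedLaw (iidEnvLaw μ) 0 ≠ ∞ := fun k _ =>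
    ne_top_of_le_ne_top ENNReal.ofReal_ne_top (lintegral_jump_seenFrom_le hB hg k)
  obtain ⟨h1, h2⟩ := lintegral_sum_jump_bounds hB (c := ENNReal.ofReal M) (g := g)
    (by
      filter_upwards [hB.ae_jumpMean_shift_le] with ω hω x
      exact (jumpMean_mono hg _).trans (hω x)) n
  obtain ⟨h3, h4⟩ := meanBlocks_bounds hB n
  have h5 := meanJump_le hB hg
  rw [lintegral_blockSum_jump_eq hB, ← mul_assoc] at h1 h2
  rw [← ENNReal.toReal_sum hne]
  have hS : ∑ k ∈ Finset.range n, ∫⁻ s, jump g (seenFrom k s) ∂annealedLaw (iidEnvLaw μ) 0 ≠ ∞ :=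
    ENNReal.sum_ne_top.2 hne
  set S := ∑ k ∈ Finset.range n, ∫⁻ s, jump g (seenFrom k s) ∂annealedLaw (iidEnvLaw μ) 0
  set w := meanBlocks μ u n * meanSigma μ u
  set a := meanJump μ u g
  have hw : w ≠ ∞ := ne_top_of_le_ne_top (by simp) h4
  have ha : a ≠ ∞ := ne_top_of_le_ne_top ENNReal.ofReal_ne_top h5
  have r1 := ENNReal.toReal_mono (ENNReal.mul_ne_top hw ha) h1
  have r2 := ENNReal.toReal_mono (by
    exact ENNReal.add_ne_top.2 ⟨hS, ENNReal.mul_ne_top ENNReal.ofReal_ne_top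
      ENNReal.ofReal_ne_top⟩) h2
  have r3 := ENNReal.toReal_mono hw h3
  have r4 := ENNReal.toReal_mono (by simp) h4
  have r5 := ENNReal.toReal_mono ENNReal.ofReal_ne_top h5
  rw [ENNReal.toReal_add hS (ENNReal.mul_ne_top ENNReal.ofReal_ne_top ENNReal.ofReal_ne_top)] at r2
  rw [ENNReal.toReal_add (by simp) ENNReal.ofReal_ne_top] at r4
  simp only [ENNReal.toReal_mul, ENNReal.toReal_natCast, ENNReal.toReal_ofReal hM,
    ENNReal.toReal_ofReal hC] at r1 r2 r3 r4 r5
  have ha0 : 0 ≤ a.toReal := ENNReal.toReal_nonneg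
  have p1 := mul_le_mul_of_nonneg_right r3 ha0
  have p2 := mul_le_mul_of_nonneg_right r4 ha0
  have p3 := mul_le_mul_of_nonneg_right r5 hC
  rw [abs_le]
  constructor <;> linarith

/-- The factor `2` comes from treating the positive and negative parts separately. -/
lemma abs_sum_integral_sub_le (hB : Ballistic μ u K ε M) {r : Site d → ℝ}
    (hr : ∀ z, |r z| ≤ len z) (n : ℕ) :
    |∑ k ∈ Finset.range n, ∫ s, jump r (seenFrom k s) ∂annealedLaw (iidEnvLaw μ) 0 -
      n * velocity μ u r| ≤ 2 * (M * ((1 + K) / ε)) := by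
  have e : ∀ k, ∫ s, jump r (seenFrom k s) ∂annealedLaw (iidEnvLaw μ) 0 =
      (∫⁻ s, jump (posPart r) (seenFrom k s) ∂annealedLaw (iidEnvLaw μ) 0).toReal -
      (∫⁻ s, jump (posPart (-r)) (seenFrom k s) ∂annealedLaw (iidEnvLaw μ) 0).toReal := fun k =>
    integral_eq_lintegral_pos_part_sub_lintegral_neg_part (integrable_jump_seenFrom hB hr k)
  have h1 := abs_sum_toReal_sub_le hB (posPart_le_len hr) n
  have h2 := abs_sum_toReal_sub_le hB (posPart_le_len (r := -r) fun z => by simpa using hr z) n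
  simp only [e, Finset.sum_sub_distrib, velocity]
  rw [abs_le] at h1 h2 ⊢
  constructor <;> linarith [h1.1, h1.2, h2.1, h2.2]

lemma integral_position (hB : Ballistic μ u K ε M) (n : ℕ) :
    Integrable (fun s => toReal (s.2 n)) (annealedLaw (iidEnvLaw μ) 0) ∧
      ∫ s, toReal (s.2 n) ∂annealedLaw (iidEnvLaw μ) 0 = fun i =>
        ∑ k ∈ Finset.range n, ∫ s, jump (coord i) (seenFrom k s) ∂annealedLaw (iidEnvLaw μ) 0 := by
  have e : ∀ i, (fun s : Env d × Path d => toReal (s.2 n) i) =ᵐ[annealedLaw (iidEnvLaw μ) 0]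
      fun s => ∑ k ∈ Finset.range n, jump (coord i) (seenFrom k s) := by
    intro i
    filter_upwards [hB.annealedLaw_ae_regular] with s hs
    rw [sum_jump_coord, hs.zero]
    simp [coord, toReal]
  have hk := fun (i : Fin d) k => integrable_jump_seenFrom hB (abs_coord_le i) k
  have hi : ∀ i, Integrable (fun s : Env d × Path d => toReal (s.2 n) i)
      (annealedLaw (iidEnvLaw μ) 0) := fun i =>
    (integrable_finsetSum _ fun k _ => hk i k).congr (e i).symm
  refine ⟨Integrable.of_eval hi, funext fun i => ?_⟩
  rw [eval_integral hi, integral_congr_ae (e i), integral_finsetSum _ fun k _ => hk i k]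

lemma l1_integral_position_sub_le (hB : Ballistic μ u K ε M) (n : ℕ) :
    l1 ((∫ s, toReal (s.2 n) ∂annealedLaw (iidEnvLaw μ) 0) -
      (n : ℝ) • fun i => velocity μ u (coord i)) ≤ d * (2 * (M * ((1 + K) / ε))) := by
  rw [(integral_position hB n).2]
  refine (Finset.sum_le_sum fun i _ => abs_sum_integral_sub_le hB (abs_coord_le i) n).trans ?_
  simp

end

end RWRE

end

theorem mainTheorem5 {d : ℕ} (u : Fin d → ℝ) (hu : u ≠ 0)
    (μ : Measure (PMF (RWRE.Site d))) [IsProbabilityMeasure μ]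
    (hforb : RWRE.ForbiddenDirection (RWRE.iidEnvLaw μ) u)
    (hN : RWRE.NonNestling (RWRE.iidEnvLaw μ) u)
    (p : ℝ) (hp : 1 < p) (hM : RWRE.MomentHypothesis (RWRE.iidEnvLaw μ) p) :
    ∃ (Pinf : Measure (RWRE.Env d)) (v : Fin d → ℝ),
      -- the equilibrium measure exists and is unique, and the drift is integrable under it; `v = E_∞(D)`
      RWRE.IsEquilibrium (RWRE.iidEnvLaw μ) u Pinf ∧
      (∀ Q : Measure (RWRE.Env d), RWRE.IsEquilibrium (RWRE.iidEnvLaw μ) u Q → Q = Pinf) ∧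
      (∀ᵐ ω ∂Pinf, Summable fun z : RWRE.Site d => (ω 0 z).toReal • RWRE.toReal z) ∧
      Integrable RWRE.drift Pinf ∧
      v = ∫ ω, RWRE.drift ω ∂Pinf ∧
      -- the law of large numbers with limit `v`
      (∀ᵐ s ∂(RWRE.annealedLaw (RWRE.iidEnvLaw μ) 0),
        Tendsto (fun n : ℕ => (n : ℝ)⁻¹ • RWRE.toReal (s.2 n)) atTop
          (𝓝 v)) ∧
      -- `E_0(σ_1) < ∞` and `v = E_0(X_{σ_1}) / E_0(σ_1)`
      (∫⁻ s, (RWRE.sigma1 u s.2 : ℝ≥0∞) ∂(RWRE.annealedLaw (RWRE.iidEnvLaw μ) 0) < ∞) ∧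
      Integrable (fun s => RWRE.toReal (RWRE.posSigma1 u s.2))
        (RWRE.annealedLaw (RWRE.iidEnvLaw μ) 0) ∧
      (v =
        (∫⁻ s, (RWRE.sigma1 u s.2 : ℝ≥0∞) ∂(RWRE.annealedLaw (RWRE.iidEnvLaw μ) 0)).toReal⁻¹ •
          ∫ s, RWRE.toReal (RWRE.posSigma1 u s.2) ∂(RWRE.annealedLaw (RWRE.iidEnvLaw μ) 0)) ∧
      -- `sup_n |E_0(X_n) - n v| < ∞`
      (∀ n : ℕ, Integrable (fun s => RWRE.toReal (s.2 n))
        (RWRE.annealedLaw (RWRE.iidEnvLaw μ) 0)) ∧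
      ∃ C : ℝ, ∀ n : ℕ,
        RWRE.l1 ((∫ s, RWRE.toReal (s.2 n) ∂(RWRE.annealedLaw (RWRE.iidEnvLaw μ) 0)) -
          (n : ℝ) • v) ≤ C := by
  obtain ⟨K, ε, M, hB⟩ := RWRE.exists_ballistic μ u hforb hN hp hM
  obtain ⟨hD, hDv⟩ := RWRE.integral_drift hB
  obtain ⟨hX, hXv⟩ := RWRE.integral_posSigma1 hB
  refine ⟨RWRE.equilibrium μ u, fun i => RWRE.velocity μ u (RWRE.coord i),
    RWRE.isEquilibrium_equilibrium hB, fun Q hQ => hQ.eq_equilibrium hB, ?_, hD, hDv.symm,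
    RWRE.ae_tendsto_position hB, RWRE.meanSigma_lt_top hB, hX, ?_,
    fun n => (RWRE.integral_position hB n).1, _, RWRE.l1_integral_position_sub_le hB⟩
  · filter_upwards [RWRE.ae_equilibrium_jumpMean_le hB] with ω hω
    exact RWRE.summable_drift (ne_top_of_le_ne_top ENNReal.ofReal_ne_top hω)
  · rw [hXv]
    funext i
    exact (inv_mul_cancel_left₀ (RWRE.toReal_meanSigma_pos hB).ne' _).symm
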